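/- **Conventions.** A dg-category $J$ is a category enriched in cochain complexes of abelian groups, with $\deg(gf)=\deg f+\deg g$ and $d(gf)=(dg)f+(-1)^{\deg g}g(df)$; it is assumed to have finite sums. It is *negative* if it has no nonzero morphisms of positive degree. $H^0(J)$ has the objects of $J$ and $\hom_{H^0(J)}(X,Y)=H^0(\hom_J(X,Y))$. A *twisted complex* over $J$ is a family $P=\{(P^i)_{i\in\mathbb Z},q_{ij}\}$ of objects $P^i$ of $J$, almost all zero, and morphisms $q_{ij}:P^i\to P^j$ of degree $i-j+1$ such that $(-1)^jd\,q_{ij}+\sum_m q_{mj}q_{im}=0$ for all $i,j$. A morphism $f:P\to P'$ of degree $\ell$ is a matrix of morphisms $f_{ij}:P^i\to P'^j$ of degree $\ell+i-j$, with differential $(df)_{ij}=(-1)^jd(f_{ij})+\sum_m\bigl(q'_{mj}f_{im}-(-1)^{\ell}f_{mj}q_{im}\bigr)$; this gives a dg-category $\mathrm{Pre\text{-}Tr}(J)$, and $\mathrm{Tr}(J)=H^0(\mathrm{Pre\text{-}Tr}(J))$. The shift is $P[n]=\{(P^{i+n}),(-1)^nq_{i+n,j+n}\}$. For a closed $f:P\to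 P'$ of degree $0$, $\mathrm{Cone}(f)$ has objects $P^{i+1}\oplus P'^i$ and morphisms $\begin{pmatrix}-q_{i+1,j+1}&0\\ f_{i+1,j}&q'_{ij}\end{pmatrix}$, and the distinguished triangles of $\mathrm{Tr}(J)$ are those isomorphic to some $P\xrightarrow{f}P'\to\mathrm{Cone}(f)\to P[1]$. An object of $J$ is regarded as a twisted complex concentrated in degree $0$; this gives the canonical functor $H^0(J)\to\mathrm{Tr}(J)$. Let $\mathcal A$ be an abelian category. A *homological functor* $\mathcal H:\mathrm{Tr}(J)\to\mathcal A$ is an additive functor which sends every distinguished triangle $T_1\to T_2\to T_3\to T_1[1]$ to a long exact sequence $\cdots\to\mathcal H(T_1)\to\mathcal H(T_2)\to\mathcal H(T_3)\to\mathcal H(T_1[1])\to\mathcal H(T_2[1])\to\cdots$. It is *$J$-acyclic* if $\mathcal H(X[n])=0$ for every object $X$ of $J$ and every $n\ne0$. **Lemma.** Let $J$ be a negative dg-category and $\mathcal A$ an abelian category. 1. For every $J$-acyclic homological functor $\mathcal H:\mathrm{Tr}(J)\to\mathcal A$ and every twisted complex $P=\{(P^i),q_{ij}\}$ there is an isomorphism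 $$\mathcal H(P)\;\cong\;\frac{\ker\bigl(\mathcal H(P^0)\xrightarrow{\mathcal H(q_{01})}\mathcal H(P^1)\bigr)}{\mathrm{Im}\bigl(\mathcal H(P^{-1})\xrightarrow{\mathcal H(q_{-1,0})}\mathcal H(P^0)\bigr)},$$ natural in $P\in\mathrm{Tr}(J)$ and in $\mathcal H$, and equal to the identity of $\mathcal H(X)$ if $P$ is an object $X$ of $J$ concentrated in degree $0$. (On the right, a morphism of $\mathrm{Tr}(J)$ represented by $f$ acts through the classes of the $f_{ii}$ in $H^0(J)$.) 2. Composition with the canonical functor $H^0(J)\to\mathrm{Tr}(J)$ is an equivalence from the category of $J$-acyclic homological functors $\mathrm{Tr}(J)\to\mathcal A$ to the category of additive functors $H^0(J)\to\mathcal A$ (morphisms being all natural transformations in both cases). -/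

import Mathlib

open CategoryTheory CategoryTheory.Limits

noncomputable section

universe w₂ w₁ v u

/-- A (cohomological) differential graded category: for every pair of objects a complex of
abelian groups `(Hom X Y n)_n` with differential `d` of degree `+1`, a bilinear associative unital
composition of degree zero (written in diagrammatic order: `comp f g` is `g ∘ f`), and the Leibniz
rule `d (g ∘ f) = (d g) ∘ f + (-1) ^ deg g • g ∘ (d f)`.
The degree of a composite or of a differential is given by an arbitrary integer, together with a
proof that it is the right one. -/
class DGCategory (J : Type u) where
  Hom : J → J → ℤ → Type v
  [addCommGroup : ∀ X Y n, AddCommGroup (Hom X Y n)]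
  id : ∀ X, Hom X X 0
  comp : ∀ {X Y Z : J} {m n p : ℤ}, Hom X Y m → Hom Y Z n → m + n = p → Hom X Z p
  d : ∀ {X Y : J} (m n : ℤ), m + 1 = n → (Hom X Y m →+ Hom X Y n)
  add_comp : ∀ {X Y Z : J} {m n p : ℤ} (f f' : Hom X Y m) (g : Hom Y Z n) (h : m + n = p),
    comp (f + f') g h = comp f g h + comp f' g h
  comp_add : ∀ {X Y Z : J} {m n p : ℤ} (f : Hom X Y m) (g g' : Hom Y Z n) (h : m + n = p),
    comp f (g + g') h = comp f g h + comp f g' h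
  id_comp : ∀ {X Y : J} {n : ℤ} (f : Hom X Y n), comp (id X) f (zero_add n) = f
  comp_id : ∀ {X Y : J} {n : ℤ} (f : Hom X Y n), comp f (id Y) (add_zero n) = f
  assoc : ∀ {X Y Z W : J} {m n p mn np mnp : ℤ} (f : Hom X Y m) (g : Hom Y Z n) (k : Hom Z W p)
    (h₁ : m + n = mn) (h₂ : n + p = np) (h₃ : mn + p = mnp) (h₄ : m + np = mnp),
    comp (comp f g h₁) k h₃ = comp f (comp g k h₂) h₄
  d_d : ∀ {X Y : J} (m n p : ℤ) (h : m + 1 = n) (h' : n + 1 = p) (f : Hom X Y m),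
    d n p h' (d m n h f) = 0
  d_comp : ∀ {X Y Z : J} {m n p m' n' p' : ℤ} (f : Hom X Y m) (g : Hom Y Z n) (h : m + n = p)
    (hm : m + 1 = m') (hn : n + 1 = n') (hp : p + 1 = p'),
    d p p' hp (comp f g h) = comp f (d n n' hn g) (by omega) +
      n.negOnePow • comp (d m m' hm f) g (by omega)

namespace DGCategory

attribute [reducible, instance] addCommGroup

section Basic

variable {J : Type u} [DGCategory.{v} J] {X Y Z : J} {m n p : ℤ}

/-- Postcomposition as an additive map. -/
def compR (X : J) (g : Hom Y Z n) (h : m + n = p) : Hom X Y m →+ Hom X Z p :=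
  AddMonoidHom.mk' (fun f => comp f g h) (fun f f' => add_comp f f' g h)

/-- Precomposition as an additive map. -/
def compL (Z : J) (f : Hom X Y m) (h : m + n = p) : Hom Y Z n →+ Hom X Z p :=
  AddMonoidHom.mk' (fun g => comp f g h) (fun g g' => comp_add f g g' h)

@[simp] lemma zero_comp (g : Hom Y Z n) (h : m + n = p) : comp (0 : Hom X Y m) g h = 0 :=
  (compR X g h).map_zero

@[simp] lemma comp_zero (f : Hom X Y m) (h : m + n = p) : comp f (0 : Hom Y Z n) h = 0 :=
  (compL Z f h).map_zero

@[simp] lemma neg_comp (f : Hom X Y m) (g : Hom Y Z n) (h : m + n = p) :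
    comp (-f) g h = - comp f g h :=
  (compR X g h).map_neg f

@[simp] lemma comp_neg (f : Hom X Y m) (g : Hom Y Z n) (h : m + n = p) :
    comp f (-g) h = - comp f g h :=
  (compL Z f h).map_neg g

lemma sub_comp (f f' : Hom X Y m) (g : Hom Y Z n) (h : m + n = p) :
    comp (f - f') g h = comp f g h - comp f' g h :=
  (compR X g h).map_sub f f'

lemma comp_sub (f : Hom X Y m) (g g' : Hom Y Z n) (h : m + n = p) :
    comp f (g - g') h = comp f g h - comp f g' h :=
  (compL Z f h).map_sub g g'

lemma sum_comp {ι : Type*} (s : Finset ι) (f : ι → Hom X Y m) (g : Hom Y Z n) (h : m + n = p) :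
    comp (∑ i ∈ s, f i) g h = ∑ i ∈ s, comp (f i) g h :=
  map_sum (compR X g h) f s

lemma comp_sum {ι : Type*} (s : Finset ι) (f : Hom X Y m) (g : ι → Hom Y Z n) (h : m + n = p) :
    comp f (∑ i ∈ s, g i) h = ∑ i ∈ s, comp f (g i) h :=
  map_sum (compL Z f h) g s

lemma units_smul_comp (a : ℤˣ) (f : Hom X Y m) (g : Hom Y Z n) (h : m + n = p) :
    comp (a • f) g h = a • comp f g h := by
  obtain rfl | rfl := Int.units_eq_one_or a <;> simp

lemma comp_units_smul (a : ℤˣ) (f : Hom X Y m) (g : Hom Y Z n) (h : m + n = p) :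
    comp f (a • g) h = a • comp f g h := by
  obtain rfl | rfl := Int.units_eq_one_or a <;> simp

lemma d_units_smul (a : ℤˣ) (f : Hom X Y m) (h : m + 1 = n) :
    d m n h (a • f) = a • d m n h f := by
  obtain rfl | rfl := Int.units_eq_one_or a <;> simp

lemma comp_of_id_eq_zero (hY : id Y = 0) (f : Hom X Y m) (g : Hom Y Z n) (h : m + n = p) :
    comp f g h = 0 := by
  rw [← comp_id f, hY]; simp

lemma d_id (X : J) : d 0 1 (zero_add 1) (id X) = 0 := by
  have h := d_comp (id X) (id X) (add_zero 0) (zero_add 1) (zero_add 1) (zero_add 1)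
  rw [comp_id, Int.negOnePow_zero, one_smul, comp_id, id_comp] at h
  simpa using h

end Basic

/-- A direct sum of `X` and `Y` in a dg-category (with closed structure morphisms of degree
zero). -/
structure BinarySum {J : Type u} [DGCategory.{v} J] (X Y : J) where
  pt : J
  inl : Hom X pt 0
  inr : Hom Y pt 0
  fst : Hom pt X 0
  snd : Hom pt Y 0
  inl_fst : comp inl fst (add_zero 0) = id X
  inr_snd : comp inr snd (add_zero 0) = id Y
  inl_snd : comp inl snd (add_zero 0) = 0
  inr_fst : comp inr fst (add_zero 0) = 0
  total : comp fst inl (add_zero 0) + comp snd inr (add_zero 0) = id pt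
  d_inl : d 0 1 (zero_add 1) inl = 0
  d_inr : d 0 1 (zero_add 1) inr = 0
  d_fst : d 0 1 (zero_add 1) fst = 0
  d_snd : d 0 1 (zero_add 1) snd = 0

/-- The dg-category has finite sums: a zero object (an object whose identity vanishes) and binary
direct sums. -/
class HasFiniteSums (J : Type u) [DGCategory.{v} J] : Prop where
  exists_zero : ∃ Z : J, id Z = 0
  exists_sum : ∀ X Y : J, Nonempty (BinarySum X Y)

/-- A dg-category is negative if it has no nonzero morphisms of pure positive degree. -/
class IsNegative (J : Type u) [DGCategory.{v} J] : Prop where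
  eq_zero : ∀ {X Y : J} {n : ℤ}, 0 < n → ∀ f : Hom X Y n, f = 0

/-- A chosen zero object. -/
def zeroObj (J : Type u) [DGCategory.{v} J] [HasFiniteSums J] : J :=
  (HasFiniteSums.exists_zero (J := J)).choose

lemma id_zeroObj (J : Type u) [DGCategory.{v} J] [HasFiniteSums J] : id (zeroObj J) = 0 :=
  (HasFiniteSums.exists_zero (J := J)).choose_spec

/-- A chosen direct sum. -/
def binarySum {J : Type u} [DGCategory.{v} J] [HasFiniteSums J] (X Y : J) : BinarySum X Y :=
  (HasFiniteSums.exists_sum X Y).some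

/-! ### The category `H⁰(J)` -/

section HZero

variable {J : Type u} [DGCategory.{v} J]

/-- The closed morphisms of degree zero. -/
def cocycles (X Y : J) : AddSubgroup (Hom X Y 0) := (d 0 1 (zero_add 1)).ker

/-- The morphisms `d w`, with `w` of degree `-1`, as a subgroup of the closed morphisms of degree
zero. -/
def coboundaries (X Y : J) : AddSubgroup (cocycles X Y) :=
  (d (X := X) (Y := Y) (-1) 0 (neg_add_cancel 1)).range.addSubgroupOf (cocycles X Y)

lemma mem_cocycles {X Y : J} (f : Hom X Y 0) : f ∈ cocycles X Y ↔ d 0 1 (zero_add 1) f = 0 :=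
  Iff.rfl

lemma mem_coboundaries {X Y : J} (f : cocycles X Y) :
    f ∈ coboundaries X Y ↔ ∃ w, d (-1) 0 (neg_add_cancel 1) w = f.1 :=
  Iff.rfl

/-- Composition of closed morphisms of degree zero. -/
def cocyclesComp {X Y Z : J} (f : cocycles X Y) (g : cocycles Y Z) : cocycles X Z :=
  ⟨comp f.1 g.1 (add_zero 0), by
    have hf := f.2
    have hg := g.2
    rw [mem_cocycles] at hf hg ⊢
    rw [d_comp f.1 g.1 (add_zero 0) (zero_add 1) (zero_add 1) (zero_add 1), hf, hg]
    simp⟩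

/-- The identity as a closed morphism. -/
def cocyclesId (X : J) : cocycles X X := ⟨id X, d_id X⟩

/-- The objects of the category `H⁰(J)`: those of `J`. -/
@[ext] structure HZero (J : Type u) where
  of ::
  obj : J

lemma cocyclesComp_congr {X Y Z : J} {f f' : cocycles X Y} {g g' : cocycles Y Z}
    (hf : -f + f' ∈ coboundaries X Y) (hg : -g + g' ∈ coboundaries Y Z) :
    -cocyclesComp f g + cocyclesComp f' g' ∈ coboundaries X Z := by
  rw [mem_coboundaries] at hf hg ⊢
  obtain ⟨a, ha⟩ := hf
  obtain ⟨b, hb⟩ := hg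
  refine ⟨comp a g'.1 (add_zero (-1)) + comp f.1 b (zero_add (-1)), ?_⟩
  have hf := f.2
  have hg := g'.2
  rw [mem_cocycles] at hf hg
  rw [map_add, d_comp a g'.1 (add_zero (-1)) (neg_add_cancel 1) (zero_add 1) (neg_add_cancel 1),
    d_comp f.1 b (zero_add (-1)) (zero_add 1) (neg_add_cancel 1) (neg_add_cancel 1), ha, hb, hf, hg]
  simp only [AddSubgroup.coe_add, AddSubgroup.coe_neg, cocyclesComp, add_comp, comp_add, neg_comp,
    comp_neg, comp_zero, zero_comp, smul_zero, add_zero, zero_add, Int.negOnePow_zero, one_smul]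
  abel

/-- The category `H⁰(J)`: a morphism is a closed morphism of degree zero modulo the differentials
of the morphisms of degree `-1`. -/
instance : Category.{v} (HZero J) where
  Hom X Y := cocycles X.obj Y.obj ⧸ coboundaries X.obj Y.obj
  id X := QuotientAddGroup.mk (cocyclesId X.obj)
  comp f g := Quotient.map₂ cocyclesComp
    (fun _ _ hf _ _ hg => QuotientAddGroup.leftRel_apply.2
      (cocyclesComp_congr (QuotientAddGroup.leftRel_apply.1 hf)
        (QuotientAddGroup.leftRel_apply.1 hg))) f g
  id_comp f := by
    induction f using QuotientAddGroup.induction_on with | H f =>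
    exact congrArg QuotientAddGroup.mk (Subtype.ext (id_comp f.1))
  comp_id f := by
    induction f using QuotientAddGroup.induction_on with | H f =>
    exact congrArg QuotientAddGroup.mk (Subtype.ext (comp_id f.1))
  assoc f g k := by
    induction f using QuotientAddGroup.induction_on with | H f =>
    induction g using QuotientAddGroup.induction_on with | H g =>
    induction k using QuotientAddGroup.induction_on with | H k =>
    exact congrArg QuotientAddGroup.mk (Subtype.ext (assoc f.1 g.1 k.1 _ _ _ _))

namespace HZero

instance (X Y : HZero J) : AddCommGroup (X ⟶ Y) :=
  inferInstanceAs (AddCommGroup (cocycles X.obj Y.obj ⧸ coboundaries X.obj Y.obj))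

/-- The class in `H⁰(J)` of a closed morphism of degree zero. -/
def mk {X Y : J} : cocycles X Y →+ (of X ⟶ of Y) := QuotientAddGroup.mk' (coboundaries X Y)

lemma mk_surjective {X Y : J} (f : of X ⟶ of Y) : ∃ g, mk g = f :=
  QuotientAddGroup.mk'_surjective _ f

lemma mk_eq_zero {X Y : J} (f : cocycles X Y) :
    mk f = 0 ↔ ∃ w, d (-1) 0 (neg_add_cancel 1) w = f.1 :=
  (QuotientAddGroup.eq_zero_iff f).trans (mem_coboundaries f)

lemma mk_comp {X Y Z : J} (f : cocycles X Y) (g : cocycles Y Z) :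
    mk (cocyclesComp f g) = mk f ≫ mk g := rfl

lemma mk_id (X : J) : mk (cocyclesId X) = 𝟙 (of X) := rfl

instance : Preadditive (HZero J) where
  add_comp X Y Z f f' g := by
    obtain ⟨f, rfl⟩ := mk_surjective f
    obtain ⟨f', rfl⟩ := mk_surjective f'
    obtain ⟨g, rfl⟩ := mk_surjective g
    rw [← map_add, ← mk_comp, ← mk_comp, ← mk_comp, ← map_add]
    exact congrArg mk (Subtype.ext (add_comp _ _ _ _))
  comp_add X Y Z f g g' := by
    obtain ⟨f, rfl⟩ := mk_surjective f
    obtain ⟨g, rfl⟩ := mk_surjective g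
    obtain ⟨g', rfl⟩ := mk_surjective g'
    rw [← map_add, ← mk_comp, ← mk_comp, ← mk_comp, ← map_add]
    exact congrArg mk (Subtype.ext (comp_add _ _ _ _))

/-- In a negative dg-category, every morphism of degree zero is closed, and so it has a class in
`H⁰(J)`. -/
def mk₀ [IsNegative J] {X Y : J} : Hom X Y 0 →+ (of X ⟶ of Y) :=
  mk.comp (AddMonoidHom.mk' (fun f => ⟨f, IsNegative.eq_zero one_pos _⟩) (fun _ _ => rfl))

end HZero

end HZero

/-! ### dg-functors -/

/-- A dg-functor: a functor that is additive on morphisms, preserves degrees and commutes with the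
differentials. -/
structure DGFunctor (J : Type*) (K : Type*) [DGCategory.{w₁} J] [DGCategory.{w₂} K] where
  obj : J → K
  map : ∀ {X Y : J} {n : ℤ}, Hom X Y n →+ Hom (obj X) (obj Y) n
  map_id : ∀ X, map (id X) = id (obj X)
  map_comp : ∀ {X Y Z : J} {m n p : ℤ} (f : Hom X Y m) (g : Hom Y Z n) (h : m + n = p),
    map (comp f g h) = comp (map f) (map g) h
  map_d : ∀ {X Y : J} (m n : ℤ) (h : m + 1 = n) (f : Hom X Y m),
    map (d m n h f) = d m n h (map f)

namespace DGFunctor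

variable {J : Type*} {K : Type*} [DGCategory.{w₁} J] [DGCategory.{w₂} K] (F : DGFunctor J K)

/-- The action of a dg-functor on closed morphisms of degree zero. -/
def mapCocycles {X Y : J} : cocycles X Y →+ cocycles (F.obj X) (F.obj Y) :=
  AddMonoidHom.mk' (fun f => ⟨F.map f.1, by
      have hf := f.2
      rw [mem_cocycles] at hf ⊢
      rw [← F.map_d, hf, map_zero]⟩)
    (fun _ _ => Subtype.ext (map_add _ _ _))

/-- The functor `H⁰(J) ⥤ H⁰(K)` induced by a dg-functor. -/
def hZero : HZero J ⥤ HZero K where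
  obj X := HZero.of (F.obj X.obj)
  map {X Y} := QuotientAddGroup.map _ _ F.mapCocycles (by
    intro f hf
    obtain ⟨w, hw⟩ := (mem_coboundaries f).1 hf
    refine (mem_coboundaries _).2 ⟨F.map w, ?_⟩
    rw [← F.map_d, hw]
    rfl)
  map_id X := congrArg HZero.mk (Subtype.ext (F.map_id X.obj))
  map_comp f g := by
    obtain ⟨f, rfl⟩ := HZero.mk_surjective f
    obtain ⟨g, rfl⟩ := HZero.mk_surjective g
    exact congrArg HZero.mk (Subtype.ext (F.map_comp f.1 g.1 _))

instance : F.hZero.Additive where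
  map_add := map_add _ _ _

end DGFunctor

/-! ### Bounded families of objects and matrices of morphisms -/

/-- A family `(P^i)_{i ∈ ℤ}` of objects of `J`, almost all of which are zero. -/
structure Family (J : Type u) [DGCategory.{v} J] where
  X : ℤ → J
  finite : {i | id (X i) ≠ 0}.Finite

namespace Family

variable {J : Type u} [DGCategory.{v} J]

/-- A morphism of degree `ℓ` from `⨁ P^i` to `⨁ Q^j` is a matrix whose entry `P^i ⟶ Q^j` has degree
`ℓ + i - j`. (The entry is indexed by `i`, `j` and by its degree `n`, which is the unique integer
with `n + j = i + ℓ`.) -/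
abbrev Mat (P Q : Family J) (ℓ : ℤ) : Type v :=
  ∀ (i j : ℤ) (n : {n : ℤ // n + j = i + ℓ}), Hom (P.X i) (Q.X j) n.1

/-- The product of matrices. -/
def matComp {P Q R : Family J} {k l r : ℤ} (f : Mat P Q k) (g : Mat Q R l) (h : k + l = r) :
    Mat P R r := fun i j n =>
  ∑ᶠ m : ℤ, comp (f i m ⟨i + k - m, by omega⟩) (g m j ⟨m + l - j, by omega⟩)
    (show (i + k - m) + (m + l - j) = n.1 by have := n.2; omega)

lemma matComp_apply {P Q R : Family J} {k l r : ℤ} (f : Mat P Q k) (g : Mat Q R l)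
    (h : k + l = r) (i j n : ℤ) (hn : n + j = i + r) (s : Finset ℤ)
    (hs : Q.finite.toFinset ⊆ s) :
    matComp f g h i j ⟨n, hn⟩ =
      ∑ m ∈ s, comp (f i m ⟨i + k - m, by omega⟩) (g m j ⟨m + l - j, by omega⟩)
        (show (i + k - m) + (m + l - j) = n by omega) := by
  apply finsum_eq_sum_of_support_subset
  intro m hm
  by_contra hms
  apply hm
  apply comp_of_id_eq_zero
  by_contra hid
  exact hms (hs (Q.finite.mem_toFinset.2 hid))

/-- A diagonal matrix of morphisms of degree zero. -/
def diag {P Q : Family J} (a : ∀ i, Hom (P.X i) (Q.X i) 0) : Mat P Q 0 := fun i j ⟨n, hn⟩ =>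
  if hij : i = j then by
    obtain rfl : n = 0 := by omega
    subst hij
    exact a i
  else 0

lemma diag_self {P Q : Family J} (a : ∀ i, Hom (P.X i) (Q.X i) 0) (i : ℤ) (h : 0 + i = i + 0) :
    diag a i i ⟨0, h⟩ = a i := by
  simp [diag]

lemma diag_ne {P Q : Family J} (a : ∀ i, Hom (P.X i) (Q.X i) 0) {i j n : ℤ} (hij : i ≠ j)
    (h : n + j = i + 0) : diag a i j ⟨n, h⟩ = 0 := by
  simp [diag, hij]

lemma diag_comp {P Q R : Family J} (a : ∀ i, Hom (P.X i) (Q.X i) 0) {k : ℤ} (f : Mat Q R k)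
    (i j n : ℤ) (hn : n + j = i + k) :
    matComp (diag a) f (zero_add k) i j ⟨n, hn⟩ = comp (a i) (f i j ⟨n, hn⟩) (zero_add n) := by
  unfold matComp
  rw [finsum_eq_single _ i]
  · obtain rfl : i + k - j = n := by omega
    have : ∀ (z : ℤ) (hz : z + i = i + 0) (h : z + (i + k - j) = i + k - j),
        comp (diag a i i ⟨z, hz⟩) (f i j ⟨i + k - j, hn⟩) h =
          comp (a i) (f i j ⟨i + k - j, hn⟩) (zero_add _) := by
      intro z hz h
      obtain rfl : z = 0 := by omega
      rw [diag_self]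
    exact this _ _ _
  · intro m hm
    rw [diag_ne a hm.symm, zero_comp]

lemma comp_diag {P Q R : Family J} {k : ℤ} (f : Mat P Q k) (b : ∀ i, Hom (Q.X i) (R.X i) 0)
    (i j n : ℤ) (hn : n + j = i + k) :
    matComp f (diag b) (add_zero k) i j ⟨n, hn⟩ = comp (f i j ⟨n, hn⟩) (b j) (add_zero n) := by
  unfold matComp
  rw [finsum_eq_single _ j]
  · have : ∀ (y z : ℤ) (hy : y + j = i + k) (hz : z + j = j + 0) (h : y + z = n),
        comp (f i j ⟨y, hy⟩) (diag b j j ⟨z, hz⟩) h =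
          comp (f i j ⟨n, hn⟩) (b j) (add_zero n) := by
      intro y z hy hz h
      obtain rfl : z = 0 := by omega
      obtain rfl : y = n := by omega
      rw [diag_self]
    exact this _ _ _ _ _
  · intro m hm
    rw [diag_ne b hm, comp_zero]

/-- The identity matrix. -/
def matId (P : Family J) : Mat P P 0 := diag fun i => id (P.X i)

/-- The differential of a matrix: up to the sign `(-1) ^ j`, the differential of `J` is applied to
each entry `P^i ⟶ Q^j`. With this sign, which comes from the formal shifts of the objects `Q^j`,
the Leibniz rule holds for the product of matrices. -/
def matD {P Q : Family J} (k l : ℤ) (h : k + 1 = l) : Mat P Q k →+ Mat P Q l :=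
  AddMonoidHom.mk'
    (fun f i j n => j.negOnePow • d (n.1 - 1) n.1 (by omega)
      (f i j ⟨n.1 - 1, by have := n.2; omega⟩))
    (fun f g => by
      funext i j n
      simp)

lemma matD_apply {P Q : Family J} (k l : ℤ) (h : k + 1 = l) (f : Mat P Q k) (i j m n : ℤ)
    (hn : n + j = i + l) (hm : m + 1 = n) :
    matD k l h f i j ⟨n, hn⟩ = j.negOnePow • d m n hm (f i j ⟨m, by omega⟩) := by
  obtain rfl : m = n - 1 := by omega
  rfl

lemma matD_diag {P Q : Family J} (a : ∀ i, Hom (P.X i) (Q.X i) 0)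
    (ha : ∀ i, d 0 1 (zero_add 1) (a i) = 0) : matD 0 1 (zero_add 1) (diag a) = 0 := by
  funext i j ⟨n, hn⟩
  rw [matD_apply 0 1 _ _ i j (n - 1) n hn (by omega)]
  by_cases hij : i = j
  · subst hij
    obtain rfl : n = 1 := by omega
    have h : d 0 1 (zero_add 1) (diag a i i ⟨0, by omega⟩) = 0 := by rw [diag_self, ha]
    exact (congrArg (i.negOnePow • ·) h).trans (smul_zero _)
  · rw [diag_ne a hij, map_zero, smul_zero]
    rfl

/-- The dg-category of bounded families and matrices. -/
instance : DGCategory.{v} (Family J) where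
  Hom := Mat
  addCommGroup P Q n := inferInstance
  id := matId
  comp := matComp
  d := matD
  add_comp {P Q R k l r} f f' g h := by
    funext i j ⟨n, hn⟩
    simp only [Pi.add_apply, matComp_apply _ _ _ _ _ _ _ _ subset_rfl, add_comp,
      Finset.sum_add_distrib]
  comp_add {P Q R k l r} f g g' h := by
    funext i j ⟨n, hn⟩
    simp only [Pi.add_apply, matComp_apply _ _ _ _ _ _ _ _ subset_rfl, comp_add,
      Finset.sum_add_distrib]
  id_comp {P Q k} f := by
    funext i j ⟨n, hn⟩
    exact (diag_comp _ f i j n hn).trans (DGCategory.id_comp _)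
  comp_id {P Q k} f := by
    funext i j ⟨n, hn⟩
    exact (comp_diag f _ i j n hn).trans (DGCategory.comp_id _)
  assoc {P Q R S k l r kl lr klr} f g e h₁ h₂ h₃ h₄ := by
    funext i j ⟨n, hn⟩
    simp only [matComp_apply _ _ _ _ _ _ _ _ subset_rfl, sum_comp, comp_sum]
    rw [Finset.sum_comm]
    refine Finset.sum_congr rfl fun a _ => Finset.sum_congr rfl fun b _ => ?_
    have : ∀ (x y z y' z' xy yz : ℤ) (hx : x + a = i + k) (hy : y + b = a + l)
        (hy' : y' + b = a + l) (hz : z + j = b + r) (hz' : z' + j = b + r)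
        (h₁ : x + y = xy) (h₂ : y' + z' = yz) (h₃ : xy + z = n) (h₄ : x + yz = n),
        comp (comp (f i a ⟨x, hx⟩) (g a b ⟨y, hy⟩) h₁) (e b j ⟨z, hz⟩) h₃ =
          comp (f i a ⟨x, hx⟩) (comp (g a b ⟨y', hy'⟩) (e b j ⟨z', hz'⟩) h₂) h₄ := by
      intro x y z y' z' xy yz hx hy hy' hz hz' h₁ h₂ h₃ h₄
      obtain rfl : y = y' := by omega
      obtain rfl : z = z' := by omega
      exact DGCategory.assoc _ _ _ _ _ _ _
    exact this _ _ _ _ _ _ _ _ _ _ _ _ _ _ _ _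
  d_d {P Q} k l r h h' f := by
    funext i j ⟨n, hn⟩
    rw [matD_apply l r h' _ i j (n - 1) n hn (by omega),
      matD_apply k l h _ i j (n - 2) (n - 1) (by omega) (by omega), d_units_smul, d_d]
    simp
  d_comp {P Q R k l r k' l' r'} f g h hk hl hr := by
    funext i j ⟨n, hn⟩
    rw [matD_apply r r' hr _ i j (n - 1) n hn (by omega)]
    simp only [Pi.add_apply, Pi.smul_apply, matComp_apply _ _ _ _ _ _ _ _ subset_rfl, map_sum,
      Finset.smul_sum, ← Finset.sum_add_distrib]
    refine Finset.sum_congr rfl fun m _ => ?_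
    have : ∀ (x y x' y' : ℤ) (hx : x + m = i + k) (hy : y + j = m + l) (hx' : x' + m = i + k')
        (hy' : y' + j = m + l') (h₁ : x + y = n - 1) (h₂ : x + y' = n) (h₃ : x' + y = n)
        (h₄ : n - 1 + 1 = n),
        j.negOnePow • d (n - 1) n h₄ (comp (f i m ⟨x, hx⟩) (g m j ⟨y, hy⟩) h₁) =
          comp (f i m ⟨x, hx⟩) (matD l l' hl g m j ⟨y', hy'⟩) h₂ +
            l.negOnePow • comp (matD k k' hk f i m ⟨x', hx'⟩) (g m j ⟨y, hy⟩) h₃ := by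
      intro x y x' y' hx hy hx' hy' h₁ h₂ h₃ h₄
      rw [matD_apply l l' hl g m j y y' hy' (by omega),
        matD_apply k k' hk f i m x x' hx' (by omega),
        DGCategory.d_comp _ _ h₁ (show x + 1 = x' by omega) (show y + 1 = y' by omega) h₄,
        comp_units_smul, units_smul_comp, smul_add, smul_smul, smul_smul, ← Int.negOnePow_add,
        ← Int.negOnePow_add]
      congr 3
      rw [show l + m = j + y by omega]
    exact this _ _ _ _ _ _ _ _ _ _ _ _

end Family

/-! ### Twisted complexes -/

/-- A pair of an object of a dg-category and an endomorphism `q` of degree one of it such that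
`d q + q ∘ q = 0`. -/
structure Twist (D : Type u) [DGCategory.{v} D] where
  fam : D
  q : Hom fam fam 1
  eq_zero : d 1 2 one_add_one_eq_two q + comp q q one_add_one_eq_two = 0

namespace Twist

variable {D : Type u} [DGCategory.{v} D]

/-- The differential `d f + q' ∘ f - (-1) ^ ℓ • f ∘ q` of a morphism `f` of degree `ℓ`. -/
def twistD {P Q : Twist D} (k l : ℤ) (h : k + 1 = l) : Hom P.fam Q.fam k →+ Hom P.fam Q.fam l :=
  AddMonoidHom.mk'
    (fun f => d k l h f + (comp f Q.q h - k.negOnePow • comp P.q f (by omega)))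
    (fun f g => by
      simp only [map_add, add_comp, comp_add, smul_add]
      abel)

lemma twistD_apply {P Q : Twist D} (k l : ℤ) (h : k + 1 = l) (f : Hom P.fam Q.fam k) :
    twistD k l h f = d k l h f + (comp f Q.q h - k.negOnePow • comp P.q f (by omega)) := rfl

lemma d_q (P : Twist D) :
    d 1 2 one_add_one_eq_two P.q = - comp P.q P.q one_add_one_eq_two :=
  eq_neg_of_add_eq_zero_left P.eq_zero

/-- The dg-category of the pairs `(P, q)`, whose morphisms are all the morphisms between the
underlying objects, with the differential twisted by `q`. -/
instance : DGCategory.{v} (Twist D) where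
  Hom P Q n := Hom P.fam Q.fam n
  id P := id P.fam
  comp f g h := comp f g h
  d k l h := twistD k l h
  add_comp f f' g h := add_comp f f' g h
  comp_add f g g' h := comp_add f g g' h
  id_comp f := id_comp f
  comp_id f := comp_id f
  assoc f g k h₁ h₂ h₃ h₄ := assoc f g k h₁ h₂ h₃ h₄
  d_d {P Q} k l r h h' f := by
    subst h
    subst h'
    rw [twistD_apply, twistD_apply]
    simp only [map_add, map_sub, d_d, d_units_smul]
    rw [d_comp f Q.q rfl rfl one_add_one_eq_two rfl,
      d_comp P.q f (add_comm 1 k) one_add_one_eq_two rfl rfl, d_q, d_q]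
    simp only [add_comp, comp_add, sub_comp, comp_sub, units_smul_comp, comp_units_smul, smul_add,
      smul_sub, comp_neg, neg_comp, smul_neg, smul_smul]
    rw [assoc f Q.q Q.q rfl one_add_one_eq_two rfl (by omega),
      assoc P.q P.q f one_add_one_eq_two (add_comm 1 k) (by omega) (by omega),
      assoc P.q f Q.q (add_comm 1 k) rfl rfl (by omega)]
    simp only [Int.negOnePow_succ, Int.negOnePow_one, Units.neg_smul, one_smul,
      neg_mul, Int.units_mul_self]
    abel
  d_comp {P Q R m n p m' n' p'} f g h hm hn hp := by
    subst hm
    subst hn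
    subst hp
    subst h
    rw [twistD_apply, twistD_apply, twistD_apply,
      d_comp f g rfl rfl rfl rfl]
    simp only [add_comp, comp_add, sub_comp, comp_sub, units_smul_comp, comp_units_smul, smul_add,
      smul_sub, smul_smul]
    rw [assoc f g R.q rfl rfl rfl (by omega), assoc f Q.q g rfl (add_comm 1 n) (by omega) (by omega),
      assoc P.q f g (add_comm 1 m) rfl (by omega) (by omega), Int.negOnePow_add, mul_comm]
    abel

end Twist

/-- A twisted complex over `J`: objects `P^i` of `J`, almost all zero, and morphisms
`q_{ij} : P^i ⟶ P^j` of degree `i - j + 1` with `(-1) ^ j • d q_{ij} + ∑_m q_{mj} ∘ q_{im} = 0`.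
With the differential and the composition defined above, twisted complexes form a dg-category
`Pre-Tr(J)`. -/
abbrev TwistedComplex (J : Type u) [DGCategory.{v} J] : Type (max u v) := Twist (Family J)

/-- The category `Tr(J) = H⁰(Pre-Tr(J))`. -/
abbrev Tr (J : Type u) [DGCategory.{v} J] : Type (max u v) := HZero (TwistedComplex J)

namespace TwistedComplex

section

variable {J : Type u} [DGCategory.{v} J]

/-! ### Shifts -/

/-- The shift of a bounded family: `P[s]^i = P^{i + s}`. -/
abbrev shiftFamily (s : ℤ) (P : Family J) : Family J where
  X i := P.X (i + s)
  finite := P.finite.preimage (add_left_injective s).injOn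

/-- The shift of matrices, without signs. -/
def shiftMat (s : ℤ) {P Q : Family J} {k : ℤ} :
    Hom P Q k →+ Hom (shiftFamily s P) (shiftFamily s Q) k :=
  AddMonoidHom.mk' (fun f i j n => f (i + s) (j + s)
    ⟨n.1, by have := n.2; omega⟩) (fun _ _ => rfl)

lemma shiftMat_id (s : ℤ) (P : Family J) :
    shiftMat s (id P) = id (shiftFamily s P) := by
  funext i j ⟨n, hn⟩
  by_cases hij : i = j
  · subst hij
    obtain rfl : n = 0 := by omega
    exact (Family.diag_self (P := P) (Q := P) (fun i => id (P.X i)) (i + s) (by omega)).trans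
      (Family.diag_self (P := shiftFamily s P) (Q := shiftFamily s P) (fun i => id (P.X (i + s))) i
        (by omega)).symm
  · exact (Family.diag_ne (P := P) (Q := P) (fun i => id (P.X i)) (i := i + s) (j := j + s) (n := n)
      (by omega) (by omega)).trans
      (Family.diag_ne (P := shiftFamily s P) (Q := shiftFamily s P) (fun i => id (P.X (i + s))) hij
        (by omega)).symm

lemma shiftMat_comp (s : ℤ) {P Q R : Family J} {k l r : ℤ} (f : Hom P Q k) (g : Hom Q R l)
    (h : k + l = r) : shiftMat s (comp f g h) = comp (shiftMat s f) (shiftMat s g) h := by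
  funext i j ⟨n, hn⟩
  have e : ∀ (m x y : ℤ) (hx : x + (m + s) = (i + s) + k) (hy : y + (j + s) = (m + s) + l)
      (x' y' : ℤ) (hx' : x' + (m + s) = (i + s) + k) (hy' : y' + (j + s) = (m + s) + l)
      (h : x + y = n) (h' : x' + y' = n),
      comp (f (i + s) (m + s) ⟨x, hx⟩) (g (m + s) (j + s) ⟨y, hy⟩) h =
        comp (f (i + s) (m + s) ⟨x', hx'⟩) (g (m + s) (j + s) ⟨y', hy'⟩) h' := by
    intro m x y hx hy x' y' hx' hy' h h'
    obtain rfl : x = x' := by omega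
    obtain rfl : y = y' := by omega
    rfl
  refine (finsum_comp_equiv (Equiv.addRight s)).symm.trans (finsum_congr fun m => ?_)
  exact e m _ _ _ _ _ _ _ _ _ _

lemma shiftMat_d (s : ℤ) {P Q : Family J} (k l : ℤ) (h : k + 1 = l) (f : Hom P Q k) :
    shiftMat s (d k l h f) = s.negOnePow • d k l h (shiftMat s f) := by
  funext i j ⟨n, hn⟩
  refine (Family.matD_apply k l h f (i + s) (j + s) (n - 1) n (by omega) (by omega)).trans ?_
  refine Eq.trans ?_ (congrArg (s.negOnePow • ·)
    (Family.matD_apply k l h (shiftMat s f) i j (n - 1) n hn (by omega)).symm)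
  have e : ∀ x : Hom (P.X (i + s)) (Q.X (j + s)) n,
      (j + s).negOnePow • x = s.negOnePow • j.negOnePow • x := fun x => by
    rw [smul_smul, ← Int.negOnePow_add, Int.negOnePow_add, Int.negOnePow_add, mul_comm]
  exact e _

/-- The shift `P[s]` of a twisted complex: its objects are `P^{i + s}` and its morphisms are
`(-1) ^ s • q_{i + s, j + s}`. -/
abbrev shift (s : ℤ) (P : TwistedComplex J) : TwistedComplex J where
  fam := shiftFamily s P.fam
  q := s.negOnePow • shiftMat s P.q
  eq_zero := by
    have h := congrArg (shiftMat s) P.eq_zero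
    rw [map_add, shiftMat_d, shiftMat_comp, map_zero] at h
    rw [d_units_smul, units_smul_comp, comp_units_smul, smul_smul, Int.units_mul_self, one_smul]
    exact h

/-- The shift as a dg-functor; a morphism `f` of degree `k` is sent to the matrix with entries
`(-1) ^ (s * k) • f_{i + s, j + s}`. -/
def shiftDG (s : ℤ) : DGFunctor (TwistedComplex J) (TwistedComplex J) where
  obj := shift s
  map {P Q k} := AddMonoidHom.mk'
    (fun f => ((s * k).negOnePow • shiftMat s f : Hom (shiftFamily s P.fam) (shiftFamily s Q.fam) k))
    (fun f g => (congrArg ((s * k).negOnePow • ·) (map_add (shiftMat s) f g)).trans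
      (smul_add _ _ _))
  map_id P := by
    refine Eq.trans ?_ (shiftMat_id s P.fam)
    change (s * 0).negOnePow • shiftMat s (id P.fam) = _
    rw [mul_zero, Int.negOnePow_zero, one_smul]
  map_comp {P Q R k l r} f g h := by
    change (s * r).negOnePow • shiftMat s (comp (J := Family J) f g h) =
      comp (J := Family J) ((s * k).negOnePow • shiftMat s f) ((s * l).negOnePow • shiftMat s g) h
    rw [units_smul_comp, comp_units_smul, smul_smul, shiftMat_comp, ← Int.negOnePow_add, ← mul_add, h]
  map_d {P Q} k l h f := by
    change (s * l).negOnePow • shiftMat s (Twist.twistD (P := P) (Q := Q) k l h f) =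
      Twist.twistD (P := shift s P) (Q := shift s Q) k l h ((s * k).negOnePow • shiftMat s f)
    rw [Twist.twistD_apply, Twist.twistD_apply]
    change _ = _ + (comp _ (s.negOnePow • shiftMat s Q.q) _ -
      k.negOnePow • comp (s.negOnePow • shiftMat s P.q) _ _)
    subst h
    have e : (s * (k + 1)).negOnePow = (s * k).negOnePow * s.negOnePow := by
      rw [mul_add, mul_one, Int.negOnePow_add]
    have hk : ∀ x : Hom P.fam Q.fam (k + 1),
        shiftMat s (k.negOnePow • x) = k.negOnePow • shiftMat s x := fun x => rfl
    simp only [map_add, map_sub, hk, d_units_smul, shiftMat_d, shiftMat_comp, units_smul_comp,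
      comp_units_smul, smul_add, smul_sub, smul_smul, e]
    congr 2
    · rw [mul_assoc, Int.units_mul_self, mul_one]
    · rw [mul_comm s.negOnePow]
    · rw [mul_comm k.negOnePow]

/-! ### Cones -/

section Sum

/-- For `x : X ⟶ X'`, the composite `S ⟶ X ⟶ X' ⟶ S'` with morphisms of degree zero at both ends. -/
def sandwich {S X X' S' : J} {n : ℤ} (a : Hom S X 0) (x : Hom X X' n) (b : Hom X' S' 0) :
    Hom S S' n :=
  comp (comp a x (zero_add n)) b (add_zero n)

lemma comp_sandwich {S X X' S' Y Y' S'' : J} {m n p : ℤ} (a : Hom S X 0) (x : Hom X X' m)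
    (b : Hom X' S' 0) (a' : Hom S' Y 0) (y : Hom Y Y' n) (b' : Hom Y' S'' 0) (h : m + n = p) :
    comp (sandwich a x b) (sandwich a' y b') h =
      sandwich a (comp (comp x (comp b a' (add_zero 0)) (add_zero m)) y h) b' := by
  unfold sandwich
  rw [← assoc _ (comp a' y (zero_add n)) b' h (add_zero n) (add_zero p) h,
    ← assoc _ a' y (add_zero m) (zero_add n) h h,
    assoc _ b a' (add_zero m) (add_zero 0) (add_zero m) (add_zero m),
    assoc a x _ (zero_add m) (add_zero m) (add_zero m) (zero_add m),
    assoc a _ y (zero_add m) h h (zero_add p)]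

lemma d_sandwich {S X X' S' : J} {m n : ℤ} (h : m + 1 = n) (a : Hom S X 0) (x : Hom X X' m)
    (b : Hom X' S' 0) (ha : d 0 1 (zero_add 1) a = 0) (hb : d 0 1 (zero_add 1) b = 0) :
    d m n h (sandwich a x b) = sandwich a (d m n h x) b := by
  unfold sandwich
  rw [d_comp _ b (add_zero m) h (zero_add 1) h, d_comp a x (zero_add m) (zero_add 1) h h, ha, hb]
  simp

/-- The middle entry of a sandwich, as an additive map. -/
def sandwichHom {S X X' S' : J} (n : ℤ) (a : Hom S X 0) (b : Hom X' S' 0) :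
    Hom X X' n →+ Hom S S' n :=
  (compR S b (add_zero n)).comp (compL X' a (zero_add n))

lemma sandwich_eq {S X X' S' : J} {n : ℤ} (a : Hom S X 0) (x : Hom X X' n) (b : Hom X' S' 0) :
    sandwich a x b = sandwichHom n a b x := rfl

lemma comp_sandwich_right {R S X X' S' : J} {n : ℤ} (e : Hom R S 0) (a : Hom S X 0) (x : Hom X X' n)
    (b : Hom X' S' 0) :
    comp e (sandwich a x b) (zero_add n) = sandwich (comp e a (add_zero 0)) x b := by
  unfold sandwich
  rw [← assoc e _ b (zero_add n) (add_zero n) (add_zero n) (zero_add n),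
    ← assoc e a x (add_zero 0) (zero_add n) (zero_add n) (zero_add n)]

lemma sandwich_comp_right {S X X' S' R : J} {n : ℤ} (a : Hom S X 0) (x : Hom X X' n)
    (b : Hom X' S' 0) (e : Hom S' R 0) :
    comp (sandwich a x b) e (add_zero n) = sandwich a x (comp b e (add_zero 0)) := by
  unfold sandwich
  rw [assoc _ b e (add_zero n) (add_zero 0) (add_zero n) (add_zero n)]

lemma zero_sandwich {S X X' S' : J} {n : ℤ} (x : Hom X X' n) (b : Hom X' S' 0) :
    sandwich (0 : Hom S X 0) x b = 0 := by
  simp [sandwich]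

lemma sandwich_zero {S X X' S' : J} {n : ℤ} (a : Hom S X 0) (x : Hom X X' n) :
    sandwich a x (0 : Hom X' S' 0) = 0 := by
  simp [sandwich]

lemma id_sandwich {X X' S' : J} {n : ℤ} (x : Hom X X' n) (b : Hom X' S' 0) :
    sandwich (id X) x b = comp x b (add_zero n) := by
  rw [sandwich, id_comp]

lemma sandwich_id {S X X' : J} {n : ℤ} (a : Hom S X 0) (x : Hom X X' n) :
    sandwich a x (id X') = comp a x (zero_add n) := by
  rw [sandwich, comp_id]

variable [HasFiniteSums J]

/-- The objects `P^{i + 1} ⊕ P'^i` of a cone. -/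
def coneSum (P Q : Family J) (i : ℤ) : BinarySum (P.X (i + 1)) (Q.X i) :=
  binarySum (P.X (i + 1)) (Q.X i)

/-- The bounded family of the objects `P^{i + 1} ⊕ P'^i`. -/
abbrev coneFamily (P Q : Family J) : Family J where
  X i := (coneSum P Q i).pt
  finite := by
    refine ((P.finite.preimage (add_left_injective 1).injOn).union Q.finite).subset ?_
    intro i hi
    by_contra h
    simp only [Set.mem_union, Set.mem_preimage, Set.mem_ofPred_eq, not_or, not_not] at h
    apply hi
    rw [← (coneSum P Q i).total, comp_of_id_eq_zero h.1, comp_of_id_eq_zero h.2, add_zero]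

/-- The matrix of morphisms of the cone of `f`, with the four entries `-q_{i+1, j+1}`, `f_{i+1, j}`,
`q'_{ij}` and `0`. -/
def coneQ (P Q : TwistedComplex J) (f : Hom P Q 0) :
    Hom (coneFamily P.fam Q.fam) (coneFamily P.fam Q.fam) 1 := fun i j n =>
  sandwich (coneSum P.fam Q.fam i).fst (-P.q (i + 1) (j + 1) ⟨n.1, by have := n.2; omega⟩)
      (coneSum P.fam Q.fam j).inl +
    sandwich (coneSum P.fam Q.fam i).fst (f (i + 1) j ⟨n.1, by have := n.2; omega⟩)
      (coneSum P.fam Q.fam j).inr +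
    sandwich (coneSum P.fam Q.fam i).snd (Q.q i j ⟨n.1, n.2⟩) (coneSum P.fam Q.fam j).inr

lemma coneQ_apply (P Q : TwistedComplex J) (f : Hom P Q 0) (i j n : ℤ) (hn : n + j = i + 1) :
    coneQ P Q f i j ⟨n, hn⟩ =
      sandwich (coneSum P.fam Q.fam i).fst (-P.q (i + 1) (j + 1) ⟨n, by omega⟩)
          (coneSum P.fam Q.fam j).inl +
        sandwich (coneSum P.fam Q.fam i).fst (f (i + 1) j ⟨n, by omega⟩)
          (coneSum P.fam Q.fam j).inr +
        sandwich (coneSum P.fam Q.fam i).snd (Q.q i j ⟨n, hn⟩) (coneSum P.fam Q.fam j).inr := rfl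

/-- The cone of a closed morphism `f : P ⟶ P'` of degree zero: its objects are
`P^{i + 1} ⊕ P'^i`. -/
abbrev cone {P Q : TwistedComplex J} (f : cocycles P Q) : TwistedComplex J where
  fam := coneFamily P.fam Q.fam
  q := coneQ P Q f.1
  eq_zero := by
    funext i j ⟨n, hn⟩
    let s : Finset ℤ := (P.fam.finite.preimage (add_left_injective 1).injOn).toFinset ∪
      Q.fam.finite.toFinset
    let e : ℤ ↪ ℤ := ⟨fun m => m + 1, add_left_injective 1⟩
    have hsP : P.fam.finite.toFinset ⊆ s.map e := by
      intro m hm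
      refine Finset.mem_map.2 ⟨m - 1, Finset.mem_union_left _ ?_, sub_add_cancel m 1⟩
      rw [Set.Finite.mem_toFinset] at hm ⊢
      have h : ∀ z, z = m → id (P.fam.X z) ≠ 0 := by
        rintro _ rfl
        exact hm
      exact h _ (sub_add_cancel m 1)
    have hsQ : Q.fam.finite.toFinset ⊆ s := Finset.subset_union_right
    have hsC : (coneFamily P.fam Q.fam).finite.toFinset ⊆ s := by
      intro m hm
      by_contra h
      simp only [s, Finset.mem_union, Set.Finite.mem_toFinset, Set.mem_preimage, Set.mem_ofPred_eq,
        not_or, not_not] at h hm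
      apply hm
      rw [← (coneSum P.fam Q.fam m).total, comp_of_id_eq_zero h.1, comp_of_id_eq_zero h.2, add_zero]
    have hP : (j + 1).negOnePow • d (n - 1) n (sub_add_cancel n 1)
          (P.q (i + 1) (j + 1) ⟨n - 1, by omega⟩) +
        Family.matComp P.q P.q one_add_one_eq_two (i + 1) (j + 1) ⟨n, by omega⟩ = 0 :=
      congrFun (congrFun (congrFun P.eq_zero (i + 1)) (j + 1)) ⟨n, by omega⟩
    have hQ : j.negOnePow • d (n - 1) n (sub_add_cancel n 1) (Q.q i j ⟨n - 1, by omega⟩) +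
        Family.matComp Q.q Q.q one_add_one_eq_two i j ⟨n, hn⟩ = 0 :=
      congrFun (congrFun (congrFun Q.eq_zero i) j) ⟨n, hn⟩
    have hn₁ : n + j = i + 1 + 1 := by omega
    have hf : j.negOnePow • d (n - 1) n (sub_add_cancel n 1) (f.1 (i + 1) j
          ⟨n - 1, show n - 1 + j = i + 1 + 0 by omega⟩) +
        (Family.matComp f.1 Q.q (zero_add 1) (i + 1) j ⟨n, hn₁⟩ -
          (0 : ℤ).negOnePow • Family.matComp P.q f.1 (add_zero 1) (i + 1) j ⟨n, hn₁⟩) = 0 :=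
      congrFun (congrFun (congrFun f.2 (i + 1)) j) ⟨n, hn₁⟩
    have hC : j.negOnePow • d (n - 1) n (sub_add_cancel n 1)
          (coneQ P Q f.1 i j ⟨n - 1, by omega⟩) +
        Family.matComp (coneQ P Q f.1) (coneQ P Q f.1) one_add_one_eq_two i j ⟨n, hn⟩ = 0 := by
      rw [Family.matComp_apply _ _ _ _ _ _ _ (s.map e) hsP, Finset.sum_map] at hP
      rw [Family.matComp_apply _ _ _ _ _ _ _ s hsQ] at hQ
      rw [Family.matComp_apply _ _ _ _ _ _ _ s hsQ,
        Family.matComp_apply _ _ _ _ _ _ _ (s.map e) hsP, Finset.sum_map, Int.negOnePow_zero,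
        one_smul, ← Finset.sum_sub_distrib] at hf
      rw [Family.matComp_apply _ _ _ _ _ _ _ s hsC, coneQ_apply, map_add, map_add,
        d_sandwich _ _ _ _ (BinarySum.d_fst _) (BinarySum.d_inl _),
        d_sandwich _ _ _ _ (BinarySum.d_fst _) (BinarySum.d_inr _),
        d_sandwich _ _ _ _ (BinarySum.d_snd _) (BinarySum.d_inr _)]
      have key : ∀ m (x y x₁ y₁ x₂ y₂ : ℤ) (hx : x + m = i + 1) (hy : y + j = m + 1)
          (hx₁ : x₁ + (m + 1) = i + 1 + 1) (hy₁ : y₁ + (j + 1) = m + 1 + 1)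
          (hx₂ : x₂ + m = i + 1 + 0) (hy₂ : y₂ + j = m + 1 + 0)
          (h : x + y = n) (h₁ : x₁ + y₁ = n) (h₂ : x₂ + y = n) (h₃ : x₁ + y₂ = n),
          comp (coneQ P Q f.1 i m ⟨x, hx⟩) (coneQ P Q f.1 m j ⟨y, hy⟩) h =
            sandwich (coneSum P.fam Q.fam i).fst
                (comp (P.q (i + 1) (m + 1) ⟨x₁, hx₁⟩) (P.q (m + 1) (j + 1) ⟨y₁, hy₁⟩) h₁)
                (coneSum P.fam Q.fam j).inl +
              sandwich (coneSum P.fam Q.fam i).fst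
                (comp (f.1 (i + 1) m ⟨x₂, hx₂⟩) (Q.q m j ⟨y, hy⟩) h₂ -
                  comp (P.q (i + 1) (m + 1) ⟨x₁, hx₁⟩) (f.1 (m + 1) j ⟨y₂, hy₂⟩) h₃)
                (coneSum P.fam Q.fam j).inr +
              sandwich (coneSum P.fam Q.fam i).snd
                (comp (Q.q i m ⟨x, hx⟩) (Q.q m j ⟨y, hy⟩) h) (coneSum P.fam Q.fam j).inr := by
        intro m x y x₁ y₁ x₂ y₂ hx hy hx₁ hy₁ hx₂ hy₂ h h₁ h₂ h₃
        obtain rfl : x = x₁ := by omega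
        obtain rfl : y = y₁ := by omega
        obtain rfl : x = x₂ := by omega
        obtain rfl : y = y₂ := by omega
        rw [coneQ_apply, coneQ_apply]
        simp only [add_comp, comp_add, comp_sandwich, BinarySum.inl_fst, BinarySum.inr_snd,
          BinarySum.inl_snd, BinarySum.inr_fst, comp_id, comp_zero, zero_comp, neg_comp, comp_neg,
          neg_neg, sub_eq_add_neg]
        simp only [sandwich_eq, map_add, map_neg, map_zero]
        abel
      rw [Finset.sum_congr rfl (fun m _ => key m (i + 1 - m) (m + 1 - j) (i + 1 + 1 - (m + 1)) (m + 1 + 1 - (j + 1))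
        (i + 1 + 0 - m) (m + 1 + 0 - j) (by omega) (by omega) (by omega) (by omega) (by omega)
        (by omega) (by omega) (by omega) (by omega) (by omega))]
      have hP' := congrArg (sandwichHom n (coneSum P.fam Q.fam i).fst (coneSum P.fam Q.fam j).inl) hP
      have hf' := congrArg (sandwichHom n (coneSum P.fam Q.fam i).fst (coneSum P.fam Q.fam j).inr) hf
      have hQ' := congrArg (sandwichHom n (coneSum P.fam Q.fam i).snd (coneSum P.fam Q.fam j).inr) hQ
      have hs : ∀ {S X X' S' : J} (a : Hom S X 0) (b : Hom X' S' 0) (z : ℤˣ) (x : Hom X X' n),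
          sandwichHom n a b (z • x) = z • sandwichHom n a b x := by
        intro S X X' S' a b z x
        obtain rfl | rfl := Int.units_eq_one_or z <;> simp
      rw [map_add, map_zero, map_sum, hs] at hP' hf' hQ'
      simp only [sandwich_eq, Finset.sum_add_distrib, smul_add, map_neg, smul_neg]
      rw [Int.negOnePow_succ, Units.neg_smul] at hP'
      have add : ∀ {G : Type v} [AddCommGroup G] (a₁ a₂ b₁ b₂ c₁ c₂ : G), -a₁ + a₂ = 0 →
          b₁ + b₂ = 0 → c₁ + c₂ = 0 → -a₁ + b₁ + c₁ + (a₂ + b₂ + c₂) = 0 := by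
        intro G _ a₁ a₂ b₁ b₂ c₁ c₂ ha hb hc
        calc _ = (-a₁ + a₂) + (b₁ + b₂) + (c₁ + c₂) := by abel
          _ = 0 := by rw [ha, hb, hc]; simp
      exact add _ _ _ _ _ _ hP' hf' hQ'
    exact hC

/-- The inclusion `P' ⟶ Cone(f)`. -/
def coneInr {P Q : TwistedComplex J} (f : cocycles P Q) : cocycles Q (cone f) :=
  ⟨Family.diag (P := Q.fam) (Q := coneFamily P.fam Q.fam) fun i => (coneSum P.fam Q.fam i).inr, by
    refine (congrArg₂ (· + ·) (Family.matD_diag _ fun i => BinarySum.d_inr _)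
      (sub_eq_zero.2 ?_)).trans (add_zero _)
    rw [Int.negOnePow_zero, one_smul]
    funext i j ⟨n, hn⟩
    refine (Family.diag_comp _ _ i j n hn).trans (Eq.trans ?_ (Family.comp_diag _ _ i j n hn).symm)
    change comp _ (coneQ P Q f.1 i j ⟨n, hn⟩) _ = _
    rw [coneQ_apply, comp_add, comp_add, comp_sandwich_right, comp_sandwich_right,
      comp_sandwich_right, BinarySum.inr_fst, BinarySum.inr_snd, zero_sandwich, zero_sandwich,
      id_sandwich, zero_add, zero_add]⟩

/-- The projection `Cone(f) ⟶ P[1]`. -/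
def coneFst {P Q : TwistedComplex J} (f : cocycles P Q) : cocycles (cone f) (shift 1 P) :=
  ⟨Family.diag (P := coneFamily P.fam Q.fam) (Q := shiftFamily 1 P.fam)
      fun i => (coneSum P.fam Q.fam i).fst, by
    refine (congrArg₂ (· + ·) (Family.matD_diag _ fun i => BinarySum.d_fst _)
      (sub_eq_zero.2 ?_)).trans (add_zero _)
    rw [Int.negOnePow_zero, one_smul]
    funext i j ⟨n, hn⟩
    refine (Family.diag_comp _ _ i j n hn).trans (Eq.trans ?_ (Family.comp_diag _ _ i j n hn).symm)
    change comp _ ((1 : ℤ).negOnePow • P.q (i + 1) (j + 1) ⟨n, by omega⟩) _ =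
      comp (coneQ P Q f.1 i j ⟨n, hn⟩) _ _
    rw [coneQ_apply, add_comp, add_comp, sandwich_comp_right, sandwich_comp_right,
      sandwich_comp_right, BinarySum.inl_fst, BinarySum.inr_fst, sandwich_zero, sandwich_zero,
      sandwich_id, add_zero, add_zero, Int.negOnePow_one, Units.neg_smul, one_smul]⟩

end Sum

end

/-! ### The canonical functor `H⁰(J) ⥤ Tr(J)` and the triangles -/

section

variable {J : Type u} [DGCategory.{v} J] [HasFiniteSums J]

/-- The family with `X` in degree `0` and the zero object in all other degrees. -/
def singleX (X : J) : ℤ → J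
  | .ofNat 0 => X
  | .ofNat (_ + 1) => zeroObj J
  | .negSucc _ => zeroObj J

lemma id_singleX_of_ne (X : J) (i : ℤ) (hi : i ≠ 0) : id (singleX X i) = 0 := by
  match i, hi with
  | .ofNat 0, hi => exact absurd rfl hi
  | .ofNat (_ + 1), _ => exact id_zeroObj J
  | .negSucc _, _ => exact id_zeroObj J

/-- The bounded family with `X` in degree `0`. -/
abbrev singleFamily (X : J) : Family J where
  X := singleX X
  finite := (Set.finite_singleton 0).subset fun i hi => by
    by_contra h
    exact hi (id_singleX_of_ne X i h)

/-- An object of `J`, as a twisted complex concentrated in degree `0`. -/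
abbrev single (X : J) : TwistedComplex J where
  fam := singleFamily X
  q := 0
  eq_zero := by simp

/-- The matrix whose only nonzero entry is `f`, from degree `0` to degree `0`. -/
def singleMat {X Y : J} {k : ℤ} (f : Hom X Y k) : Family.Mat (singleFamily X) (singleFamily Y) k
  | .ofNat 0, .ofNat 0, n => (show k = n.1 by have := n.2; simp at this; omega) ▸ f
  | .ofNat (_ + 1), _, _ => 0
  | .negSucc _, _, _ => 0
  | .ofNat 0, .ofNat (_ + 1), _ => 0
  | .ofNat 0, .negSucc _, _ => 0

lemma singleMat_zero {X Y : J} {k : ℤ} (f : Hom X Y k) (h : k + 0 = 0 + k) :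
    singleMat f 0 0 ⟨k, h⟩ = f := rfl

lemma hom_ext_single {X Y : J} {k : ℤ} {f g : Family.Mat (singleFamily X) (singleFamily Y) k}
    (h : f 0 0 ⟨k, by omega⟩ = g 0 0 ⟨k, by omega⟩) : f = g := by
  funext i j ⟨n, hn⟩
  by_cases hi : i = 0
  · by_cases hj : j = 0
    · subst hi hj
      obtain rfl : k = n := by omega
      exact h
    · rw [← comp_id (f i j ⟨n, hn⟩), ← comp_id (g i j ⟨n, hn⟩), id_singleX_of_ne Y j hj, comp_zero,
        comp_zero]
  · rw [← id_comp (f i j ⟨n, hn⟩), ← id_comp (g i j ⟨n, hn⟩), id_singleX_of_ne X i hi, zero_comp,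
      zero_comp]

/-- The canonical dg-functor `J ⟶ Pre-Tr(J)`. -/
def singleDG (J : Type u) [DGCategory.{v} J] [HasFiniteSums J] :
    DGFunctor J (TwistedComplex J) where
  obj := single
  map {X Y k} := AddMonoidHom.mk'
    (fun f => (singleMat f : Family.Mat (singleFamily X) (singleFamily Y) k))
    (fun _ _ => hom_ext_single rfl)
  map_id X := hom_ext_single (Family.diag_self (P := singleFamily X) (Q := singleFamily X)
    (fun i => id (singleX X i)) 0 (by omega)).symm
  map_comp {X Y Z k l r} f g h := by
    subst h
    refine hom_ext_single ?_
    change comp f g rfl = Family.matComp (singleMat f) (singleMat g) rfl 0 0 ⟨k + l, by omega⟩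
    unfold Family.matComp
    rw [finsum_eq_single _ 0]
    · have : ∀ (x y : ℤ) (hx : x + 0 = 0 + k) (hy : y + 0 = 0 + l) (h : x + y = k + l),
          comp f g rfl = comp (singleMat f 0 0 ⟨x, hx⟩) (singleMat g 0 0 ⟨y, hy⟩) h := by
        intro x y hx hy h
        obtain rfl : k = x := by omega
        obtain rfl : l = y := by omega
        rfl
      exact this _ _ _ _ _
    · intro m hm
      exact comp_of_id_eq_zero (id_singleX_of_ne Y m hm) _ _ _
  map_d {X Y} k l h f := by
    refine hom_ext_single ?_
    have e : comp (J := Family J) (singleMat f) (0 : Hom (singleFamily Y) (singleFamily Y) 1) h -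
        k.negOnePow • comp (J := Family J) (0 : Hom (singleFamily X) (singleFamily X) 1)
          (singleMat f) (by omega) = 0 := by
      rw [comp_zero, zero_comp, smul_zero, sub_zero]
    refine Eq.trans ?_ (congrFun (congrFun (congrFun ((congrArg (d k l h (singleMat f) + ·) e).trans
      (add_zero _)) 0) 0) ⟨l, by omega⟩).symm
    refine Eq.trans ?_ (Family.matD_apply k l h (singleMat f) 0 0 k l (by omega) h).symm
    rw [singleMat_zero, Int.negOnePow_zero, one_smul]
    rfl

/-- The canonical functor `H⁰(J) ⥤ Tr(J)`. -/
abbrev incl (J : Type u) [DGCategory.{v} J] [HasFiniteSums J] : HZero J ⥤ Tr J := (singleDG J).hZero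

/-- The shift functor `P ↦ P[s]` of `Tr(J)`. -/
abbrev shiftTr (J : Type u) [DGCategory.{v} J] (s : ℤ) : Tr J ⥤ Tr J :=
  (shiftDG (J := J) s).hZero

/-- The distinguished triangles of `Tr(J)`: those which are isomorphic to a triangle
`P ⟶ P' ⟶ Cone(f) ⟶ P[1]` for some closed morphism `f : P ⟶ P'` of degree zero. -/
def IsDistinguished {X Y Z : Tr J} (a : X ⟶ Y) (b : Y ⟶ Z) (c : Z ⟶ (shiftTr J 1).obj X) : Prop :=
  ∃ (P Q : TwistedComplex J) (f : cocycles P Q)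
    (x : X ≅ HZero.of P) (y : Y ≅ HZero.of Q) (z : Z ≅ HZero.of (cone f)),
    a ≫ y.hom = x.hom ≫ HZero.mk f ∧
    b ≫ z.hom = y.hom ≫ HZero.mk (coneInr f) ∧
    c ≫ (shiftTr J 1).map x.hom = z.hom ≫ HZero.mk (coneFst f)

end

/-! ### The complex `P^{-1} ⟶ P^0 ⟶ P^1` in `H⁰(J)`, for `J` negative -/

section Heart

variable {J : Type u} [DGCategory.{v} J] [IsNegative J]

lemma mk₀_eq_zero {X Y : J} (f : Hom X Y 0) (m : ℤ) (hm : m + 1 = 0) (w : Hom X Y m) (a : ℤˣ)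
    (hw : a • d m 0 hm w = f) : HZero.mk₀ f = 0 := by
  obtain rfl : m = -1 := by omega
  exact (HZero.mk_eq_zero _).2 ⟨a • w, (d_units_smul _ _ _).trans hw⟩

lemma mk₀_comp {X Y Z : J} (f : Hom X Y 0) (g : Hom Y Z 0) :
    HZero.mk₀ (comp f g (add_zero 0)) = HZero.mk₀ f ≫ HZero.mk₀ g := rfl

lemma matComp_zero {P Q R : Family J} {k l r : ℤ} (f : Family.Mat P Q k) (g : Family.Mat Q R l)
    (h : k + l = r) (i m j : ℤ) (hn : 0 + j = i + r) (hm : 0 + m = i + k) (hj : 0 + j = m + l) :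
    Family.matComp f g h i j ⟨0, hn⟩ = comp (f i m ⟨0, hm⟩) (g m j ⟨0, hj⟩) (add_zero 0) := by
  unfold Family.matComp
  rw [finsum_eq_single _ m]
  · have : ∀ (x y : ℤ) (hx : x + m = i + k) (hy : y + j = m + l) (h : x + y = 0),
        comp (f i m ⟨x, hx⟩) (g m j ⟨y, hy⟩) h =
          comp (f i m ⟨0, hm⟩) (g m j ⟨0, hj⟩) (add_zero 0) := by
      intro x y hx hy h
      obtain rfl : x = 0 := by omega
      obtain rfl : y = 0 := by omega
      rfl
    exact this _ _ _ _ _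
  · intro z hz
    rcases lt_or_gt_of_ne hz with hz | hz
    · rw [IsNegative.eq_zero (n := i + k - z) (by omega) (f i z ⟨i + k - z, by omega⟩), zero_comp]
    · rw [IsNegative.eq_zero (n := z + l - j) (by omega) (g z j ⟨z + l - j, by omega⟩), comp_zero]

/-- The class in `H⁰(J)` of the morphism `q_{ij} : P^i ⟶ P^j`, where `j = i + 1`. -/
def qClass (P : TwistedComplex J) (i j : ℤ) (h : i + 1 = j) :
    HZero.of (P.fam.X i) ⟶ HZero.of (P.fam.X j) :=
  HZero.mk₀ (P.q i j ⟨0, by omega⟩)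

/-- The class in `H⁰(J)` of the component `f_{ii}` of a morphism of degree zero. -/
def diagClass {P Q : TwistedComplex J} (f : cocycles P Q) (i : ℤ) :
    HZero.of (P.fam.X i) ⟶ HZero.of (Q.fam.X i) :=
  HZero.mk₀ ((show Family.Mat P.fam Q.fam 0 from f.1) i i ⟨0, by omega⟩)

lemma qClass_comp (P : TwistedComplex J) (i j k : ℤ) (h : i + 1 = j) (h' : j + 1 = k) :
    qClass P i j h ≫ qClass P j k h' = 0 := by
  have e : k.negOnePow • d (0 - 1) 0 (sub_add_cancel 0 1) (P.q i k ⟨0 - 1, by omega⟩) +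
      Family.matComp P.q P.q one_add_one_eq_two i k ⟨0, by omega⟩ = 0 :=
    congrFun (congrFun (congrFun P.eq_zero i) k) ⟨0, by omega⟩
  rw [matComp_zero P.q P.q one_add_one_eq_two i j k (by omega) (by omega) (by omega)] at e
  refine mk₀_eq_zero _ (0 - 1) (by omega) (P.q i k ⟨0 - 1, by omega⟩) (-k.negOnePow) ?_
  rw [Units.neg_smul]
  exact neg_eq_of_add_eq_zero_right e

lemma diagClass_comm {P Q : TwistedComplex J} (f : cocycles P Q) (i j : ℤ) (h : i + 1 = j) :
    diagClass f i ≫ qClass Q i j h = qClass P i j h ≫ diagClass f j := by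
  have hn : 0 + j = i + 1 := by omega
  let f₁ : Family.Mat P.fam Q.fam 0 := f.1
  have e : j.negOnePow • d (0 - 1) 0 (sub_add_cancel 0 1) (f₁ i j ⟨0 - 1, by omega⟩) +
      (Family.matComp f₁ Q.q (zero_add 1) i j ⟨0, hn⟩ -
        (0 : ℤ).negOnePow • Family.matComp P.q f₁ (add_zero 1) i j ⟨0, hn⟩) = 0 :=
    congrFun (congrFun (congrFun f.2 i) j) ⟨0, hn⟩
  rw [matComp_zero f₁ Q.q (zero_add 1) i i j (by omega) (by omega) (by omega),
    matComp_zero P.q f₁ (add_zero 1) i j j (by omega) (by omega) (by omega),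
    Int.negOnePow_zero, one_smul] at e
  rw [← sub_eq_zero]
  change HZero.mk₀ (comp (f₁ i i ⟨0, by omega⟩) (Q.q i j ⟨0, by omega⟩) (add_zero 0)) -
    HZero.mk₀ (comp (P.q i j ⟨0, by omega⟩) (f₁ j j ⟨0, by omega⟩) (add_zero 0)) = 0
  rw [← map_sub]
  refine mk₀_eq_zero _ (0 - 1) (by omega) (f₁ i j ⟨0 - 1, by omega⟩) (-j.negOnePow) ?_
  rw [Units.neg_smul]
  exact neg_eq_of_add_eq_zero_right e

lemma diagClass_id (P : TwistedComplex J) (i : ℤ) :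
    diagClass (cocyclesId P) i = 𝟙 (HZero.of (P.fam.X i)) :=
  congrArg HZero.mk₀ (Family.diag_self (P := P.fam) (Q := P.fam) (fun i => id (P.fam.X i)) i
    (by omega))

lemma diagClass_cocyclesComp {P Q R : TwistedComplex J} (f : cocycles P Q) (g : cocycles Q R)
    (i : ℤ) : diagClass (cocyclesComp f g) i = diagClass f i ≫ diagClass g i :=
  congrArg HZero.mk₀ (matComp_zero (P := P.fam) (Q := Q.fam) (R := R.fam) f.1 g.1 (add_zero 0)
    i i i (by omega) (by omega) (by omega))

lemma diagClass_add {P Q : TwistedComplex J} (f g : cocycles P Q) (i : ℤ) :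
    diagClass (f + g) i = diagClass f i + diagClass g i :=
  map_add HZero.mk₀ _ _

lemma diagClass_of_mem_coboundaries {P Q : TwistedComplex J} (f : cocycles P Q)
    (hf : f ∈ coboundaries P Q) :
    ∃ s : ∀ i j : ℤ, HZero.of (P.fam.X i) ⟶ HZero.of (Q.fam.X j),
      ∀ (i j k : ℤ) (h : i + 1 = j) (h' : j + 1 = k),
        diagClass f j = s j i ≫ qClass Q i j h + qClass P j k h' ≫ s k j := by
  obtain ⟨w₀, hw⟩ := (mem_coboundaries f).1 hf
  let w : Family.Mat P.fam Q.fam (-1) := w₀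
  refine ⟨fun i j => if h : 0 + j = i + -1 then HZero.mk₀ (w i j ⟨0, h⟩) else 0, ?_⟩
  intro i j k h h'
  beta_reduce
  rw [dif_pos (show 0 + i = j + -1 by omega), dif_pos (show 0 + j = k + -1 by omega)]
  have hn : 0 + j = j + 0 := by omega
  have e : j.negOnePow • d (0 - 1) 0 (sub_add_cancel 0 1) (w j j ⟨0 - 1, by omega⟩) +
      (Family.matComp w Q.q (neg_add_cancel 1) j j ⟨0, hn⟩ -
        (-1 : ℤ).negOnePow • Family.matComp P.q w (add_neg_cancel 1) j j ⟨0, hn⟩) =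
      (show Family.Mat P.fam Q.fam 0 from f.1) j j ⟨0, hn⟩ :=
    congrFun (congrFun (congrFun hw j) j) ⟨0, hn⟩
  rw [matComp_zero w Q.q (neg_add_cancel 1) j i j (by omega) (by omega) (by omega),
    matComp_zero P.q w (add_neg_cancel 1) j k j (by omega) (by omega) (by omega),
    Int.negOnePow_neg, Int.negOnePow_one, Units.neg_smul, one_smul, sub_neg_eq_add] at e
  rw [diagClass, ← e, map_add, map_add, mk₀_comp, mk₀_comp,
    mk₀_eq_zero _ (0 - 1) (by omega) (w j j ⟨0 - 1, by omega⟩) j.negOnePow rfl, zero_add]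
  rfl

/-- The complex `P^{-1} ⟶ P^0 ⟶ P^1` in `H⁰(J)`, whose morphisms are the classes of `q_{-1,0}` and
`q_{01}`. -/
abbrev heartComplex (P : TwistedComplex J) : ShortComplex (HZero J) :=
  ShortComplex.mk (qClass P (-1) 0 (neg_add_cancel 1)) (qClass P 0 1 (zero_add 1))
    (qClass_comp P _ _ _ _ _)

/-- The morphism between these complexes that a closed morphism `f` of degree zero of twisted
complexes induces: its components are the classes of the diagonal entries `f_{ii}`. -/
abbrev heartMap {P Q : TwistedComplex J} (f : cocycles P Q) : heartComplex P ⟶ heartComplex Q where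
  τ₁ := diagClass f (-1)
  τ₂ := diagClass f 0
  τ₃ := diagClass f 1
  comm₁₂ := diagClass_comm f _ _ (neg_add_cancel 1)
  comm₂₃ := diagClass_comm f _ _ (zero_add 1)

variable {A : Type w₁} [Category.{w₂} A] [Abelian A]

/-- The morphism that a closed morphism of degree zero induces between the complexes
`F(P^{-1}) ⟶ F(P^0) ⟶ F(P^1)`. -/
abbrev mapHeartMap (F : HZero J ⥤ A) [F.Additive] {P Q : TwistedComplex J} (f : cocycles P Q) :
    (heartComplex P).map F ⟶ (heartComplex Q).map F :=
  F.mapShortComplex.map (heartMap f)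

lemma mapHeartMap_add (F : HZero J ⥤ A) [F.Additive] {P Q : TwistedComplex J}
    (f g : cocycles P Q) : mapHeartMap F (f + g) = mapHeartMap F f + mapHeartMap F g :=
  ShortComplex.hom_ext _ _ ((congrArg F.map (diagClass_add f g (-1))).trans F.map_add)
    ((congrArg F.map (diagClass_add f g 0)).trans F.map_add)
    ((congrArg F.map (diagClass_add f g 1)).trans F.map_add)

lemma mapHeartMap_id (F : HZero J ⥤ A) [F.Additive] (P : TwistedComplex J) :
    mapHeartMap F (cocyclesId P) = 𝟙 ((heartComplex P).map F) :=
  ShortComplex.hom_ext _ _ ((congrArg F.map (diagClass_id P (-1))).trans (F.map_id _))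
    ((congrArg F.map (diagClass_id P 0)).trans (F.map_id _))
    ((congrArg F.map (diagClass_id P 1)).trans (F.map_id _))

lemma mapHeartMap_comp (F : HZero J ⥤ A) [F.Additive] {P Q R : TwistedComplex J}
    (f : cocycles P Q) (g : cocycles Q R) :
    mapHeartMap F (cocyclesComp f g) = mapHeartMap F f ≫ mapHeartMap F g :=
  ShortComplex.hom_ext _ _
    ((congrArg F.map (diagClass_cocyclesComp f g (-1))).trans (F.map_comp _ _))
    ((congrArg F.map (diagClass_cocyclesComp f g 0)).trans (F.map_comp _ _))
    ((congrArg F.map (diagClass_cocyclesComp f g 1)).trans (F.map_comp _ _))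

lemma homologyMap_eq_zero {S T : ShortComplex A} (φ : S ⟶ T) (a : S.X₂ ⟶ T.X₁) (b : S.X₃ ⟶ T.X₂)
    (h : φ.τ₂ = a ≫ T.f + S.g ≫ b) : ShortComplex.homologyMap φ = 0 := by
  have c₁ : (φ.τ₁ - S.f ≫ a) ≫ T.f = 0 := by
    rw [Preadditive.sub_comp, φ.comm₁₂, h]
    simp
  have c₃ : S.g ≫ (φ.τ₃ - b ≫ T.g) = 0 := by
    rw [Preadditive.comp_sub, ← φ.comm₂₃, h]
    simp
  have e : ShortComplex.Homotopy φ 0 :=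
    { h₀ := φ.τ₁ - S.f ≫ a
      h₀_f := c₁
      h₁ := a
      h₂ := b
      h₃ := φ.τ₃ - b ≫ T.g
      g_h₃ := c₃
      comm₁ := by simp
      comm₂ := by rw [h, ShortComplex.zero_τ₂, add_zero, add_comm]
      comm₃ := by simp }
  rw [e.homologyMap_congr, ShortComplex.homologyMap_zero]

/-- The map on `ker / im` of `F(P^{-1}) ⟶ F(P^0) ⟶ F(P^1)` induced by a closed morphism of degree
zero. -/
def heartHomologyMap (F : HZero J ⥤ A) [F.Additive] (P Q : TwistedComplex J) :
    cocycles P Q →+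
      (((heartComplex P).map F).homology ⟶ ((heartComplex Q).map F).homology) :=
  AddMonoidHom.mk' (fun f => ShortComplex.homologyMap (mapHeartMap F f))
    (fun f g => by rw [mapHeartMap_add, ShortComplex.homologyMap_add])

lemma heartHomologyMap_eq_zero (F : HZero J ⥤ A) [F.Additive] (P Q : TwistedComplex J)
    (f : cocycles P Q) (hf : f ∈ coboundaries P Q) : heartHomologyMap F P Q f = 0 := by
  obtain ⟨s, hs⟩ := diagClass_of_mem_coboundaries f hf
  refine homologyMap_eq_zero (mapHeartMap F f) (F.map (s 0 (-1))) (F.map (s 1 0)) ?_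
  refine (congrArg F.map (hs (-1) 0 1 (neg_add_cancel 1) (zero_add 1))).trans ?_
  rw [F.map_add, F.map_comp, F.map_comp]
  rfl

/-- For an additive functor `F : H⁰(J) ⥤ A`, the functor from `Tr(J)` to `A` which sends `P` to
`ker(F(P^0) ⟶ F(P^1)) / im(F(P^{-1}) ⟶ F(P^0))`, the homology of `F(P^{-1}) ⟶ F(P^0) ⟶ F(P^1)`. -/
def heartHomology (F : HZero J ⥤ A) [F.Additive] : Tr J ⥤ A where
  obj P := ((heartComplex P.obj).map F).homology
  map {P Q} := QuotientAddGroup.lift _ (heartHomologyMap F P.obj Q.obj)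
    (heartHomologyMap_eq_zero F P.obj Q.obj)
  map_id P := by
    change ShortComplex.homologyMap (mapHeartMap F (cocyclesId P.obj)) = _
    rw [mapHeartMap_id, ShortComplex.homologyMap_id]
  map_comp f g := by
    obtain ⟨f, rfl⟩ := HZero.mk_surjective f
    obtain ⟨g, rfl⟩ := HZero.mk_surjective g
    change ShortComplex.homologyMap (mapHeartMap F (cocyclesComp f g)) =
      ShortComplex.homologyMap (mapHeartMap F f) ≫ ShortComplex.homologyMap (mapHeartMap F g)
    rw [mapHeartMap_comp, ShortComplex.homologyMap_comp]

variable (J A) in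
/-- The functor `F ↦ (P ↦ ker(F(P^0) ⟶ F(P^1)) / im(F(P^{-1}) ⟶ F(P^0)))`. -/
def heartHomologyFunctor : (HZero J ⥤+ A) ⥤ (Tr J ⥤ A) where
  obj F := heartHomology F.obj
  map {F G} η :=
    { app := fun P => ShortComplex.homologyMap ((heartComplex P.obj).mapNatTrans η.hom)
      naturality := by
        intro P Q f
        obtain ⟨f, rfl⟩ := HZero.mk_surjective f
        have e : mapHeartMap F.obj f ≫ (heartComplex Q.obj).mapNatTrans η.hom =
            (heartComplex P.obj).mapNatTrans η.hom ≫ mapHeartMap G.obj f :=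
          ShortComplex.hom_ext _ _ (η.hom.naturality _) (η.hom.naturality _) (η.hom.naturality _)
        change ShortComplex.homologyMap (mapHeartMap F.obj f) ≫
            ShortComplex.homologyMap ((heartComplex Q.obj).mapNatTrans η.hom) =
          ShortComplex.homologyMap ((heartComplex P.obj).mapNatTrans η.hom) ≫
            ShortComplex.homologyMap (mapHeartMap G.obj f)
        rw [← ShortComplex.homologyMap_comp, ← ShortComplex.homologyMap_comp, e] }
  map_id F := by
    ext P
    exact ShortComplex.homologyMap_id ((heartComplex P.obj).map F.obj)
  map_comp {F G K} η θ := by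
    ext P
    exact ShortComplex.homologyMap_comp ((heartComplex P.obj).mapNatTrans η.hom)
      ((heartComplex P.obj).mapNatTrans θ.hom)

end Heart

/-! ### `J`-acyclic homological functors -/

section Homological

variable {J : Type u} [DGCategory.{v} J] [HasFiniteSums J]
variable {A : Type w₁} [Category.{w₂} A] [Abelian A]

/-- The sequence `X ⟶ Y ⟶ Z` is exact at `Y` (in particular, the composite is zero). -/
def ExactAt {X Y Z : A} (f : X ⟶ Y) (g : Y ⟶ Z) : Prop :=
  ∃ w : f ≫ g = 0, (ShortComplex.mk f g w).Exact

/-- A homological functor on `Tr(J)`: an additive functor such that, for every distinguished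
triangle `X ⟶ Y ⟶ Z ⟶ X[1]`, the sequence
`⋯ ⟶ H(X[s]) ⟶ H(Y[s]) ⟶ H(Z[s]) ⟶ H(X[1][s]) ⟶ H(Y[1][s]) ⟶ ⋯` is exact. -/
structure IsHomological (H : Tr J ⥤ A) : Prop where
  additive : H.Additive
  exact₂ : ∀ {X Y Z : Tr J} (a : X ⟶ Y) (b : Y ⟶ Z) (c : Z ⟶ (shiftTr J 1).obj X),
    IsDistinguished a b c → ∀ s : ℤ,
      ExactAt (H.map ((shiftTr J s).map a)) (H.map ((shiftTr J s).map b))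
  exact₃ : ∀ {X Y Z : Tr J} (a : X ⟶ Y) (b : Y ⟶ Z) (c : Z ⟶ (shiftTr J 1).obj X),
    IsDistinguished a b c → ∀ s : ℤ,
      ExactAt (H.map ((shiftTr J s).map b)) (H.map ((shiftTr J s).map c))
  exact₁ : ∀ {X Y Z : Tr J} (a : X ⟶ Y) (b : Y ⟶ Z) (c : Z ⟶ (shiftTr J 1).obj X),
    IsDistinguished a b c → ∀ s : ℤ,
      ExactAt (H.map ((shiftTr J s).map c)) (H.map ((shiftTr J s).map ((shiftTr J 1).map a)))

/-- `J`-acyclicity: `H(X[n]) = 0` for every object `X` of `J` and every `n ≠ 0`. -/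
def IsAcyclic (H : Tr J ⥤ A) : Prop :=
  ∀ (X : J) (n : ℤ), n ≠ 0 → IsZero (H.obj ((shiftTr J n).obj ((incl J).obj (HZero.of X))))

variable (J A)

/-- The property of functors `Tr(J) ⥤ A` to be homological and `J`-acyclic. -/
def acyclicHomological : ObjectProperty (Tr J ⥤ A) := fun H => IsHomological H ∧ IsAcyclic H

/-- The category of `J`-acyclic homological functors `Tr(J) ⥤ A` and natural transformations. -/
abbrev AcyclicHomologicalFunctor := (acyclicHomological J A).FullSubcategory

/-- The composition with the canonical functor `H⁰(J) ⥤ Tr(J)`, as a functor from the category of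
`J`-acyclic homological functors `Tr(J) ⥤ A` to the category of additive functors `H⁰(J) ⥤ A`. -/
def restriction : AcyclicHomologicalFunctor J A ⥤ (HZero J ⥤+ A) :=
  (additiveFunctor (HZero J) A).lift
    ((acyclicHomological J A).ι ⋙ (Functor.whiskeringLeft (HZero J) (Tr J) A).obj (incl J))
    (fun H => by
      have := H.property.1.additive
      exact inferInstanceAs (incl J ⋙ H.obj).Additive)

section Canonical

variable {J A} [IsNegative J]

/-- For an object `X` of `J`, regarded as a twisted complex `P` concentrated in degree `0`, the
canonical morphism from `F(X) = F(P^0)` to the cokernel of `F(P^{-1}) ⟶ F(P^0)`. The homology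
`ker(F(P^0) ⟶ F(P^1)) / im(F(P^{-1}) ⟶ F(P^0))` is a subobject of this cokernel. (For this `P`,
all three are `F(X)`, since `P^{-1}` and `P^1` are zero.) -/
def singleToOpcycles (F : HZero J ⥤ A) [F.Additive] (X : J) :
    F.obj (HZero.of X) ⟶ ((heartComplex (single X)).map F).opcycles :=
  ((heartComplex (single X)).map F).pOpcycles

end Canonical

end Homological

end TwistedComplex

end DGCategory

/-!
Since `J` is negative, a structure morphism `q_{ij}` of a twisted complex `P` vanishes unless
`i < j`. Therefore `P` can be restricted to every convex set of degrees (`exists_restriction`), and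
a cut between two degrees gives a distinguished triangle `P^{≥ k} ⟶ P ⟶ P^{< k} ⟶ P^{≥ k}[1]`
(`Restriction.isDistinguished`, for the rotated triangle shifted by one).

Let `H` be an acyclic homological functor. By induction on the number of degrees, these triangles
show that `H` vanishes on the twisted complexes concentrated in positive degrees and on those
concentrated in negative degrees (`IsHomological.isZero_of_pos`, `IsHomological.isZero_of_neg`).
The cut between `0` and `1` then makes `H(P) ⟶ H(P^{≤ 0}) ⟶ H(P^1)` exact with the first morphism
a monomorphism, and the cut of `P^{≤ 0}` between `-1` and `0` makes
`H(P^{-1}) ⟶ H(P^0) ⟶ H(P^{≤ 0})` exact with the second morphism an epimorphism. In other words,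
`H(P^{≤ 0})` and `H(P)` are right homology data for `H(P^{-1}) ⟶ H(P^0) ⟶ H(P^1)`
(`rightHomologyData`). The truncation `P ⟶ P^{≤ 0}` is functorial on closed morphisms
(`Restriction.map`), so the resulting isomorphism `homologyNatIso` is natural.

Conversely, let `F` be an additive functor on `H⁰(J)`. The objects `F(P^i)` form a bounded complex,
and the cone of a morphism `f` of twisted complexes yields the mapping cone of the morphism of
complexes given by the diagonal entries of `f`. The long exact sequence of a mapping cone is proved
on generalized elements (`exactAt_homologyMap`), and shows that the homology in degree zero is a
homological functor (`isHomological_heartHomology`); it is acyclic because `X[n]` has no object in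
degree zero if `n ≠ 0`. This construction is quasi-inverse to the restriction: on one side by
`homologyNatIso`, on the other because the homology in degree zero of the complex `0 ⟶ F(X) ⟶ 0`
is `F(X)` (`heartHomologySingleIso`).
-/

/-! ### Diagonal morphisms and shifts of twisted complexes -/

namespace DGCategory

namespace Family

variable {J : Type u} [DGCategory.{v} J]

lemma hom_ext {P Q : Family J} {k : ℤ} {f g : Hom P Q k}
    (h : ∀ (i j n : ℤ) (hn : n + j = i + k), f i j ⟨n, hn⟩ = g i j ⟨n, hn⟩) : f = g := by
  funext i j ⟨n, hn⟩
  exact h i j n hn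

/-- The diagonal matrix with entries `a i`, as a morphism of degree zero of the dg-category of
bounded families. -/
abbrev diagHom {P Q : Family J} (a : ∀ i, Hom (P.X i) (Q.X i) 0) : Hom P Q 0 := diag a

lemma diagHom_comp_apply {P Q R : Family J} (a : ∀ i, Hom (P.X i) (Q.X i) 0) {k : ℤ}
    (f : Hom Q R k) (i j n : ℤ) (hn : n + j = i + k) :
    comp (diagHom a) f (zero_add k) i j ⟨n, hn⟩ = comp (a i) (f i j ⟨n, hn⟩) (zero_add n) :=
  diag_comp a f i j n hn

lemma comp_diagHom_apply {P Q R : Family J} {k : ℤ} (f : Hom P Q k)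
    (b : ∀ i, Hom (Q.X i) (R.X i) 0) (i j n : ℤ) (hn : n + j = i + k) :
    comp f (diagHom b) (add_zero k) i j ⟨n, hn⟩ = comp (f i j ⟨n, hn⟩) (b j) (add_zero n) :=
  comp_diag f b i j n hn

lemma diagHom_comp_diagHom {P Q R : Family J} (a : ∀ i, Hom (P.X i) (Q.X i) 0)
    (b : ∀ i, Hom (Q.X i) (R.X i) 0) :
    comp (diagHom a) (diagHom b) (add_zero 0) =
      diagHom fun i => comp (a i) (b i) (add_zero 0) := by
  refine hom_ext fun i j n hn => ?_
  rw [diagHom_comp_apply]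
  by_cases hij : i = j
  · subst hij
    obtain rfl : n = 0 := by omega
    rw [diagHom, diagHom, diag_self, diag_self]
  · rw [diagHom, diagHom, diag_ne _ hij, diag_ne _ hij, comp_zero]

lemma diagHom_add {P Q : Family J} (a b : ∀ i, Hom (P.X i) (Q.X i) 0) :
    diagHom (fun i => a i + b i) = diagHom a + diagHom b := by
  refine hom_ext fun i j n hn => ?_
  change diag _ i j ⟨n, hn⟩ = diag a i j ⟨n, hn⟩ + diag b i j ⟨n, hn⟩
  by_cases hij : i = j
  · subst hij
    obtain rfl : n = 0 := by omega
    rw [diag_self, diag_self, diag_self]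
  · rw [diag_ne _ hij, diag_ne _ hij, diag_ne _ hij]
    exact (add_zero _).symm

lemma sandwich_diagHom_apply {P Q R S : Family J} (a : ∀ i, Hom (P.X i) (Q.X i) 0) {k : ℤ}
    (f : Hom Q R k) (b : ∀ i, Hom (R.X i) (S.X i) 0) (i j n : ℤ) (hn : n + j = i + k) :
    TwistedComplex.sandwich (diagHom a) f (diagHom b) i j ⟨n, hn⟩ =
      TwistedComplex.sandwich (a i) (f i j ⟨n, hn⟩) (b j) := by
  unfold TwistedComplex.sandwich
  rw [comp_diagHom_apply, diagHom_comp_apply]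

lemma d_diagHom [IsNegative J] {P Q : Family J} (a : ∀ i, Hom (P.X i) (Q.X i) 0) :
    d 0 1 (zero_add 1) (diagHom a) = 0 :=
  matD_diag a fun _ => IsNegative.eq_zero one_pos _

/-- The identity of an object of a family, regarded as a morphism between two objects whose indices
are propositionally equal. -/
def castHom (P : Family J) {i j : ℤ} (h : i = j) : Hom (P.X i) (P.X j) 0 := by
  subst h
  exact id (P.X i)

lemma castHom_comp_castHom (P : Family J) {i j : ℤ} (h : i = j) (h' : j = i) :
    comp (P.castHom h) (P.castHom h') (add_zero 0) = id (P.X i) := by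
  subst h
  exact id_comp _

lemma castHom_comp {P Q : Family J} {k : ℤ} (f : Hom P Q k) {i i' j j' : ℤ} (hi : i = i')
    (hj : j = j') (n : ℤ) (h : n + j = i + k) (h' : n + j' = i' + k) :
    comp (P.castHom hi) (f i' j' ⟨n, h'⟩) (zero_add n) =
      comp (f i j ⟨n, h⟩) (Q.castHom hj) (add_zero n) := by
  subst hi hj
  exact (id_comp _).trans (comp_id _).symm

end Family

namespace TwistedComplex

section Entry

variable {J : Type u} [DGCategory.{v} J]

/-- The entry `f_{ij}`, of degree `n = i - j`, of a closed morphism `f` of degree zero. -/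
def entry {P Q : TwistedComplex J} (f : cocycles P Q) (i j n : ℤ) (hn : n + j = i + 0) :
    Hom (P.fam.X i) (Q.fam.X j) n :=
  (show Family.Mat P.fam Q.fam 0 from f.1) i j ⟨n, hn⟩

lemma cocycles_ext {P Q : TwistedComplex J} {f g : cocycles P Q}
    (h : ∀ (i j n : ℤ) (hn : n + j = i + 0), entry f i j n hn = entry g i j n hn) : f = g :=
  Subtype.ext (Family.hom_ext h)

lemma entry_shift (s : ℤ) {P Q : TwistedComplex J} (f : cocycles P Q) (i j n : ℤ)
    (hn : n + j = i + 0) :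
    entry ((shiftDG s).mapCocycles f) i j n hn = entry f (i + s) (j + s) n (by omega) := by
  change (s * 0).negOnePow • entry f (i + s) (j + s) n _ = _
  rw [mul_zero, Int.negOnePow_zero, one_smul]

lemma shift_comm (s : ℤ) {P Q : TwistedComplex J} (a : ∀ i, Hom (P.fam.X i) (Q.fam.X i) 0)
    (ha : ∀ (i j n : ℤ) (hn : n + j = i + 1), comp (a i) (Q.q i j ⟨n, hn⟩) (zero_add n) =
      comp (P.q i j ⟨n, hn⟩) (a j) (add_zero n)) (i j n : ℤ) (hn : n + j = i + 1) :
    comp (a (i + s)) ((shift s Q).q i j ⟨n, hn⟩) (zero_add n) =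
      comp ((shift s P).q i j ⟨n, hn⟩) (a (j + s)) (add_zero n) := by
  change comp _ (s.negOnePow • Q.q (i + s) (j + s) ⟨n, by omega⟩) _ =
    comp (s.negOnePow • P.q (i + s) (j + s) ⟨n, by omega⟩) _ _
  rw [comp_units_smul, units_smul_comp, ha]

end Entry

section Diagonal

variable {J : Type u} [DGCategory.{v} J] [IsNegative J]

/-- For `J` negative, a family of morphisms `P^i ⟶ Q^i` of degree zero which commute with the
structure morphisms `q_{ij}` is a closed morphism of twisted complexes. -/
def diagCocycle {P Q : TwistedComplex J} (a : ∀ i, Hom (P.fam.X i) (Q.fam.X i) 0)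
    (ha : ∀ (i j n : ℤ) (hn : n + j = i + 1), comp (a i) (Q.q i j ⟨n, hn⟩) (zero_add n) =
      comp (P.q i j ⟨n, hn⟩) (a j) (add_zero n)) : cocycles P Q :=
  ⟨Family.diagHom a, by
    refine (congrArg₂ (· + ·) (Family.d_diagHom a) (sub_eq_zero.2 ?_)).trans (add_zero _)
    rw [Int.negOnePow_zero, one_smul]
    refine Family.hom_ext fun i j n hn => ?_
    rw [Family.diagHom_comp_apply, Family.comp_diagHom_apply, ha]⟩

/-- A diagonal closed morphism whose entries are invertible is an isomorphism in `Tr(J)`. -/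
def diagIso {P Q : TwistedComplex J} (a : ∀ i, Hom (P.fam.X i) (Q.fam.X i) 0)
    (b : ∀ i, Hom (Q.fam.X i) (P.fam.X i) 0)
    (hab : ∀ i, comp (a i) (b i) (add_zero 0) = id _)
    (hba : ∀ i, comp (b i) (a i) (add_zero 0) = id _)
    (ha : ∀ (i j n : ℤ) (hn : n + j = i + 1), comp (a i) (Q.q i j ⟨n, hn⟩) (zero_add n) =
      comp (P.q i j ⟨n, hn⟩) (a j) (add_zero n)) :
    HZero.of P ≅ HZero.of Q where
  hom := HZero.mk (diagCocycle a ha)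
  inv := HZero.mk (diagCocycle b fun i j n hn => by
    rw [← comp_id (P.q i j ⟨n, hn⟩), ← hab j,
      ← assoc _ (a j) (b j) (add_zero n) (add_zero 0) (add_zero n) (add_zero n), ← ha i j n hn,
      assoc (a i) _ (b j) (zero_add n) (add_zero n) (add_zero n) (zero_add n),
      ← assoc (b i) (a i) _ (add_zero 0) (zero_add n) (zero_add n) (zero_add n), hba, id_comp])
  hom_inv_id := by
    rw [← HZero.mk_comp]
    refine congrArg HZero.mk (Subtype.ext ((Family.diagHom_comp_diagHom a b).trans ?_))
    simp only [hab]
    rfl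
  inv_hom_id := by
    rw [← HZero.mk_comp]
    refine congrArg HZero.mk (Subtype.ext ((Family.diagHom_comp_diagHom b a).trans ?_))
    simp only [hba]
    rfl

lemma entry_diagCocycle_comp {P Q R : TwistedComplex J} (a : ∀ i, Hom (P.fam.X i) (Q.fam.X i) 0)
    (ha : ∀ (i j n : ℤ) (hn : n + j = i + 1), comp (a i) (Q.q i j ⟨n, hn⟩) (zero_add n) =
      comp (P.q i j ⟨n, hn⟩) (a j) (add_zero n)) (f : cocycles Q R) (i j n : ℤ)
    (hn : n + j = i + 0) :
    entry (cocyclesComp (diagCocycle a ha) f) i j n hn =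
      comp (a i) (entry f i j n hn) (zero_add n) :=
  Family.diag_comp (P := P.fam) (Q := Q.fam) (R := R.fam) a f.1 i j n hn

lemma entry_comp_diagCocycle {P Q R : TwistedComplex J} (f : cocycles P Q)
    (a : ∀ i, Hom (Q.fam.X i) (R.fam.X i) 0)
    (ha : ∀ (i j n : ℤ) (hn : n + j = i + 1), comp (a i) (R.q i j ⟨n, hn⟩) (zero_add n) =
      comp (Q.q i j ⟨n, hn⟩) (a j) (add_zero n)) (i j n : ℤ) (hn : n + j = i + 0) :
    entry (cocyclesComp f (diagCocycle a ha)) i j n hn =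
      comp (entry f i j n hn) (a j) (add_zero n) :=
  Family.comp_diag (P := P.fam) (Q := Q.fam) (R := R.fam) f.1 a i j n hn

lemma shiftDG_mapCocycles_diagCocycle (s : ℤ) {P Q : TwistedComplex J}
    (a : ∀ i, Hom (P.fam.X i) (Q.fam.X i) 0)
    (ha : ∀ (i j n : ℤ) (hn : n + j = i + 1), comp (a i) (Q.q i j ⟨n, hn⟩) (zero_add n) =
      comp (P.q i j ⟨n, hn⟩) (a j) (add_zero n)) :
    (shiftDG s).mapCocycles (diagCocycle a ha) =
      diagCocycle (P := shift s P) (Q := shift s Q) (fun i => a (i + s)) (shift_comm s a ha) := by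
  refine cocycles_ext fun i j n hn => ?_
  rw [entry_shift]
  have e : Family.diag a (i + s) (j + s) ⟨n, by omega⟩ = Family.diag (P := shiftFamily s P.fam)
      (Q := shiftFamily s Q.fam) (fun i => a (i + s)) i j ⟨n, hn⟩ := by
    by_cases hij : i = j
    · subst hij
      obtain rfl : n = 0 := by omega
      rw [Family.diag_self, Family.diag_self]
    · rw [Family.diag_ne _ hij, Family.diag_ne _ (by omega)]
  exact e

/-- If `s + t = 0`, the isomorphism `P[s][t] ≅ P`. -/
def shiftCancelObj (s t : ℤ) (h : s + t = 0) (P : TwistedComplex J) :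
    HZero.of (shift t (shift s P)) ≅ HZero.of P :=
  diagIso (P := shift t (shift s P)) (fun _ => P.fam.castHom (by omega))
    (fun _ => P.fam.castHom (by omega)) (fun _ => Family.castHom_comp_castHom _ _ _)
    (fun _ => Family.castHom_comp_castHom _ _ _) (fun i j n hn => by
      change comp _ _ _ = comp (t.negOnePow • s.negOnePow • P.q (i + t + s) (j + t + s)
        ⟨n, by omega⟩) _ _
      rw [smul_smul, ← Int.negOnePow_add, add_comm t, h, Int.negOnePow_zero, one_smul]
      exact Family.castHom_comp P.q _ _ n _ hn)

/-- If `s + t = 0`, the shifts by `s` and by `t` are inverse to each other on `Tr(J)`. -/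
def shiftCancel [HasFiniteSums J] (s t : ℤ) (h : s + t = 0) :
    shiftTr J s ⋙ shiftTr J t ≅ 𝟭 (Tr J) :=
  NatIso.ofComponents (fun P => shiftCancelObj s t h P.obj) (by
    intro P Q f
    obtain ⟨f, rfl⟩ := HZero.mk_surjective f
    refine congrArg HZero.mk (cocycles_ext fun i j n hn => ?_)
    refine (entry_comp_diagCocycle _ _ _ i j n hn).trans
      (Eq.trans ?_ (entry_diagCocycle_comp _ _ f i j n hn).symm)
    have e := (entry_shift t ((shiftDG s).mapCocycles f) i j n hn).trans
      (entry_shift s f (i + t) (j + t) n (by omega))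
    exact (congrArg (fun x => comp x _ (add_zero n)) e).trans
      (Family.castHom_comp _ _ _ n _ hn).symm)

end Diagonal

/-! ### Restrictions of twisted complexes to convex sets of degrees -/

section Restriction

variable {J : Type u} [DGCategory.{v} J]

/-- The data exhibiting `Q` as the restriction of the twisted complex `P` to the degrees in `S`:
`Q^i` is identified with `P^i` for `i ∈ S` and is zero for `i ∉ S`, and the structure morphisms of
`Q` are those of `P`. Neither `Q ⟶ P` nor `P ⟶ Q` is required to be closed. -/
structure Restriction (S : Set ℤ) (P Q : TwistedComplex J) where
  inc : ∀ i, Hom (Q.fam.X i) (P.fam.X i) 0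
  proj : ∀ i, Hom (P.fam.X i) (Q.fam.X i) 0
  inc_proj : ∀ i, comp (inc i) (proj i) (add_zero 0) = id (Q.fam.X i)
  proj_inc : ∀ i ∈ S, comp (proj i) (inc i) (add_zero 0) = id (P.fam.X i)
  id_eq_zero : ∀ i ∉ S, id (Q.fam.X i) = 0
  q_eq : ∀ (i j n : ℤ) (hn : n + j = i + 1),
    Q.q i j ⟨n, hn⟩ = sandwich (inc i) (P.q i j ⟨n, hn⟩) (proj j)

lemma eq_zero_of_id_source {X Y : J} (hX : id X = 0) {n : ℤ} (f : Hom X Y n) : f = 0 := by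
  rw [← id_comp f, hX, zero_comp]

lemma eq_zero_of_id_target {X Y : J} (hY : id Y = 0) {n : ℤ} (f : Hom X Y n) : f = 0 := by
  rw [← comp_id f, hY, comp_zero]

lemma sandwich_sandwich {S' S X X' T T' : J} {n : ℤ} (a' : Hom S' S 0) (a : Hom S X 0)
    (x : Hom X X' n) (b : Hom X' T 0) (b' : Hom T T' 0) :
    sandwich a' (sandwich a x b) b' =
      sandwich (comp a' a (add_zero 0)) x (comp b b' (add_zero 0)) := by
  rw [sandwich, comp_sandwich_right, sandwich_comp_right]

namespace Restriction

variable {S T : Set ℤ} {P Q R : TwistedComplex J}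

lemma id_eq_zero_of_id_eq_zero (h : Restriction S P Q) {i : ℤ} (hP : id (P.fam.X i) = 0) :
    id (Q.fam.X i) = 0 := by
  rw [← h.inc_proj i, eq_zero_of_id_source hP (h.proj i), comp_zero]

/-- If `P` is zero in the degrees of `T` which are not in `S`, then the restriction to `S` is also
the restriction to `T`. -/
def mono (h : Restriction S P Q) (hST : S ⊆ T) (hP : ∀ i ∈ T, i ∉ S → id (P.fam.X i) = 0) :
    Restriction T P Q where
  inc := h.inc
  proj := h.proj
  inc_proj := h.inc_proj
  proj_inc i hi := by
    by_cases hS : i ∈ S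
    · exact h.proj_inc i hS
    · rw [hP i hi hS]
      exact eq_zero_of_id_source (hP i hi hS) _
  id_eq_zero i hi := h.id_eq_zero i fun hS => hi (hST hS)
  q_eq := h.q_eq

/-- For `S ⊆ T`, the restriction to `S` is the restriction to `S` of the restriction to `T`. -/
def factor (h : Restriction S P Q) (h' : Restriction T P R) (hST : S ⊆ T) :
    Restriction S R Q where
  inc i := comp (h.inc i) (h'.proj i) (add_zero 0)
  proj i := comp (h'.inc i) (h.proj i) (add_zero 0)
  inc_proj i := by
    by_cases hi : i ∈ T
    · rw [assoc _ _ _ (add_zero 0) (add_zero 0) (add_zero 0) (add_zero 0),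
        ← assoc (h'.proj i) _ _ (add_zero 0) (add_zero 0) (add_zero 0) (add_zero 0),
        h'.proj_inc i hi, id_comp, h.inc_proj]
    · have h₀ := h.id_eq_zero i fun hS => hi (hST hS)
      rw [h₀]
      exact eq_zero_of_id_source h₀ _
  proj_inc i hi := by
    rw [assoc _ _ _ (add_zero 0) (add_zero 0) (add_zero 0) (add_zero 0),
      ← assoc (h.proj i) _ _ (add_zero 0) (add_zero 0) (add_zero 0) (add_zero 0),
      h.proj_inc i hi, id_comp, h'.inc_proj]
  id_eq_zero := h.id_eq_zero
  q_eq i j n hn := by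
    by_cases hi : i ∈ T
    · by_cases hj : j ∈ T
      · rw [h.q_eq, h'.q_eq, sandwich_sandwich,
          assoc (h.inc i) _ _ (add_zero 0) (add_zero 0) (add_zero 0) (add_zero 0),
          h'.proj_inc i hi, comp_id,
          ← assoc (h'.proj j) _ _ (add_zero 0) (add_zero 0) (add_zero 0) (add_zero 0),
          h'.proj_inc j hj, id_comp]
      · have h₀ := h.id_eq_zero j fun hS => hj (hST hS)
        rw [eq_zero_of_id_target h₀ (Q.q i j ⟨n, hn⟩)]
        exact (eq_zero_of_id_target h₀ _).symm
    · have h₀ := h.id_eq_zero i fun hS => hi (hST hS)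
      rw [eq_zero_of_id_source h₀ (Q.q i j ⟨n, hn⟩)]
      exact (eq_zero_of_id_source h₀ _).symm

lemma sandwich_q (h : Restriction S P Q) :
    sandwich (Family.diagHom h.inc) P.q (Family.diagHom h.proj) = Q.q :=
  Family.hom_ext fun i j n hn => by rw [Family.sandwich_diagHom_apply, h.q_eq]

end Restriction

lemma exists_object_restriction [HasFiniteSums J] (X : J) (c : Prop) :
    ∃ (Y : J) (a : Hom Y X 0) (b : Hom X Y 0), comp a b (add_zero 0) = id Y ∧
      (c → comp b a (add_zero 0) = id X) ∧ (¬ c → id Y = 0) := by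
  by_cases hc : c
  · exact ⟨X, id X, id X, id_comp _, fun _ => id_comp _, fun h => absurd hc h⟩
  · exact ⟨zeroObj J, 0, 0, by rw [id_zeroObj, comp_zero], fun h => absurd h hc,
      fun _ => id_zeroObj J⟩

variable [IsNegative J]

lemma q_eq_zero (P : TwistedComplex J) (i j n : ℤ) (hn : n + j = i + 1) (hij : j ≤ i) :
    P.q i j ⟨n, hn⟩ = 0 :=
  IsNegative.eq_zero (n := n) (by omega) _

namespace Restriction

variable {S T : Set ℤ} {P Q R : TwistedComplex J}

/-- A nonzero structure morphism `P^i ⟶ P^j` has `i < j`, so it cannot leave an upper set of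
degrees. -/
lemma inc_comm (h : Restriction S P Q) (hS : IsUpperSet S) (i j n : ℤ) (hn : n + j = i + 1) :
    comp (h.inc i) (P.q i j ⟨n, hn⟩) (zero_add n) =
      comp (Q.q i j ⟨n, hn⟩) (h.inc j) (add_zero n) := by
  by_cases hi : i ∈ S
  · by_cases hj : j ∈ S
    · rw [h.q_eq, sandwich_comp_right, h.proj_inc j hj, sandwich_id]
    · have hij : j ≤ i := by
        by_contra hij
        exact hj (hS (by omega) hi)
      rw [q_eq_zero P i j n hn hij, q_eq_zero Q i j n hn hij, comp_zero, zero_comp]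
  · have h₀ := h.id_eq_zero i hi
    rw [eq_zero_of_id_source h₀ (comp _ _ _), eq_zero_of_id_source h₀ (comp _ _ _)]

lemma proj_comm (h : Restriction S P Q) (hS : IsLowerSet S) (i j n : ℤ) (hn : n + j = i + 1) :
    comp (h.proj i) (Q.q i j ⟨n, hn⟩) (zero_add n) =
      comp (P.q i j ⟨n, hn⟩) (h.proj j) (add_zero n) := by
  by_cases hj : j ∈ S
  · by_cases hi : i ∈ S
    · rw [h.q_eq, comp_sandwich_right, h.proj_inc i hi, id_sandwich]
    · have hij : j ≤ i := by
        by_contra hij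
        exact hi (hS (by omega) hj)
      rw [q_eq_zero P i j n hn hij, q_eq_zero Q i j n hn hij, comp_zero, zero_comp]
  · have h₀ := h.id_eq_zero j hj
    rw [eq_zero_of_id_target h₀ (comp _ _ _), eq_zero_of_id_target h₀ (comp _ _ _)]

/-- The inclusion `Q ⟶ P` of the restriction to an upper set of degrees. -/
def incCocycle (h : Restriction S P Q) (hS : IsUpperSet S) : cocycles Q P :=
  diagCocycle h.inc (h.inc_comm hS)

/-- The projection `P ⟶ Q` to the restriction to a lower set of degrees. -/
def projCocycle (h : Restriction S P Q) (hS : IsLowerSet S) : cocycles P Q :=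
  diagCocycle h.proj (h.proj_comm hS)

/-- A restriction to all the degrees in which `P` is not zero is isomorphic to `P`. -/
def iso (h : Restriction S P Q) (hP : ∀ i ∉ S, id (P.fam.X i) = 0) :
    HZero.of P ≅ HZero.of Q :=
  diagIso h.proj h.inc
    (fun i => (h.mono (Set.subset_univ S) fun i _ => hP i).proj_inc i (Set.mem_univ i)) h.inc_proj
    ((h.mono (Set.subset_univ S) fun i _ => hP i).proj_comm isLowerSet_univ)

end Restriction

/-- A twisted complex can be restricted to every convex set of degrees. -/
lemma exists_restriction [HasFiniteSums J] (S : Set ℤ) (hS : S.OrdConnected)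
    (P : TwistedComplex J) : ∃ Q : TwistedComplex J, Nonempty (Restriction S P Q) := by
  choose Y a b hab hba h₀ using fun i => exists_object_restriction (P.fam.X i) (i ∈ S)
  let F : Family J :=
    { X := Y
      finite := P.fam.finite.subset fun i hi hP => hi (by
        rw [← hab i, eq_zero_of_id_target hP (a i), zero_comp]) }
  let A : Hom F P.fam 0 := Family.diagHom a
  let B : Hom P.fam F 0 := Family.diagHom b
  have hA : d 0 1 (zero_add 1) A = 0 := Family.d_diagHom (P := F) a
  have hB : d 0 1 (zero_add 1) B = 0 := Family.d_diagHom (Q := F) b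
  -- A composite `P^i ⟶ P^m ⟶ P^j` of structure morphisms vanishes unless `i < m < j`, so that
  -- for `i, j ∈ S` only the `m ∈ S` contribute.
  have key : sandwich A (comp (comp P.q (comp B A (add_zero 0)) (add_zero 1)) P.q
      one_add_one_eq_two) B = sandwich A (comp P.q P.q one_add_one_eq_two) B := by
    have e : comp B A (add_zero 0) = Family.diagHom fun i => comp (b i) (a i) (add_zero 0) :=
      Family.diagHom_comp_diagHom (Q := F) b a
    rw [e]
    refine Family.hom_ext fun i j n hn => ?_
    refine (Family.sandwich_diagHom_apply (P := F) (S := F) a _ b i j n hn).trans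
      (Eq.trans ?_ (Family.sandwich_diagHom_apply (P := F) (S := F) a _ b i j n hn).symm)
    by_cases hi : i ∈ S
    · by_cases hj : j ∈ S
      · congr 1
        refine finsum_congr fun m => ?_
        have e' := Family.comp_diagHom_apply P.q (fun i => comp (b i) (a i) (add_zero 0)) i m
          (i + 1 - m) (by omega)
        refine (congrArg (fun x => comp x _ _) e').trans ?_
        by_cases him : m ≤ i
        · rw [q_eq_zero P i m _ _ him, zero_comp, zero_comp]
        · by_cases hmj : j ≤ m
          · rw [q_eq_zero P m j _ _ hmj, comp_zero, comp_zero]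
          · rw [hba m (hS.out hi hj ⟨by omega, by omega⟩), comp_id]
      · exact (eq_zero_of_id_target (h₀ j hj) _).trans (eq_zero_of_id_target (h₀ j hj) _).symm
    · exact (eq_zero_of_id_source (h₀ i hi) _).trans (eq_zero_of_id_source (h₀ i hi) _).symm
  refine ⟨{ fam := F, q := sandwich A P.q B, eq_zero := ?_ }, ⟨?_⟩⟩
  · rw [d_sandwich _ _ _ _ hA hB, comp_sandwich, key, sandwich_eq, sandwich_eq, ← map_add,
      P.eq_zero, map_zero]
  · exact
      { inc := a
        proj := b
        inc_proj := hab
        proj_inc := hba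
        id_eq_zero := h₀
        q_eq := fun i j n hn => Family.sandwich_diagHom_apply (P := F) (S := F) a P.q b i j n hn }

end Restriction

/-! ### The distinguished triangle of a truncation -/

section Rotate

variable {J : Type u} [DGCategory.{v} J]

/-- A matrix of degree `k + 1` to `Q`, regarded as a matrix of degree `k` to `Q[1]`. -/
def toShiftOne {P Q : Family J} (k l : ℤ) (h : k + 1 = l) (f : Hom P Q l) :
    Hom P (shiftFamily 1 Q) k := fun i j n =>
  f i (j + 1) ⟨n.1, by have := n.2; omega⟩

lemma toShiftOne_comp {P Q R : Family J} {k l m k' m' : ℤ} (f : Hom P Q k) (g : Hom Q R l)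
    (h : k + l = m) (hk : k' + 1 = k) (hm : m' + 1 = m) :
    toShiftOne m' m hm (comp f g h) =
      comp (toShiftOne k' k hk f) (shiftMat 1 g) (show k' + l = m' by omega) := by
  refine Family.hom_ext fun i j n hn => ?_
  have e : ∀ (a x y : ℤ) (hx : x + (a + 1) = i + k) (hy : y + (j + 1) = (a + 1) + l)
      (x' y' : ℤ) (hx' : x' + (a + 1) = i + k) (hy' : y' + (j + 1) = (a + 1) + l)
      (h : x + y = n) (h' : x' + y' = n),
      comp (f i (a + 1) ⟨x, hx⟩) (g (a + 1) (j + 1) ⟨y, hy⟩) h =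
        comp (f i (a + 1) ⟨x', hx'⟩) (g (a + 1) (j + 1) ⟨y', hy'⟩) h' := by
    intro m x y hx hy x' y' hx' hy' h h'
    obtain rfl : x = x' := by omega
    obtain rfl : y = y' := by omega
    rfl
  refine (finsum_comp_equiv (Equiv.addRight (1 : ℤ))).symm.trans (finsum_congr fun a => ?_)
  exact e a _ _ _ _ _ _ _ _ _ _

lemma comp_toShiftOne {P Q R : Family J} {k l m l' m' : ℤ} (f : Hom P Q k) (g : Hom Q R l)
    (h : k + l = m) (hl : l' + 1 = l) (hm : m' + 1 = m) :
    toShiftOne m' m hm (comp f g h) =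
      comp f (toShiftOne l' l hl g) (show k + l' = m' by omega) := by
  refine Family.hom_ext fun i j n hn => ?_
  refine finsum_congr fun a => ?_
  have e : ∀ (x y y' : ℤ) (hx : x + a = i + k) (hy : y + (j + 1) = a + l)
      (hy' : y' + (j + 1) = a + l) (h : x + y = n) (h' : x + y' = n),
      comp (f i a ⟨x, hx⟩) (g a (j + 1) ⟨y, hy⟩) h =
        comp (f i a ⟨x, hx⟩) (g a (j + 1) ⟨y', hy'⟩) h' := by
    intro x y y' hx hy hy' h h'
    obtain rfl : y = y' := by omega
    rfl
  exact e _ _ _ _ _ _ _ _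

/-- The sign `(-1) ^ j` in the differential of matrices changes when the target is reindexed. -/
lemma toShiftOne_d {P Q : Family J} {k l m : ℤ} (f : Hom P Q l) (hk : k + 1 = l)
    (hl : l + 1 = m) :
    toShiftOne l m hl (d l m hl f) = -d k l hk (toShiftOne k l hk f) := by
  refine Family.hom_ext fun i j n hn => ?_
  refine (Family.matD_apply l m hl f i (j + 1) (n - 1) n (by omega) (by omega)).trans ?_
  refine Eq.trans ?_ (congrArg (- ·)
    (Family.matD_apply k l hk (toShiftOne k l hk f) i j (n - 1) n hn (by omega)).symm)
  rw [Int.negOnePow_succ, Units.neg_smul]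
  rfl

end Rotate

section Triangle

variable {J : Type u} [DGCategory.{v} J]

lemma comp_comp_comp_of_deg_zero {X₁ X₂ X₃ X₄ X₅ : J} (a : Hom X₁ X₂ 0) (b : Hom X₂ X₃ 0)
    (c : Hom X₃ X₄ 0) (e : Hom X₄ X₅ 0) :
    comp (comp a b (add_zero 0)) (comp c e (add_zero 0)) (add_zero 0) =
      sandwich a (comp b c (add_zero 0)) e := by
  rw [sandwich, ← assoc _ c e (add_zero 0) (add_zero 0) (add_zero 0) (add_zero 0),
    assoc a b c (add_zero 0) (add_zero 0) (add_zero 0) (add_zero 0)]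

lemma comp_neg_sandwich_comp {X X' Y Y' : J} {p : Hom X X' 0} {s : Hom X' X 0} {r : Hom Y Y' 0}
    {i : Hom Y' Y 0} (hp : comp p s (add_zero 0) = id X) (hr : comp r i (add_zero 0) = id Y)
    (q : Hom X Y 0) :
    comp p (comp (-sandwich s q r) i (add_zero 0)) (add_zero 0) = -q := by
  rw [neg_comp, comp_neg, sandwich_comp_right, comp_sandwich_right, hp, hr, id_sandwich, comp_id]

lemma comp_binarySum_lift {X Y W : J} (B : BinarySum X Y) (p : Hom W X 0) (r : Hom W Y 0)
    {i : Hom Y W 0} (hp : comp i p (add_zero 0) = 0) (hr : comp i r (add_zero 0) = id Y) :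
    comp i (comp p B.inl (add_zero 0) + comp r B.inr (add_zero 0)) (add_zero 0) = B.inr := by
  rw [comp_add, ← assoc _ _ _ (add_zero 0) (add_zero 0) (add_zero 0) (add_zero 0),
    ← assoc _ _ _ (add_zero 0) (add_zero 0) (add_zero 0) (add_zero 0), hp, hr, zero_comp,
    zero_add, id_comp]

lemma binarySum_lift_fst {X Y W : J} (B : BinarySum X Y) (p : Hom W X 0) (r : Hom W Y 0) :
    comp (comp p B.inl (add_zero 0) + comp r B.inr (add_zero 0)) B.fst (add_zero 0) = p := by
  rw [add_comp, assoc _ _ _ (add_zero 0) (add_zero 0) (add_zero 0) (add_zero 0),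
    assoc _ _ _ (add_zero 0) (add_zero 0) (add_zero 0) (add_zero 0), B.inl_fst, B.inr_fst,
    comp_zero, add_zero, comp_id]

/-- The commutation of the morphism `(s, i)` from a cone with the structure morphisms, entry by
entry. -/
lemma binarySum_desc_comm {X Y X' Y' W W' : J} (B : BinarySum X Y) (B' : BinarySum X' Y') {n : ℤ}
    {s : Hom X W 0} {i : Hom Y W 0} {s' : Hom X' W' 0} {i' : Hom Y' W' 0} {q : Hom W W' n}
    {x : Hom X X' n} {w : Hom X Y' n} {y : Hom Y Y' n}
    (h₁ : comp x s' (add_zero n) - comp w i' (add_zero n) = comp s q (zero_add n))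
    (h₂ : comp i q (zero_add n) = comp y i' (add_zero n)) :
    comp (comp B.fst s (add_zero 0) + comp B.snd i (add_zero 0)) (-q) (zero_add n) =
      comp (sandwich B.fst (-x) B'.inl + sandwich B.fst w B'.inr + sandwich B.snd (-y) B'.inr)
        (comp B'.fst s' (add_zero 0) + comp B'.snd i' (add_zero 0)) (add_zero n) := by
  rw [add_comp, assoc _ s _ (add_zero 0) (zero_add n) (zero_add n) (zero_add n),
    assoc _ i _ (add_zero 0) (zero_add n) (zero_add n) (zero_add n), comp_neg, comp_neg, ← h₁,
    comp_neg, h₂]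
  simp only [add_comp, comp_add, sandwich_comp_right,
    ← assoc _ _ _ (add_zero 0) (add_zero 0) (add_zero 0) (add_zero 0), BinarySum.inl_fst,
    BinarySum.inr_snd, BinarySum.inl_snd, BinarySum.inr_fst, id_comp, zero_comp, sandwich_zero,
    add_zero, zero_add]
  simp only [sandwich, assoc _ _ _ (zero_add n) (add_zero n) (add_zero n) (zero_add n), neg_comp,
    comp_neg, comp_sub]
  abel

namespace Restriction

variable {S : Set ℤ} {P Q R : TwistedComplex J}

lemma inc_proj_eq_zero {T : Set ℤ} (hQ : Restriction S P Q) (hR : Restriction T P R)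
    (hST : Disjoint S T) (i : ℤ) : comp (hQ.inc i) (hR.proj i) (add_zero 0) = 0 := by
  by_cases hi : i ∈ S
  · exact eq_zero_of_id_target (hR.id_eq_zero i fun h => Set.disjoint_left.1 hST hi h) _
  · exact eq_zero_of_id_source (hQ.id_eq_zero i hi) _

lemma total (hQ : Restriction S P Q) (hR : Restriction Sᶜ P R) (i : ℤ) :
    comp (hQ.proj i) (hQ.inc i) (add_zero 0) + comp (hR.proj i) (hR.inc i) (add_zero 0) =
      id (P.fam.X i) := by
  by_cases hi : i ∈ S
  · rw [hQ.proj_inc i hi, eq_zero_of_id_source (hR.id_eq_zero i fun h => h hi) (hR.inc i),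
      comp_zero, add_zero]
  · rw [hR.proj_inc i hi, eq_zero_of_id_source (hQ.id_eq_zero i hi) (hQ.inc i),
      comp_zero, zero_add]

variable [IsNegative J]

/-- For an upper set `S` of degrees, the part of the structure morphism of `P` which goes from the
restriction `R` of `P` to `Sᶜ` to the restriction `Q` of `P` to `S`, with the sign changed. It
is a closed morphism `R ⟶ Q[1]`, with cone `P[1]`. -/
def connecting (hQ : Restriction S P Q) (hR : Restriction Sᶜ P R) :
    cocycles R (shift 1 Q) :=
  ⟨toShiftOne 0 1 (zero_add 1)
      (-sandwich (Family.diagHom hR.inc) P.q (Family.diagHom hQ.proj)), by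
    let i : Hom Q.fam P.fam 0 := Family.diagHom hQ.inc
    let r : Hom P.fam Q.fam 0 := Family.diagHom hQ.proj
    let p : Hom P.fam R.fam 0 := Family.diagHom hR.proj
    let s : Hom R.fam P.fam 0 := Family.diagHom hR.inc
    have hr : d 0 1 (zero_add 1) r = 0 := Family.d_diagHom _
    have hs : d 0 1 (zero_add 1) s = 0 := Family.d_diagHom _
    have hri : comp r i (add_zero 0) + comp p s (add_zero 0) = id P.fam := by
      rw [Family.diagHom_comp_diagHom, Family.diagHom_comp_diagHom, ← Family.diagHom_add]
      exact congrArg Family.diagHom (funext fun m => hQ.total hR m)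
    let w : Hom R.fam Q.fam 1 := sandwich s P.q r
    -- The component `R ⟶ Q` of the equation `d q + q ∘ q = 0` of `P`.
    have hw : d 1 2 one_add_one_eq_two w + comp w Q.q one_add_one_eq_two +
        comp R.q w one_add_one_eq_two = 0 := by
      rw [← hQ.sandwich_q, ← hR.sandwich_q]
      change d 1 2 _ (sandwich s P.q r) + comp (sandwich s P.q r) (sandwich i P.q r) _ +
        comp (sandwich s P.q p) (sandwich s P.q r) _ = 0
      rw [d_sandwich _ _ _ _ hs hr, comp_sandwich, comp_sandwich, sandwich_eq, sandwich_eq,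
        sandwich_eq, ← map_add, ← map_add, add_assoc, ← add_comp, ← comp_add, hri, comp_id,
        P.eq_zero, map_zero]
    let W : Hom R.fam (shift 1 Q).fam 0 := toShiftOne 0 1 (zero_add 1) (-w)
    change d 0 1 (zero_add 1) W + (comp W ((1 : ℤ).negOnePow • shiftMat 1 Q.q) (zero_add 1) -
      (0 : ℤ).negOnePow • comp R.q W (add_zero 1)) = 0
    have h₁ : d 0 1 (zero_add 1) W = toShiftOne 1 2 one_add_one_eq_two
        (d 1 2 one_add_one_eq_two w) := by
      rw [← neg_neg (d 1 2 one_add_one_eq_two w), ← map_neg]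
      exact (neg_eq_iff_eq_neg.1 (toShiftOne_d (-w) (zero_add 1) one_add_one_eq_two).symm)
    have h₂ : comp W (shiftMat 1 Q.q) (zero_add 1) = -toShiftOne 1 2 one_add_one_eq_two
        (comp w Q.q one_add_one_eq_two) :=
      (toShiftOne_comp (-w) Q.q one_add_one_eq_two (zero_add 1) one_add_one_eq_two).symm.trans
        (congrArg (toShiftOne 1 2 one_add_one_eq_two) (neg_comp w Q.q one_add_one_eq_two))
    have h₃ : comp R.q W (add_zero 1) = -toShiftOne 1 2 one_add_one_eq_two
        (comp R.q w one_add_one_eq_two) :=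
      (comp_toShiftOne R.q (-w) one_add_one_eq_two (zero_add 1) one_add_one_eq_two).symm.trans
        (congrArg (toShiftOne 1 2 one_add_one_eq_two) (comp_neg R.q w one_add_one_eq_two))
    rw [comp_units_smul, h₁, h₂, h₃, Int.negOnePow_one, Int.negOnePow_zero, Units.neg_smul,
      one_smul, one_smul, neg_neg, sub_neg_eq_add, ← add_assoc]
    exact congrArg (toShiftOne 1 2 one_add_one_eq_two) hw⟩

lemma entry_connecting (hQ : Restriction S P Q) (hR : Restriction Sᶜ P R)
    (i j n : ℤ) (hn : n + j = i + 0) : entry (hQ.connecting hR) i j n hn =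
      -sandwich (hR.inc i) (P.q i (j + 1) ⟨n, by omega⟩) (hQ.proj (j + 1)) :=
  congrArg (- ·) (Family.sandwich_diagHom_apply hR.inc P.q hQ.proj i (j + 1) n (by omega))

lemma q_comp_inc_sub (hQ : Restriction S P Q) (hR : Restriction Sᶜ P R) (i j n : ℤ)
    (hn : n + (j + 1) = i + 1) :
    comp (R.q i (j + 1) ⟨n, hn⟩) (hR.inc (j + 1)) (add_zero n) -
      comp (entry (hQ.connecting hR) i j n (by omega)) (hQ.inc (j + 1)) (add_zero n) =
      comp (hR.inc i) (P.q i (j + 1) ⟨n, hn⟩) (zero_add n) := by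
  rw [entry_connecting, neg_comp, sub_neg_eq_add, hR.q_eq, sandwich_comp_right,
    sandwich_comp_right, add_comm (sandwich _ _ _), sandwich, sandwich, ← comp_add, hQ.total hR,
    comp_id]

variable [HasFiniteSums J]

lemma coneIso_comm (hQ : Restriction S P Q) (hR : Restriction Sᶜ P R) (hS : IsUpperSet S)
    (i j n : ℤ) (hn : n + j = i + 1) :
    comp (comp (coneSum R.fam (shift 1 Q).fam i).fst (hR.inc (i + 1)) (add_zero 0) +
        comp (coneSum R.fam (shift 1 Q).fam i).snd (hQ.inc (i + 1)) (add_zero 0))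
      ((shift 1 P).q i j ⟨n, hn⟩) (zero_add n) =
    comp ((cone (hQ.connecting hR)).q i j ⟨n, hn⟩)
      (comp (coneSum R.fam (shift 1 Q).fam j).fst (hR.inc (j + 1)) (add_zero 0) +
        comp (coneSum R.fam (shift 1 Q).fam j).snd (hQ.inc (j + 1)) (add_zero 0))
      (add_zero n) := by
  have e₁ : (shift 1 P).q i j ⟨n, hn⟩ = -P.q (i + 1) (j + 1) ⟨n, by omega⟩ := by
    change (1 : ℤ).negOnePow • P.q (i + 1) (j + 1) ⟨n, by omega⟩ = _
    rw [Int.negOnePow_one, Units.neg_smul, one_smul]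
  have e₂ : (shift 1 Q).q i j ⟨n, hn⟩ = -Q.q (i + 1) (j + 1) ⟨n, by omega⟩ := by
    change (1 : ℤ).negOnePow • Q.q (i + 1) (j + 1) ⟨n, by omega⟩ = _
    rw [Int.negOnePow_one, Units.neg_smul, one_smul]
  have e₃ : (cone (hQ.connecting hR)).q i j ⟨n, hn⟩ = _ :=
    coneQ_apply R (shift 1 Q) (hQ.connecting hR).1 i j n hn
  have e₄ := hQ.q_comp_inc_sub hR (i + 1) j n (by omega)
  rw [e₁, e₃, e₂]
  exact binarySum_desc_comm _ _ e₄ (hQ.inc_comm hS _ _ n (by omega))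

/-- The cone of the connecting morphism `R ⟶ Q[1]` is `P[1]`. -/
def coneIso (hQ : Restriction S P Q) (hR : Restriction Sᶜ P R) (hS : IsUpperSet S) :
    (shiftTr J 1).obj (HZero.of P) ≅ HZero.of (cone (hQ.connecting hR)) :=
  (diagIso (P := cone (hQ.connecting hR)) (Q := shift 1 P)
    (fun i => comp (coneSum R.fam (shift 1 Q).fam i).fst (hR.inc (i + 1)) (add_zero 0) +
      comp (coneSum R.fam (shift 1 Q).fam i).snd (hQ.inc (i + 1)) (add_zero 0))
    (fun i => comp (hR.proj (i + 1)) (coneSum R.fam (shift 1 Q).fam i).inl (add_zero 0) +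
      comp (hQ.proj (i + 1)) (coneSum R.fam (shift 1 Q).fam i).inr (add_zero 0))
    (fun i => by
      simp only [add_comp, comp_add, comp_comp_comp_of_deg_zero, hR.inc_proj, hQ.inc_proj,
        hQ.inc_proj_eq_zero hR disjoint_compl_right, hR.inc_proj_eq_zero hQ disjoint_compl_left]
      simp only [sandwich, comp_id, comp_zero, zero_comp, add_zero, zero_add]
      exact (coneSum R.fam (shift 1 Q).fam i).total)
    (fun i => by
      simp only [add_comp, comp_add, comp_comp_comp_of_deg_zero, BinarySum.inl_fst,
        BinarySum.inr_snd, BinarySum.inl_snd, BinarySum.inr_fst]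
      simp only [sandwich, comp_id, comp_zero, zero_comp, add_zero, zero_add]
      exact (add_comm _ _).trans (hQ.total hR (i + 1)))
    (hQ.coneIso_comm hR hS)).symm

/-- For an upper set `S` of degrees, with `Q` and `R` the restrictions of `P` to `S` and to `Sᶜ`,
the triangle `R ⟶ Q[1] ⟶ P[1] ⟶ R[1]` is distinguished. -/
lemma isDistinguished (hQ : Restriction S P Q) (hR : Restriction Sᶜ P R) (hS : IsUpperSet S) :
    IsDistinguished (HZero.mk (hQ.connecting hR))
      ((shiftTr J 1).map (HZero.mk (hQ.incCocycle hS)))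
      ((shiftTr J 1).map (HZero.mk (hR.projCocycle hS.compl))) := by
  refine ⟨R, shift 1 Q, hQ.connecting hR, Iso.refl _, Iso.refl _, hQ.coneIso hR hS, ?_, ?_, ?_⟩
  · rw [Iso.refl_hom, Iso.refl_hom, Category.id_comp, Category.comp_id]
  · rw [Iso.refl_hom, Category.id_comp]
    refine (congrArg (HZero.mk · ≫ (hQ.coneIso hR hS).hom)
      (shiftDG_mapCocycles_diagCocycle 1 hQ.inc (hQ.inc_comm hS))).trans
      (congrArg HZero.mk (Subtype.ext ((Family.diagHom_comp_diagHom _ _).trans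
        (congrArg Family.diagHom (funext fun i => ?_)))))
    exact comp_binarySum_lift _ _ _ (hQ.inc_proj_eq_zero hR disjoint_compl_right _)
      (hQ.inc_proj _)
  · rw [Iso.refl_hom]
    refine (congrArg (_ ≫ ·) ((shiftTr J 1).map_id _)).trans ((Category.comp_id _).trans ?_)
    refine (congrArg HZero.mk
      (shiftDG_mapCocycles_diagCocycle 1 hR.proj (hR.proj_comm hS.compl))).trans
      (congrArg HZero.mk (Subtype.ext (Eq.symm ((Family.diagHom_comp_diagHom _ _).trans
        (congrArg Family.diagHom (funext fun i => ?_))))))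
    exact binarySum_lift_fst _ _ _

end Restriction

end Triangle

/-! ### Vanishing of acyclic homological functors -/

section Single

variable {J : Type u} [DGCategory.{v} J] [HasFiniteSums J]

lemma cocycles_single_ext {X Y : J} {f g : cocycles (single X) (single Y)}
    (h : entry f 0 0 0 rfl = entry g 0 0 0 rfl) : f = g :=
  Subtype.ext (hom_ext_single h)

variable [IsNegative J]

/-- For `J` negative, an object `X` identified with `P^0` is the restriction of `P` to degree
zero. -/
def Restriction.single (P : TwistedComplex J) (X : J) (a : Hom X (P.fam.X 0) 0)
    (b : Hom (P.fam.X 0) X 0) (hab : comp a b (add_zero 0) = id X)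
    (hba : comp b a (add_zero 0) = id (P.fam.X 0)) :
    Restriction {0} P (TwistedComplex.single X) where
  inc
    | .ofNat 0 => a
    | .ofNat (_ + 1) => 0
    | .negSucc _ => 0
  proj
    | .ofNat 0 => b
    | .ofNat (_ + 1) => 0
    | .negSucc _ => 0
  inc_proj
    | .ofNat 0 => hab
    | .ofNat (_ + 1) => (comp_zero _ _).trans (id_zeroObj J).symm
    | .negSucc _ => (comp_zero _ _).trans (id_zeroObj J).symm
  proj_inc i hi := by
    obtain rfl : i = 0 := hi
    exact hba
  id_eq_zero i hi := id_singleX_of_ne X i hi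
  q_eq i j n hn := by
    change 0 = _
    by_cases hi : i = 0
    · by_cases hj : j = 0
      · rw [q_eq_zero P i j n hn (by omega)]
        simp [sandwich]
      · exact (eq_zero_of_id_target (id_singleX_of_ne X j hj) _).symm
    · exact (eq_zero_of_id_source (id_singleX_of_ne X i hi) _).symm

end Single

section Exactness

variable {A : Type w₁} [Category.{w₂} A] [Abelian A]

lemma ExactAt.of_iso {X Y Z X' Y' Z' : A} {f : X ⟶ Y} {g : Y ⟶ Z} {f' : X' ⟶ Y'} {g' : Y' ⟶ Z'}
    (h : ExactAt f g) (α : X ≅ X') (β : Y ≅ Y') (γ : Z ≅ Z') (hf : f ≫ β.hom = α.hom ≫ f')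
    (hg : g ≫ γ.hom = β.hom ≫ g') : ExactAt f' g' := by
  obtain ⟨w, h⟩ := h
  have w' : f' ≫ g' = 0 := by
    rw [← cancel_epi α.hom, ← Category.assoc, ← hf, Category.assoc, ← hg, ← Category.assoc, w]
    simp
  exact ⟨w', ShortComplex.exact_of_iso (ShortComplex.isoMk α β γ hf.symm hg.symm) h⟩

lemma ExactAt.isZero {X Y Z : A} {f : X ⟶ Y} {g : Y ⟶ Z} (h : ExactAt f g) (hX : IsZero X)
    (hZ : IsZero Z) : IsZero Y :=
  h.choose_spec.isZero_of_both_zeros (hX.eq_of_src _ _) (hZ.eq_of_tgt _ _)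

lemma ExactAt.epi {X Y Z : A} {f : X ⟶ Y} {g : Y ⟶ Z} (h : ExactAt f g) (hZ : IsZero Z) : Epi f :=
  h.choose_spec.epi_f (hZ.eq_of_tgt _ _)

lemma ExactAt.mono {X Y Z : A} {f : X ⟶ Y} {g : Y ⟶ Z} (h : ExactAt f g) (hX : IsZero X) : Mono g :=
  h.choose_spec.mono_g (hX.eq_of_src _ _)

variable {J : Type u} [DGCategory.{v} J] [HasFiniteSums J] [IsNegative J]
  {H : Tr J ⥤ A} {S : Set ℤ} {P Q R : TwistedComplex J}

namespace IsHomological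

/-- `H(Q) ⟶ H(P) ⟶ H(R)` is exact. The distinguished triangle involves `P[1]`, hence the shift by
`-1`. -/
lemma exact_inc_proj (hH : IsHomological H) (hQ : Restriction S P Q) (hR : Restriction Sᶜ P R)
    (hS : IsUpperSet S) :
    ExactAt (H.map (HZero.mk (hQ.incCocycle hS))) (H.map (HZero.mk (hR.projCocycle hS.compl))) := by
  let φ := Functor.isoWhiskerRight (shiftCancel (J := J) 1 (-1) (add_neg_cancel 1)) H
  exact (hH.exact₃ _ _ _ (hQ.isDistinguished hR hS) (-1)).of_iso (φ.app _) (φ.app _) (φ.app _)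
    (φ.hom.naturality _) (φ.hom.naturality _)

lemma exact_proj_connecting (hH : IsHomological H) (hQ : Restriction S P Q)
    (hR : Restriction Sᶜ P R) (hS : IsUpperSet S) :
    ExactAt (H.map (HZero.mk (hR.projCocycle hS.compl))) (H.map (HZero.mk (hQ.connecting hR))) := by
  let φ := Functor.isoWhiskerRight (shiftCancel (J := J) 1 (-1) (add_neg_cancel 1)) H
  exact (hH.exact₁ _ _ _ (hQ.isDistinguished hR hS) (-1)).of_iso (φ.app _) (φ.app _) (φ.app _)
    (φ.hom.naturality _) (φ.hom.naturality _)

lemma exact_connecting_inc (hH : IsHomological H) (hQ : Restriction S P Q)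
    (hR : Restriction Sᶜ P R) (hS : IsUpperSet S) :
    ExactAt (H.map ((shiftTr J (-1)).map (HZero.mk (hQ.connecting hR)) ≫
      (shiftCancelObj 1 (-1) (add_neg_cancel 1) Q).hom))
      (H.map (HZero.mk (hQ.incCocycle hS))) := by
  let φ := Functor.isoWhiskerRight (shiftCancel (J := J) 1 (-1) (add_neg_cancel 1)) H
  exact (hH.exact₂ _ _ _ (hQ.isDistinguished hR hS) (-1)).of_iso (Iso.refl _) (φ.app _) (φ.app _)
    ((H.map_comp _ _).symm.trans (Category.id_comp _).symm) (φ.hom.naturality _)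

end IsHomological

/-- A twisted complex concentrated in degree `n` is `X[-n]` for an object `X` of `J`. -/
lemma IsAcyclic.isZero_of_concentrated (hA : IsAcyclic H) (n : ℤ) (hn : n ≠ 0)
    (hP : ∀ i, i ≠ n → id (P.fam.X i) = 0) : IsZero (H.obj (HZero.of P)) := by
  let r := Restriction.single (shift n P) (P.fam.X (0 + n)) (id _) (id _) (id_comp _) (id_comp _)
  have e : HZero.of (shift n P) ≅ HZero.of (single (P.fam.X (0 + n))) :=
    r.iso fun i hi => hP (i + n) fun h => hi (by rw [Set.mem_singleton_iff]; omega)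
  have e' : HZero.of P ≅ (shiftTr J (-n)).obj (HZero.of (single (P.fam.X (0 + n)))) :=
    (shiftCancelObj n (-n) (add_neg_cancel n) P).symm ≪≫ (shiftTr J (-n)).mapIso e
  exact (hA _ (-n) (neg_ne_zero.2 hn)).of_iso (H.mapIso e')

lemma IsHomological.isZero_of_id_eq_zero (hH : IsHomological H)
    (hP : ∀ i, id (P.fam.X i) = 0) : IsZero (H.obj (HZero.of P)) := by
  have := hH.additive
  rw [IsZero.iff_id_eq_zero, ← H.map_id, ← HZero.mk_id]
  have e : cocyclesId P = 0 := cocycles_ext fun i j n hn => by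
    rw [eq_zero_of_id_source (hP i) (entry _ i j n hn)]
    exact (eq_zero_of_id_source (hP i) _).symm
  rw [e, map_zero, Functor.map_zero]

/-- Vanishing on the twisted complexes concentrated in the `n` degrees from `a` on, if zero is not
among them: the degree `a + n - 1` is split off to induct on `n`. -/
lemma IsHomological.isZero_of_interval (hH : IsHomological H) (hA : IsAcyclic H) (a : ℤ) (n : ℕ)
    (ha : 0 < a ∨ a + n ≤ 0) :
    ∀ P : TwistedComplex J, (∀ i, i < a ∨ a + n ≤ i → id (P.fam.X i) = 0) →
      IsZero (H.obj (HZero.of P)) := by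
  induction n with
  | zero => exact fun P hP => hH.isZero_of_id_eq_zero fun i => hP i (by omega)
  | succ n ih =>
    intro P hP
    obtain ⟨Q, ⟨hQ⟩⟩ := exists_restriction (Set.Ici (a + n)) Set.ordConnected_Ici P
    obtain ⟨R, ⟨hR⟩⟩ := exists_restriction (Set.Ici (a + n : ℤ))ᶜ
      (by rw [Set.compl_Ici]; exact Set.ordConnected_Iio) P
    refine (hH.exact_inc_proj hQ hR (isUpperSet_Ici _)).isZero ?_ ?_
    · refine hA.isZero_of_concentrated (a + n) (by omega) fun i hi => ?_
      rcases lt_or_gt_of_ne hi with hi | hi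
      · exact hQ.id_eq_zero i (by simpa using hi)
      · exact hQ.id_eq_zero_of_id_eq_zero (hP i (by push_cast; omega))
    · refine ih (by omega) R fun i hi => ?_
      rcases hi with hi | hi
      · exact hR.id_eq_zero_of_id_eq_zero (hP i (Or.inl hi))
      · exact hR.id_eq_zero i (by simpa using hi)

/-- An acyclic homological functor vanishes on the twisted complexes concentrated in positive
degrees. -/
lemma IsHomological.isZero_of_pos (hH : IsHomological H) (hA : IsAcyclic H)
    (hP : ∀ i ≤ 0, id (P.fam.X i) = 0) : IsZero (H.obj (HZero.of P)) := by
  obtain ⟨b, hb⟩ := P.fam.finite.bddAbove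
  refine hH.isZero_of_interval hA 1 b.toNat (by omega) P fun i hi => ?_
  by_contra h
  have : i ≤ b := hb h
  have : ¬ i ≤ 0 := fun hi => h (hP i hi)
  omega

/-- An acyclic homological functor vanishes on the twisted complexes concentrated in negative
degrees. -/
lemma IsHomological.isZero_of_neg (hH : IsHomological H) (hA : IsAcyclic H)
    (hP : ∀ i, 0 ≤ i → id (P.fam.X i) = 0) : IsZero (H.obj (HZero.of P)) := by
  obtain ⟨b, hb⟩ := P.fam.finite.bddBelow
  refine hH.isZero_of_interval hA (-(-b).toNat) (-b).toNat (by omega) P fun i hi => ?_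
  by_contra h
  have : b ≤ i := hb h
  have : ¬ 0 ≤ i := fun hi => h (hP i hi)
  omega

end Exactness

/-! ### Right homology from exact sequences, and truncation of morphisms -/

section Abelian

variable {A : Type w₁} [Category.{w₂} A] [Abelian A]

lemma ExactAt.precomp_epi {W X Y Z : A} {f : X ⟶ Y} {g : Y ⟶ Z} (h : ExactAt f g) (e : W ⟶ X)
    [Epi e] : ExactAt (e ≫ f) g := by
  obtain ⟨w, h⟩ := h
  have w' : (e ≫ f) ≫ g = 0 := by rw [Category.assoc, w, Limits.comp_zero]
  let φ : ShortComplex.mk (e ≫ f) g w' ⟶ ShortComplex.mk f g w :=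
    { τ₁ := e, τ₂ := 𝟙 _, τ₃ := 𝟙 _ }
  have : Epi φ.τ₁ := inferInstanceAs (Epi e)
  have : IsIso φ.τ₂ := inferInstanceAs (IsIso (𝟙 Y))
  have : Mono φ.τ₃ := inferInstanceAs (Mono (𝟙 Z))
  exact ⟨w', (ShortComplex.exact_iff_of_epi_of_isIso_of_mono φ).2 h⟩

lemma ExactAt.comp_mono {X Y Z W : A} {f : X ⟶ Y} {g : Y ⟶ Z} (h : ExactAt f g) (m : Z ⟶ W)
    [Mono m] : ExactAt f (g ≫ m) := by
  obtain ⟨w, h⟩ := h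
  have w' : f ≫ g ≫ m = 0 := by rw [← Category.assoc, w, Limits.zero_comp]
  let φ : ShortComplex.mk f g w ⟶ ShortComplex.mk f (g ≫ m) w' :=
    { τ₁ := 𝟙 _, τ₂ := 𝟙 _, τ₃ := m }
  have : Epi φ.τ₁ := inferInstanceAs (Epi (𝟙 X))
  have : IsIso φ.τ₂ := inferInstanceAs (IsIso (𝟙 Y))
  have : Mono φ.τ₃ := inferInstanceAs (Mono m)
  exact ⟨w', (ShortComplex.exact_iff_of_epi_of_isIso_of_mono φ).1 h⟩

/-- The homology of `X₁ ⟶ X₂ ⟶ X₃` from exact sequences `X₁ ⟶ X₂ ⟶ Q ⟶ 0` and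
`0 ⟶ K ⟶ Q ⟶ X₃`. -/
def rightHomologyDataOfExact (S : ShortComplex A) {Q K : A} (p : S.X₂ ⟶ Q) (i : K ⟶ Q)
    (k : Q ⟶ S.X₃) (h₁ : ExactAt S.f p) (hp : Epi p) (h₂ : ExactAt i k) (hi : Mono i)
    (h : p ≫ k = S.g) : S.RightHomologyData where
  Q := Q
  H := K
  p := p
  ι := i
  wp := h₁.choose
  hp := h₁.choose_spec.gIsCokernel
  wι := by
    have e : h₁.choose_spec.gIsCokernel.desc (CokernelCofork.ofπ S.g S.zero) = k := by
      rw [← cancel_epi p, h]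
      exact h₁.choose_spec.gIsCokernel.fac _ WalkingParallelPair.one
    exact (congrArg (i ≫ ·) e).trans h₂.choose
  -- The morphism induced by `S.g` on the cokernel `Q` is `k`, of which `i` is a kernel.
  hι := by
    have e : h₁.choose_spec.gIsCokernel.desc (CokernelCofork.ofπ S.g S.zero) = k := by
      rw [← cancel_epi p, h]
      exact h₁.choose_spec.gIsCokernel.fac _ WalkingParallelPair.one
    have isLimit : ∀ (k' : Q ⟶ S.X₃) (w : i ≫ k' = 0), k' = k →
        Nonempty (IsLimit (KernelFork.ofι i w)) := by
      rintro _ _ rfl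
      exact ⟨h₂.choose_spec.fIsKernel⟩
    exact (isLimit _ _ e).some

/-- The identification of the homology by right homology data is natural with respect to the
morphisms which are compatible with these data. -/
lemma homologyIso_naturality {S T : ShortComplex A} (h : S.RightHomologyData)
    (h' : T.RightHomologyData) (φ : S ⟶ T) (φQ : h.Q ⟶ h'.Q) (φH : h.H ⟶ h'.H)
    (hQ : h.p ≫ φQ = φ.τ₂ ≫ h'.p) (hH : φH ≫ h'.ι = h.ι ≫ φQ) :
    φH ≫ h'.homologyIso.inv = h.homologyIso.inv ≫ ShortComplex.homologyMap φ := by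
  let γ : ShortComplex.RightHomologyMapData φ h h' :=
    { φQ := φQ
      φH := φH
      commp := hQ
      commg' := by
        rw [← cancel_epi h.p, ← Category.assoc, hQ, Category.assoc, h'.p_g', ← Category.assoc,
          h.p_g', φ.comm₂₃]
      commι := hH }
  have := γ.homologyMap_eq
  rw [this, Iso.inv_hom_id_assoc]

end Abelian

section Truncation

variable {J : Type u} [DGCategory.{v} J] [IsNegative J]

lemma entry_eq_zero {P Q : TwistedComplex J} (f : cocycles P Q) (i j n : ℤ) (hn : n + j = i + 0)
    (hij : j < i) : entry f i j n hn = 0 :=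
  IsNegative.eq_zero (n := n) (by omega) _

variable {S : Set ℤ} {P Q P' Q' : TwistedComplex J}

/-- The restriction of `f` commutes with the projections: an entry `f_{ij}` with `i ∉ S` and `j ∈ S`
would have positive degree. -/
lemma Restriction.proj_inc_comp (hQ : Restriction S P Q) (hQ' : Restriction S P' Q')
    (hS : IsLowerSet S) (f : cocycles P P') (i j n : ℤ) (hn : n + j = i + 0) :
    comp (hQ.proj i) (sandwich (hQ.inc i) (entry f i j n hn) (hQ'.proj j)) (zero_add n) =
      comp (entry f i j n hn) (hQ'.proj j) (add_zero n) := by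
  by_cases hi : i ∈ S
  · rw [comp_sandwich_right, hQ.proj_inc i hi, id_sandwich]
  · by_cases hj : j ∈ S
    · have hij : j < i := by
        by_contra hij
        exact hi (hS (by omega) hj)
      rw [entry_eq_zero f i j n hn hij]
      simp [sandwich]
    · rw [eq_zero_of_id_target (hQ'.id_eq_zero j hj) (comp (entry f i j n hn) _ _)]
      exact eq_zero_of_id_target (hQ'.id_eq_zero j hj) _

/-- The restriction to a lower set of degrees of a closed morphism of degree zero. -/
def Restriction.map (hQ : Restriction S P Q) (hQ' : Restriction S P' Q') (hS : IsLowerSet S)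
    (f : cocycles P P') : cocycles Q Q' :=
  ⟨sandwich (J := Family J) (Family.diagHom hQ.inc) f.1 (Family.diagHom hQ'.proj), by
    let p : Hom P.fam Q.fam 0 := Family.diagHom hQ.proj
    let s : Hom Q.fam P.fam 0 := Family.diagHom hQ.inc
    let p' : Hom P'.fam Q'.fam 0 := Family.diagHom hQ'.proj
    let f₀ : Hom P.fam P'.fam 0 := f.1
    have hs : d 0 1 (zero_add 1) s = 0 := Family.d_diagHom _
    have hp' : d 0 1 (zero_add 1) p' = 0 := Family.d_diagHom _
    have hf : d 0 1 (zero_add 1) f₀ + (comp f₀ P'.q (zero_add 1) -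
      (0 : ℤ).negOnePow • comp P.q f₀ (add_zero 1)) = 0 := f.2
    change d 0 1 (zero_add 1) (sandwich s f₀ p') + (comp (sandwich s f₀ p') Q'.q (zero_add 1) -
      (0 : ℤ).negOnePow • comp Q.q (sandwich s f₀ p') (add_zero 1)) = 0
    have h₁ : comp p (sandwich s f₀ p') (add_zero 0) = comp f₀ p' (add_zero 0) :=
      Family.hom_ext fun i j n hn => by
        rw [Family.diagHom_comp_apply, Family.sandwich_diagHom_apply, Family.comp_diagHom_apply]
        exact hQ.proj_inc_comp hQ' hS f i j n hn
    have h₂ : comp p' Q'.q (zero_add 1) = comp P'.q p' (add_zero 1) :=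
      Family.hom_ext fun i j n hn => by
        rw [Family.diagHom_comp_apply, Family.comp_diagHom_apply]
        exact hQ'.proj_comm hS i j n hn
    have h₃ : comp (sandwich s f₀ p') Q'.q (zero_add 1) =
        sandwich s (comp f₀ P'.q (zero_add 1)) p' := by
      unfold sandwich
      rw [assoc _ p' _ (add_zero 0) (zero_add 1) (zero_add 1) (zero_add 1), h₂,
        ← assoc _ _ p' (zero_add 1) (add_zero 1) (add_zero 1) (zero_add 1),
        assoc s f₀ _ (zero_add 0) (zero_add 1) (zero_add 1) (zero_add 1)]
    have h₄ : comp Q.q (sandwich s f₀ p') (add_zero 1) =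
        sandwich s (comp P.q f₀ (add_zero 1)) p' := by
      rw [← hQ.sandwich_q]
      change comp (sandwich s P.q p) _ _ = _
      rw [sandwich, assoc _ p _ (add_zero 1) (add_zero 0) (add_zero 1) (add_zero 1), h₁, sandwich,
        ← assoc _ f₀ p' (add_zero 1) (add_zero 0) (add_zero 1) (add_zero 1),
        assoc s _ f₀ (zero_add 1) (add_zero 1) (add_zero 1) (zero_add 1)]
    rw [Int.negOnePow_zero, one_smul] at hf ⊢
    rw [d_sandwich _ _ _ _ hs hp', h₃, h₄, sandwich_eq, sandwich_eq, sandwich_eq, ← map_sub,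
      ← map_add, hf, map_zero]⟩

lemma Restriction.entry_map (hQ : Restriction S P Q) (hQ' : Restriction S P' Q')
    (hS : IsLowerSet S) (f : cocycles P P') (i j n : ℤ) (hn : n + j = i + 0) :
    entry (hQ.map hQ' hS f) i j n hn = sandwich (hQ.inc i) (entry f i j n hn) (hQ'.proj j) :=
  Family.sandwich_diagHom_apply hQ.inc (show Hom P.fam P'.fam 0 from f.1) hQ'.proj i j n hn

lemma Restriction.proj_map (hQ : Restriction S P Q) (hQ' : Restriction S P' Q')
    (hS : IsLowerSet S) (f : cocycles P P') :
    cocyclesComp (hQ.projCocycle hS) (hQ.map hQ' hS f) =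
      cocyclesComp f (hQ'.projCocycle hS) := by
  refine cocycles_ext fun i j n hn => ?_
  refine (entry_diagCocycle_comp _ _ _ i j n hn).trans
    (Eq.trans ?_ (entry_comp_diagCocycle _ _ _ i j n hn).symm)
  rw [hQ.entry_map]
  exact hQ.proj_inc_comp hQ' hS f i j n hn

end Truncation

/-! ### The truncation in nonpositive degrees -/

section Stupid

variable {J : Type u} [DGCategory.{v} J] [IsNegative J] [HasFiniteSums J]

/-- The truncation of a twisted complex in the degrees `≥ k`, where the entries of `P` are kept. -/
def stupidGE (k : ℤ) (P : TwistedComplex J) : TwistedComplex J :=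
  (exists_restriction (Set.Ici k) Set.ordConnected_Ici P).choose

/-- The truncation of a twisted complex in the degrees `< k`, where the entries of `P` are kept. -/
def stupidLT (k : ℤ) (P : TwistedComplex J) : TwistedComplex J :=
  (exists_restriction (Set.Ici k)ᶜ (isUpperSet_Ici k).compl.ordConnected P).choose

/-- The restriction data of the truncation in the degrees `≥ k`. -/
def restrictionGE (k : ℤ) (P : TwistedComplex J) : Restriction (Set.Ici k) P (stupidGE k P) :=
  (exists_restriction (Set.Ici k) Set.ordConnected_Ici P).choose_spec.some

/-- The restriction data of the truncation in the degrees `< k`. -/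
def restrictionLT (k : ℤ) (P : TwistedComplex J) : Restriction (Set.Ici k)ᶜ P (stupidLT k P) :=
  (exists_restriction (Set.Ici k)ᶜ (isUpperSet_Ici k).compl.ordConnected P).choose_spec.some

variable (P : TwistedComplex J)

/-- `P^0` as a restriction of `P^{≤ 0}`. -/
def restrictionZero : Restriction (Set.Ici 0) (stupidLT 1 P) (single (P.fam.X 0)) :=
  ((Restriction.single P (P.fam.X 0) (id _) (id _) (id_comp _) (id_comp _)).factor
    (restrictionLT 1 P) (by simp)).mono (by simp) fun i hi hi' =>
      (restrictionLT 1 P).id_eq_zero i fun h => h (by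
        have h₁ : 0 ≤ i := hi
        have h₂ : ¬ i = 0 := hi'
        exact show 1 ≤ i by omega)

/-- `P^{< 0}` as a restriction of `P^{≤ 0}`. -/
def restrictionNeg : Restriction (Set.Ici 0)ᶜ (stupidLT 1 P) (stupidLT 0 P) :=
  (restrictionLT 0 P).factor (restrictionLT 1 P)
    (Set.compl_subset_compl.2 (Set.Ici_subset_Ici.2 zero_le_one))

variable {P} in
/-- For a restriction `Q` of `P` to a set of degrees which contains `1`, the object `P^1` is the
restriction of `Q[1]` to degree `0`. -/
def Restriction.singleShiftOne {S : Set ℤ} {Q : TwistedComplex J} (h : Restriction S P Q)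
    (hS : 1 ∈ S) : Restriction {0} (shift 1 Q) (TwistedComplex.single (P.fam.X 1)) :=
  Restriction.single (shift 1 Q) (P.fam.X 1) (h.proj 1) (h.inc 1) (h.proj_inc 1 hS) (h.inc_proj 1)

variable {P} in
/-- For a restriction `Q` of `P` to a set of degrees which contains `-1`, the object `P^{-1}` is the
restriction of `Q[-1]` to degree `0`. -/
def Restriction.singleShiftNegOne {S : Set ℤ} {Q : TwistedComplex J} (h : Restriction S P Q)
    (hS : -1 ∈ S) : Restriction {0} (shift (-1) Q) (TwistedComplex.single (P.fam.X (-1))) :=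
  Restriction.single (shift (-1) Q) (P.fam.X (-1)) (h.proj (-1)) (h.inc (-1) :)
    (h.proj_inc (-1) hS) (h.inc_proj (-1))

/-- `P^1` as a restriction of `P^{≥ 1}[1]`. -/
def restrictionOne :
    Restriction (Set.Ici 1)ᶜ (shift 1 (stupidGE 1 P)) (single (P.fam.X 1)) :=
  ((restrictionGE 1 P).singleShiftOne (Set.mem_Ici.2 le_rfl)).mono (by simp) fun i hi hi' =>
    (restrictionGE 1 P).id_eq_zero (i + 1) fun h => hi' (by
      have h₁ : ¬ 1 ≤ i := hi
      have h₂ : 1 ≤ i + 1 := h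
      exact show i = 0 by omega)

/-- `P^{-1}` as a restriction of `P^{< 0}[-1]`. -/
def restrictionNegOne :
    Restriction (Set.Ici 0) (shift (-1) (stupidLT 0 P)) (single (P.fam.X (-1))) :=
  ((restrictionLT 0 P).singleShiftNegOne (by simp)).mono (by simp) fun i hi hi' =>
    (restrictionLT 0 P).id_eq_zero (i + -1) fun h => h (by
      have h₁ : 0 ≤ i := hi
      have h₂ : ¬ i = 0 := hi'
      exact show 0 ≤ i + -1 by omega)

/-- The inclusion `P^0 ⟶ P^{≤ 0}`. -/
def incZero : cocycles (single (P.fam.X 0)) (stupidLT 1 P) :=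
  (restrictionZero P).incCocycle (isUpperSet_Ici 0)

/-- The projection `P ⟶ P^{≤ 0}`. -/
def projLT : cocycles P (stupidLT 1 P) :=
  (restrictionLT 1 P).projCocycle (isUpperSet_Ici 1).compl

/-- The morphism `P^{< 0}[-1] ⟶ P^0` with cone `P^{≤ 0}`. -/
def fromNeg : HZero.of (shift (-1) (stupidLT 0 P)) ⟶ HZero.of (single (P.fam.X 0)) :=
  (shiftTr J (-1)).map (HZero.mk ((restrictionZero P).connecting (restrictionNeg P))) ≫
      (shiftCancelObj 1 (-1) (add_neg_cancel 1) (single (P.fam.X 0))).hom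

lemma eq_neg_incl_map_mk₀ {X Y : J} (x : Hom X Y 0) (f : cocycles (single X) (single Y))
    (hf : entry f 0 0 0 rfl = -x) : HZero.mk f = -(incl J).map (HZero.mk₀ x) := by
  refine Eq.trans (congrArg HZero.mk (cocycles_single_ext (g := -(singleDG J).mapCocycles
    ⟨x, IsNegative.eq_zero one_pos _⟩) ?_)) (map_neg HZero.mk _)
  exact hf

/-- The composite `P^{-1} ⟶ P^{< 0}[-1] ⟶ P^0` is `-q_{-1,0}`. -/
lemma inc_fromNeg : HZero.mk ((restrictionNegOne P).incCocycle (isUpperSet_Ici 0)) ≫ fromNeg P =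
      -(incl J).map (qClass P (-1) 0 (neg_add_cancel 1)) := by
  refine eq_neg_incl_map_mk₀ (P.q (-1) 0 ⟨0, by omega⟩) (cocyclesComp
    ((restrictionNegOne P).incCocycle (isUpperSet_Ici 0)) (cocyclesComp
      ((shiftDG (-1)).mapCocycles ((restrictionZero P).connecting (restrictionNeg P)))
      (diagCocycle _ _))) ?_
  refine (entry_diagCocycle_comp _ ((restrictionNegOne P).inc_comm (isUpperSet_Ici 0))
    _ 0 0 0 rfl).trans ?_
  refine (congrArg (fun x => comp _ x _) (entry_comp_diagCocycle _ _ _ 0 0 0 rfl)).trans ?_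
  refine (congrArg (fun x => comp _ (comp x _ _) _)
    ((entry_shift (-1) ((restrictionZero P).connecting (restrictionNeg P)) 0 0 0 rfl).trans
    ((restrictionZero P).entry_connecting (restrictionNeg P) (0 + -1) (0 + -1) 0 rfl))).trans ?_
  have hB : (stupidLT 1 P).q (-1) 0 ⟨0, by omega⟩ = _ := (restrictionLT 1 P).q_eq (-1) 0 0 rfl
  refine (congrArg (fun x => comp _ (comp (-sandwich (restrictionNeg P |>.inc (-1)) x _) _ _) _)
    hB).trans ?_
  refine (congrArg (fun x => comp _ (comp (-x) _ _) _) (sandwich_sandwich _ _ _ _ _)).trans ?_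
  refine comp_neg_sandwich_comp ?_ ?_ _
  · have h₁ := (restrictionLT 0 P).proj_inc (-1) (by simp)
    have h₂ := (restrictionLT 1 P).proj_inc (-1) (by simp)
    refine Eq.trans (congrArg (fun x => comp _ x (add_zero 0))
      ((assoc _ _ _ (add_zero 0) (add_zero 0) (add_zero 0) (add_zero 0)).trans ?_)) h₁
    exact (congrArg (fun x => comp _ x _) h₂).trans (comp_id _)
  · have h₁ := (restrictionLT 1 P).proj_inc 0 (by simp)
    refine (comp_id _).trans (Eq.trans (congrArg (fun x => comp _ x (add_zero 0)) ?_) h₁)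
    exact comp_id _

/-- The composite `P^0 ⟶ P^{≤ 0} ⟶ P^{≥ 1}[1] ⟶ P^1` is `-q_{01}`. -/
lemma incZero_connecting_proj :
    HZero.mk (incZero P) ≫ HZero.mk ((restrictionGE 1 P).connecting (restrictionLT 1 P)) ≫
      HZero.mk ((restrictionOne P).projCocycle (isUpperSet_Ici 1).compl) =
    -(incl J).map (qClass P 0 1 (zero_add 1)) := by
  refine eq_neg_incl_map_mk₀ (P.q 0 1 ⟨0, by omega⟩) (cocyclesComp (incZero P) (cocyclesComp
      ((restrictionGE 1 P).connecting (restrictionLT 1 P))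
      ((restrictionOne P).projCocycle (isUpperSet_Ici 1).compl))) ?_
  refine (entry_diagCocycle_comp _ ((restrictionZero P).inc_comm (isUpperSet_Ici 0))
    _ 0 0 0 rfl).trans ?_
  refine (congrArg (fun x => comp _ x _) (entry_comp_diagCocycle _ _
    ((restrictionOne P).proj_comm (isUpperSet_Ici 1).compl) 0 0 0 rfl)).trans ?_
  rw [Restriction.entry_connecting]
  refine comp_neg_sandwich_comp (s := (restrictionLT 1 P).inc 0) ?_ ?_ _
  · exact (congrArg (fun x => comp x _ _) (id_comp _)).trans
      ((restrictionLT 1 P).proj_inc 0 (by simp))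
  · exact (restrictionGE 1 P).proj_inc 1 (Set.mem_Ici.2 le_rfl)

/-- The morphism `P^{≤ 0} ⟶ Q^{≤ 0}` induced by a closed morphism `P ⟶ Q` of degree zero. -/
def mapLT {P Q : TwistedComplex J} (f : cocycles P Q) : cocycles (stupidLT 1 P) (stupidLT 1 Q) :=
  (restrictionLT 1 P).map (restrictionLT 1 Q) (isUpperSet_Ici 1).compl f

lemma projLT_mapLT {P Q : TwistedComplex J} (f : cocycles P Q) :
    cocyclesComp (projLT P) (mapLT f) = cocyclesComp f (projLT Q) :=
  (restrictionLT 1 P).proj_map (restrictionLT 1 Q) (isUpperSet_Ici 1).compl f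

lemma incZero_mapLT {P Q : TwistedComplex J} (f : cocycles P Q) :
    HZero.mk (incZero P) ≫ HZero.mk (mapLT f) =
      (incl J).map (diagClass f 0) ≫ HZero.mk (incZero Q) := by
  refine congrArg HZero.mk (a₁ := cocyclesComp (incZero P) (mapLT f))
    (a₂ := cocyclesComp ((singleDG J).mapCocycles
      ⟨entry f 0 0 0 rfl, IsNegative.eq_zero one_pos _⟩) (incZero Q))
    (cocycles_ext fun i j n hn => ?_)
  refine (entry_diagCocycle_comp _ ((restrictionZero P).inc_comm (isUpperSet_Ici 0))
    _ i j n hn).trans (Eq.trans ?_ (entry_comp_diagCocycle _ _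
      ((restrictionZero Q).inc_comm (isUpperSet_Ici 0)) i j n hn).symm)
  by_cases hi : i = 0
  · subst hi
    by_cases hj : j = 0
    · subst hj
      obtain rfl : n = 0 := by omega
      change comp _ _ _ = comp (entry f 0 0 0 rfl) _ _
      have e : (restrictionZero P).inc 0 = (restrictionLT 1 P).proj 0 := id_comp _
      have e' : (restrictionZero Q).inc 0 = (restrictionLT 1 Q).proj 0 := id_comp _
      rw [e, e']
      refine Eq.trans (congrArg (fun x => comp _ x _) ((restrictionLT 1 P).entry_map
        (restrictionLT 1 Q) (isUpperSet_Ici 1).compl f 0 0 0 rfl)) ?_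
      exact (restrictionLT 1 P).proj_inc_comp (restrictionLT 1 Q) (isUpperSet_Ici 1).compl f
        0 0 0 rfl
    · by_cases hj' : j < 0
      · exact ((congrArg (fun x => comp _ x _) (entry_eq_zero _ 0 j n hn hj')).trans
          (comp_zero _ _)).trans ((congrArg (fun x => comp x _ _)
            (entry_eq_zero _ 0 j n hn hj')).trans (zero_comp _ _)).symm
      · have h₀ : id ((stupidLT 1 Q).fam.X j) = 0 :=
          (restrictionLT 1 Q).id_eq_zero j fun h => h (show 1 ≤ j by omega)
        exact (eq_zero_of_id_target h₀ _).trans (eq_zero_of_id_target h₀ _).symm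
  · exact (eq_zero_of_id_source (id_singleX_of_ne _ i hi) _).trans
      (eq_zero_of_id_source (id_singleX_of_ne _ i hi) _).symm

end Stupid

/-! ### The values of an acyclic homological functor as homology objects -/

section HomologyIso

variable {J : Type u} [DGCategory.{v} J] [IsNegative J] [HasFiniteSums J]
variable {A : Type w₁} [Category.{w₂} A] [Abelian A] {H : Tr J ⥤ A}

/-- `H(P^{-1}) ⟶ H(P^0) ⟶ H(P^{≤ 0}) ⟶ 0` is exact. -/
lemma IsHomological.exactAt_qClass_incZero (hH : IsHomological H) (hA : IsAcyclic H)
    (P : TwistedComplex J) :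
    ExactAt (H.map ((incl J).map (qClass P (-1) 0 (neg_add_cancel 1))))
      (H.map (HZero.mk (incZero P))) := by
  have := hH.additive
  have h₁ : ExactAt (H.map (fromNeg P)) (H.map (HZero.mk (incZero P))) :=
    hH.exact_connecting_inc (restrictionZero P) (restrictionNeg P) (isUpperSet_Ici 0)
  have h₂ : Epi (H.map (HZero.mk ((restrictionNegOne P).incCocycle (isUpperSet_Ici 0)))) :=
    (hH.exact_inc_proj (restrictionNegOne P) (restrictionLT 0 _) (isUpperSet_Ici 0)).epi
      (hH.isZero_of_neg hA fun i hi => (restrictionLT 0 _).id_eq_zero i fun h => h hi)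
  have h₃ := h₁.precomp_epi
    (-H.map (HZero.mk ((restrictionNegOne P).incCocycle (isUpperSet_Ici 0))))
  have e := (H.map_comp (HZero.mk ((restrictionNegOne P).incCocycle (isUpperSet_Ici 0)))
    (fromNeg P)).symm.trans ((congrArg H.map (inc_fromNeg P)).trans H.map_neg)
  have e' := (Preadditive.neg_comp _ _).trans ((congrArg (- ·) e).trans (neg_neg _))
  exact e' ▸ h₃

lemma IsHomological.epi_incZero (hH : IsHomological H) (hA : IsAcyclic H) (P : TwistedComplex J) :
    Epi (H.map (HZero.mk (incZero P))) :=
  (hH.exact_inc_proj (restrictionZero P) (restrictionNeg P) (isUpperSet_Ici 0)).epi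
    (hH.isZero_of_neg hA fun i hi => (restrictionNeg P).id_eq_zero i fun h => h hi)

lemma IsHomological.mono_projLT (hH : IsHomological H) (hA : IsAcyclic H) (P : TwistedComplex J) :
    Mono (H.map (HZero.mk (projLT P))) :=
  (hH.exact_inc_proj (restrictionGE 1 P) (restrictionLT 1 P) (isUpperSet_Ici 1)).mono
    (hH.isZero_of_pos hA fun i hi => (restrictionGE 1 P).id_eq_zero i fun h => by
      have : 1 ≤ i := h
      omega)

/-- The morphism `P^{≤ 0} ⟶ P^1` given by the structure morphisms of `P`. The sign undoes the one
of the connecting morphism. -/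
def toOne (P : TwistedComplex J) : HZero.of (stupidLT 1 P) ⟶ HZero.of (single (P.fam.X 1)) :=
  -(HZero.mk ((restrictionGE 1 P).connecting (restrictionLT 1 P)) ≫
    HZero.mk ((restrictionOne P).projCocycle (isUpperSet_Ici 1).compl))

lemma incZero_toOne (P : TwistedComplex J) :
    HZero.mk (incZero P) ≫ toOne P = (incl J).map (qClass P 0 1 (zero_add 1)) :=
  (Preadditive.comp_neg _ _).trans ((congrArg (- ·) (incZero_connecting_proj P)).trans
    (neg_neg _))

/-- `0 ⟶ H(P) ⟶ H(P^{≤ 0}) ⟶ H(P^1)` is exact. -/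
lemma IsHomological.exactAt_projLT_toOne (hH : IsHomological H) (hA : IsAcyclic H)
    (P : TwistedComplex J) :
    ExactAt (H.map (HZero.mk (projLT P))) (H.map (toOne P)) := by
  have := hH.additive
  have h₁ := hH.exact_proj_connecting (restrictionGE 1 P) (restrictionLT 1 P) (isUpperSet_Ici 1)
  have h₂ : Mono (H.map (HZero.mk ((restrictionOne P).projCocycle (isUpperSet_Ici 1).compl))) :=
    (hH.exact_inc_proj (restrictionGE 1 _) (restrictionOne P) (isUpperSet_Ici 1)).mono
      (hH.isZero_of_pos hA fun i hi => (restrictionGE 1 _).id_eq_zero i fun h => by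
        have : 1 ≤ i := h
        omega)
  have h₃ := h₁.comp_mono
    (-H.map (HZero.mk ((restrictionOne P).projCocycle (isUpperSet_Ici 1).compl)))
  rwa [Preadditive.comp_neg, ← H.map_comp, ← Functor.map_neg] at h₃

/-- For an acyclic homological functor `H`, the object `H(P)` as the homology of
`H(P^{-1}) ⟶ H(P^0) ⟶ H(P^1)`; the cokernel of the first morphism is `H(P^{≤ 0})`. -/
def rightHomologyData (H : AcyclicHomologicalFunctor J A) (P : TwistedComplex J) :
    ((heartComplex P).map ((restriction J A).obj H).obj).RightHomologyData :=
  rightHomologyDataOfExact ((heartComplex P).map ((restriction J A).obj H).obj)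
    (H.obj.map (HZero.mk (incZero P))) (H.obj.map (HZero.mk (projLT P))) (H.obj.map (toOne P))
    (H.property.1.exactAt_qClass_incZero H.property.2 P)
    (H.property.1.epi_incZero H.property.2 P)
    (H.property.1.exactAt_projLT_toOne H.property.2 P)
    (H.property.1.mono_projLT H.property.2 P)
    ((H.obj.map_comp _ _).symm.trans (congrArg H.obj.map (incZero_toOne P)))

/-- The isomorphism `H(P) ≅ ker(H(P^0) ⟶ H(P^1)) / im(H(P^{-1}) ⟶ H(P^0))`, natural in `P`. -/
def homologyIso (H : AcyclicHomologicalFunctor J A) :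
    H.obj ≅ heartHomology ((restriction J A).obj H).obj :=
  NatIso.ofComponents (fun P => (rightHomologyData H P.obj).homologyIso.symm) (by
    intro P Q f
    obtain ⟨f, rfl⟩ := HZero.mk_surjective f
    refine homologyIso_naturality (rightHomologyData H P.obj) (rightHomologyData H Q.obj)
      (mapHeartMap _ f) (H.obj.map (HZero.mk (mapLT f))) (H.obj.map (HZero.mk f)) ?_ ?_
    · refine (H.obj.map_comp _ _).symm.trans (Eq.trans ?_ (H.obj.map_comp _ _))
      exact congrArg H.obj.map (incZero_mapLT f)
    · refine (H.obj.map_comp _ _).symm.trans (Eq.trans ?_ (H.obj.map_comp _ _))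
      exact congrArg (fun x => H.obj.map (HZero.mk x)) (projLT_mapLT f).symm)

variable (J A) in
/-- The isomorphism `homologyIso`, natural in `H`. -/
def homologyNatIso :
    (acyclicHomological J A).ι ≅ restriction J A ⋙ heartHomologyFunctor J A :=
  NatIso.ofComponents (fun H => homologyIso H) (by
    intro H K η
    ext P
    exact homologyIso_naturality (rightHomologyData H P.obj) (rightHomologyData K P.obj)
      ((heartComplex P.obj).mapNatTrans ((restriction J A).map η).hom) (η.hom.app _) (η.hom.app _)
      (η.hom.naturality _) (η.hom.naturality _).symm)

lemma homologyNatIso_single (H : AcyclicHomologicalFunctor J A) (X : J) :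
    ((homologyNatIso J A).hom.app H).app ((incl J).obj (HZero.of X)) ≫
      ((heartComplex (single X)).map ((restriction J A).obj H).obj).homologyι =
        singleToOpcycles ((restriction J A).obj H).obj X := by
  refine ((rightHomologyData H (single X)).homologyIso_inv_comp_homologyι).trans
    (Eq.trans ?_ (rightHomologyData H (single X)).p_comp_opcyclesIso_inv)
  refine congrArg (fun x : cocycles (single X) (stupidLT 1 (single X)) =>
    H.obj.map (HZero.mk x) ≫ (rightHomologyData H (single X)).opcyclesIso.inv)
      (Subtype.ext (congrArg (Family.diagHom (P := singleFamily X)) (funext fun i => ?_)))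
  by_cases hi : i = 0
  · subst hi
    exact (id_comp _).symm
  · exact (eq_zero_of_id_source (id_singleX_of_ne X i hi) _).trans
      (eq_zero_of_id_source (id_singleX_of_ne X i hi) _).symm

end HomologyIso

/-! ### The homology sequence of a mapping cone -/

section ConeChase

variable {A : Type w₁} [Category.{w₂} A] [Abelian A]

/-- Exactness on homology, checked on cycles (generalized elements of the middle terms). -/
lemma exactAt_homologyMap {S T U : ShortComplex A} (φ : S ⟶ T) (ψ : T ⟶ U)
    (h₀ : ShortComplex.homologyMap (φ ≫ ψ) = 0)
    (h : ∀ {W : A} (z : W ⟶ T.X₂) (y : W ⟶ U.X₁), z ≫ T.g = 0 → z ≫ ψ.τ₂ = y ≫ U.f →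
      ∃ (x : W ⟶ S.X₂) (t : W ⟶ T.X₁), x ≫ S.g = 0 ∧ z = x ≫ φ.τ₂ + t ≫ T.f) :
    ExactAt (ShortComplex.homologyMap φ) (ShortComplex.homologyMap ψ) := by
  refine ⟨by rw [← ShortComplex.homologyMap_comp, h₀], ?_⟩
  rw [ShortComplex.exact_iff_exact_up_to_refinements]
  intro W γ hγ
  obtain ⟨W', π, hπ, z, hz, e⟩ := T.eq_liftCycles_homologyπ_up_to_refinements γ
  have e' : U.liftCycles (z ≫ ψ.τ₂) (by rw [Category.assoc, ψ.comm₂₃, ← Category.assoc, hz,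
      Limits.zero_comp]) ≫ U.homologyπ = 0 := by
    have : (π ≫ γ) ≫ ShortComplex.homologyMap ψ = 0 := by
      rw [Category.assoc, hγ, Limits.comp_zero]
    rw [e, Category.assoc, ShortComplex.homologyπ_naturality, ← Category.assoc] at this
    rw [← this]
    congr 1
    rw [← cancel_mono U.iCycles]
    simp
  obtain ⟨W'', ρ, hρ, y, hy⟩ :=
    (U.liftCycles_comp_homologyπ_eq_zero_iff_up_to_refinements _ _).1 e'
  obtain ⟨x, t, hx, ht⟩ := h (ρ ≫ z) y (by rw [Category.assoc, hz, Limits.comp_zero])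
    (by rw [Category.assoc, hy])
  refine ⟨W'', ρ ≫ π, inferInstance, S.liftCycles x hx ≫ S.homologyπ, ?_⟩
  have e₁ : ρ ≫ T.liftCycles z hz =
      S.liftCycles x hx ≫ ShortComplex.cyclesMap φ + t ≫ T.toCycles := by
    rw [← cancel_mono T.iCycles]
    simpa using ht
  dsimp only
  rw [Category.assoc, e, ← Category.assoc, e₁, Preadditive.add_comp, Category.assoc,
    Category.assoc, Category.assoc, T.toCycles_comp_homologyπ, Limits.comp_zero, add_zero,
    ShortComplex.homologyπ_naturality]

variable {P₁ P₂ P₃ Q₁ Q₂ Q₃ : A} {a₁ : P₁ ⟶ P₂} {a₂ : P₂ ⟶ P₃} {b₁ : Q₁ ⟶ Q₂} {b₂ : Q₂ ⟶ Q₃}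
  {B₁ : BinaryBicone P₁ Q₁} {B₂ : BinaryBicone P₂ Q₂} {B₃ : BinaryBicone P₃ Q₃}
  {c₁ : B₁.pt ⟶ B₂.pt} {c₂ : B₂.pt ⟶ B₃.pt} {θ₁ : P₁ ⟶ Q₂} {θ₂ : P₂ ⟶ Q₃}

/-- Exactness of the homology sequence of a cone at the cone. -/
lemma exactAt_homologyMap_inr_fst (ha : a₁ ≫ a₂ = 0) (hb : b₁ ≫ b₂ = 0) (hc : c₁ ≫ c₂ = 0)
    (ht : B₂.fst ≫ B₂.inl + B₂.snd ≫ B₂.inr = 𝟙 B₂.pt)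
    (h₁ : c₁ = B₁.fst ≫ a₁ ≫ B₂.inl + B₁.fst ≫ θ₁ ≫ B₂.inr + B₁.snd ≫ b₁ ≫ B₂.inr)
    (h₂ : c₂ = B₂.fst ≫ a₂ ≫ B₃.inl + B₂.fst ≫ θ₂ ≫ B₃.inr + B₂.snd ≫ b₂ ≫ B₃.inr)
    (φ : ShortComplex.mk b₁ b₂ hb ⟶ ShortComplex.mk c₁ c₂ hc)
    (ψ : ShortComplex.mk c₁ c₂ hc ⟶ ShortComplex.mk a₁ a₂ ha)
    (hφ : φ.τ₂ = B₂.inr) (hψ : ψ.τ₂ = B₂.fst) :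
    ExactAt (ShortComplex.homologyMap φ) (ShortComplex.homologyMap ψ) := by
  refine exactAt_homologyMap φ ψ ?_ fun {W} z y hz hy => ?_
  · refine homologyMap_eq_zero _ 0 0 ?_
    rw [ShortComplex.comp_τ₂, hφ, hψ]
    simp
  · dsimp only at z y hz hy
    have e : z - (y ≫ B₁.inl) ≫ c₁ = (z ≫ B₂.snd - y ≫ θ₁) ≫ B₂.inr := by
      rw [hψ] at hy
      have hz' : z = (z ≫ B₂.fst) ≫ B₂.inl + z ≫ B₂.snd ≫ B₂.inr := by
        rw [Category.assoc, ← Preadditive.comp_add, ht, Category.comp_id]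
      rw [h₁]
      nth_rw 1 [hz']
      rw [hy]
      simp [Preadditive.sub_comp]
    refine ⟨z ≫ B₂.snd - y ≫ θ₁, y ≫ B₁.inl, ?_, ?_⟩
    · have e₂ : B₂.inr ≫ c₂ = b₂ ≫ B₃.inr := by
        rw [h₂]
        simp
      have : (((z ≫ B₂.snd - y ≫ θ₁) ≫ b₂) ≫ B₃.inr) ≫ B₃.snd = 0 := by
        rw [Category.assoc _ b₂, ← e₂, ← Category.assoc, ← e, Preadditive.sub_comp, hz,
          Category.assoc _ c₁, hc]
        simp
      simpa using this
    · dsimp only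
      rw [hφ, ← e]
      abel

/-- Exactness of the homology sequence of a cone at the (shifted) source of the morphism. -/
lemma exactAt_homologyMap_fst (ha : a₁ ≫ a₂ = 0) {Q₄ : A} {b₃ : Q₃ ⟶ Q₄} {b₁' : Q₂ ⟶ Q₃}
    (hb' : b₁' ≫ b₃ = 0) (hc : c₁ ≫ c₂ = 0)
    (h₂ : c₂ = B₂.fst ≫ a₂ ≫ B₃.inl + B₂.fst ≫ θ₂ ≫ B₃.inr + B₂.snd ≫ b₂ ≫ B₃.inr)
    (φ : ShortComplex.mk c₁ c₂ hc ⟶ ShortComplex.mk a₁ a₂ ha)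
    (ψ : ShortComplex.mk a₁ a₂ ha ⟶ ShortComplex.mk b₁' b₃ hb') (hbb : b₁' = -b₂)
    (hφ : φ.τ₂ = B₂.fst) (hψ : ψ.τ₂ = θ₂) :
    ExactAt (ShortComplex.homologyMap φ) (ShortComplex.homologyMap ψ) := by
  refine exactAt_homologyMap φ ψ ?_ fun {W} z y hz hy => ?_
  · refine homologyMap_eq_zero _ B₂.snd B₃.snd ?_
    rw [ShortComplex.comp_τ₂, hφ, hψ]
    have e : B₂.fst ≫ θ₂ = B₂.snd ≫ b₁' + c₂ ≫ B₃.snd := by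
      rw [h₂, hbb]
      simp
    exact e
  · dsimp only at z y hz hy
    refine ⟨z ≫ B₂.inl + y ≫ B₂.inr, 0, ?_, ?_⟩
    · rw [hψ, hbb] at hy
      have : z ≫ θ₂ ≫ B₃.inr = -(y ≫ b₂ ≫ B₃.inr) := by
        rw [← Category.assoc, hy]
        simp
      have hz' : z ≫ a₂ ≫ B₃.inl = 0 := by rw [← Category.assoc, hz, Limits.zero_comp]
      have e : (z ≫ B₂.inl + y ≫ B₂.inr) ≫ c₂ = 0 := by
        rw [h₂]
        simp [this, hz']
      exact e
    · dsimp only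
      rw [hφ]
      simp

/-- Exactness of the homology sequence of a cone at the target of the morphism. -/
lemma exactAt_homologyMap_inr {P₀ : A} {a₀ : P₀ ⟶ P₁} {a₁' : P₁ ⟶ P₂} (ha : a₀ ≫ a₁' = 0)
    (hb : b₁ ≫ b₂ = 0) {C₃ : A} {c₂ : B₂.pt ⟶ C₃} (hc : c₁ ≫ c₂ = 0)
    (h₁ : c₁ = B₁.fst ≫ a₁ ≫ B₂.inl + B₁.fst ≫ θ₁ ≫ B₂.inr + B₁.snd ≫ b₁ ≫ B₂.inr)
    (φ : ShortComplex.mk a₀ a₁' ha ⟶ ShortComplex.mk b₁ b₂ hb)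
    (ψ : ShortComplex.mk b₁ b₂ hb ⟶ ShortComplex.mk c₁ c₂ hc) (haa : a₁ = -a₁')
    (hφ : φ.τ₂ = θ₁) (hψ : ψ.τ₂ = B₂.inr) :
    ExactAt (ShortComplex.homologyMap φ) (ShortComplex.homologyMap ψ) := by
  refine exactAt_homologyMap φ ψ ?_ fun {W} z y hz hy => ?_
  · refine homologyMap_eq_zero _ B₁.inl B₂.inl ?_
    rw [ShortComplex.comp_τ₂, hφ, hψ]
    have e : θ₁ ≫ B₂.inr = B₁.inl ≫ c₁ + a₁' ≫ B₂.inl := by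
      rw [h₁, haa]
      simp
    exact e
  · dsimp only at z y hz hy
    rw [hψ, h₁, haa] at hy
    refine ⟨y ≫ B₁.fst, y ≫ B₁.snd, ?_, ?_⟩
    · have := congrArg (· ≫ B₂.fst) hy
      simpa using this.symm
    · have := congrArg (· ≫ B₂.snd) hy
      rw [hφ]
      simpa using this

end ConeChase

/-! ### Homology of the cone of a morphism of twisted complexes -/

section HeartHomological

lemma map_sum_of_three {C : Type*} [Category* C] [Preadditive C] {D : Type*} [Category* D]
    [Preadditive D] (F : C ⥤ D) [F.Additive] {X Y X₁ Y₁ X₂ Y₂ X₃ Y₃ : C} (a₁ : X ⟶ X₁)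
    (b₁ : X₁ ⟶ Y₁) (c₁ : Y₁ ⟶ Y) (a₂ : X ⟶ X₂) (b₂ : X₂ ⟶ Y₂) (c₂ : Y₂ ⟶ Y) (a₃ : X ⟶ X₃)
    (b₃ : X₃ ⟶ Y₃) (c₃ : Y₃ ⟶ Y) :
    F.map (a₁ ≫ b₁ ≫ c₁ + a₂ ≫ b₂ ≫ c₂ + a₃ ≫ b₃ ≫ c₃) =
      F.map a₁ ≫ F.map b₁ ≫ F.map c₁ + F.map a₂ ≫ F.map b₂ ≫ F.map c₂ +
        F.map a₃ ≫ F.map b₃ ≫ F.map c₃ := by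
  simp

variable {J : Type u} [DGCategory.{v} J] [IsNegative J]

/-- The complex `P^i ⟶ P^j ⟶ P^k` in `H⁰(J)`, where `j = i + 1` and `k = j + 1`. -/
abbrev complexAt (P : TwistedComplex J) (i j k : ℤ) (h : i + 1 = j) (h' : j + 1 = k) :
    ShortComplex (HZero J) :=
  ShortComplex.mk (qClass P i j h) (qClass P j k h') (qClass_comp P _ _ _ _ _)

/-- The morphism of the complexes `P^i ⟶ P^j ⟶ P^k` induced by a closed morphism of degree zero. -/
abbrev mapAt {P Q : TwistedComplex J} (f : cocycles P Q) (i j k : ℤ) (h : i + 1 = j)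
    (h' : j + 1 = k) : complexAt P i j k h h' ⟶ complexAt Q i j k h h' where
  τ₁ := diagClass f i
  τ₂ := diagClass f j
  τ₃ := diagClass f k
  comm₁₂ := diagClass_comm f _ _ h
  comm₂₃ := diagClass_comm f _ _ h'

lemma qClass_shift (s : ℤ) (P : TwistedComplex J) (i j : ℤ) (h : i + 1 = j) :
    qClass (shift s P) i j h = s.negOnePow • qClass P (i + s) (j + s) (by omega) := by
  change HZero.mk₀ (s.negOnePow • P.q (i + s) (j + s) ⟨0, by omega⟩) = _
  obtain e | e := Int.units_eq_one_or s.negOnePow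
  · rw [e, one_smul, one_smul]
    rfl
  · rw [e, Units.neg_smul, one_smul, Units.neg_smul, one_smul, map_neg]
    rfl

lemma qClass_shift_one (P : TwistedComplex J) (i j : ℤ) (h : i + 1 = j) :
    qClass (shift 1 P) i j h = -qClass P (i + 1) (j + 1) (by omega) := by
  rw [qClass_shift, Int.negOnePow_one, Units.neg_smul, one_smul]

lemma diagClass_shift (s : ℤ) {P Q : TwistedComplex J} (f : cocycles P Q) (i : ℤ) :
    diagClass ((shiftDG s).mapCocycles f) i = diagClass f (i + s) :=
  congrArg HZero.mk₀ (entry_shift s f i i 0 (by omega))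

lemma mk₀_sandwich {X X' Y Y' : J} (a : Hom X X' 0) (x : Hom X' Y 0) (b : Hom Y Y' 0) :
    HZero.mk₀ (sandwich a x b) = HZero.mk₀ a ≫ HZero.mk₀ x ≫ HZero.mk₀ b :=
  Category.assoc (HZero.mk₀ a) (HZero.mk₀ x) (HZero.mk₀ b)

variable [HasFiniteSums J]

/-- The direct sum `(Cone f)^i = P^{i + 1} ⊕ Q^i` in `H⁰(J)`. -/
def coneBicone {P Q : TwistedComplex J} (f : cocycles P Q) (i : ℤ) :
    BinaryBicone (HZero.of (P.fam.X (i + 1))) (HZero.of (Q.fam.X i)) where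
  pt := HZero.of ((cone f).fam.X i)
  fst := HZero.mk₀ (coneSum P.fam Q.fam i).fst
  snd := HZero.mk₀ (coneSum P.fam Q.fam i).snd
  inl := HZero.mk₀ (coneSum P.fam Q.fam i).inl
  inr := HZero.mk₀ (coneSum P.fam Q.fam i).inr
  inl_fst := congrArg HZero.mk₀ (coneSum P.fam Q.fam i).inl_fst
  inl_snd := (congrArg HZero.mk₀ (coneSum P.fam Q.fam i).inl_snd).trans (map_zero _)
  inr_fst := (congrArg HZero.mk₀ (coneSum P.fam Q.fam i).inr_fst).trans (map_zero _)
  inr_snd := congrArg HZero.mk₀ (coneSum P.fam Q.fam i).inr_snd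

lemma coneBicone_total {P Q : TwistedComplex J} (f : cocycles P Q) (i : ℤ) :
    (coneBicone f i).fst ≫ (coneBicone f i).inl + (coneBicone f i).snd ≫ (coneBicone f i).inr =
      𝟙 (coneBicone f i).pt :=
  (map_add HZero.mk₀ _ _).symm.trans (congrArg HZero.mk₀ (coneSum P.fam Q.fam i).total)

/-- In `H⁰(J)`, the structure morphisms of the cone of `f` are those of a mapping cone. -/
lemma qClass_cone {P Q : TwistedComplex J} (f : cocycles P Q) (i : ℤ) :
    qClass (cone f) i (i + 1) rfl =
      (coneBicone f i).fst ≫ qClass (shift 1 P) i (i + 1) rfl ≫ (coneBicone f (i + 1)).inl +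
      (coneBicone f i).fst ≫ diagClass f (i + 1) ≫ (coneBicone f (i + 1)).inr +
      (coneBicone f i).snd ≫ qClass Q i (i + 1) rfl ≫ (coneBicone f (i + 1)).inr := by
  have e : -HZero.mk₀ (P.q (i + 1) (i + 1 + 1) ⟨0, by omega⟩) =
      qClass (shift 1 P) i (i + 1) rfl := (qClass_shift_one P i (i + 1) rfl).symm
  refine (congrArg HZero.mk₀ (coneQ_apply P Q f.1 i (i + 1) 0 (by omega))).trans ?_
  rw [map_add, map_add, mk₀_sandwich, mk₀_sandwich, mk₀_sandwich, map_neg]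
  exact congrArg (fun x => (coneBicone f i).fst ≫ x ≫ (coneBicone f (i + 1)).inl +
      (coneBicone f i).fst ≫ diagClass f (i + 1) ≫ (coneBicone f (i + 1)).inr +
      (coneBicone f i).snd ≫ qClass Q i (i + 1) rfl ≫ (coneBicone f (i + 1)).inr) e

lemma diagClass_coneInr {P Q : TwistedComplex J} (f : cocycles P Q) (i : ℤ) :
    diagClass (coneInr f) i = (coneBicone f i).inr :=
  congrArg HZero.mk₀ (Family.diag_self (P := Q.fam) (Q := coneFamily P.fam Q.fam)
    (fun i => (coneSum P.fam Q.fam i).inr) i (by omega))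

lemma diagClass_coneFst {P Q : TwistedComplex J} (f : cocycles P Q) (i : ℤ) :
    diagClass (coneFst f) i = (coneBicone f i).fst :=
  congrArg HZero.mk₀ (Family.diag_self (P := coneFamily P.fam Q.fam) (Q := shiftFamily 1 P.fam)
    (fun i => (coneSum P.fam Q.fam i).fst) i (by omega))

variable {A : Type w₁} [Category.{w₂} A] [Abelian A] (F : HZero J ⥤ A) [F.Additive]

lemma map_coneBicone_total {P Q : TwistedComplex J} (f : cocycles P Q) (i : ℤ) :
    (F.mapBinaryBicone (coneBicone f i)).fst ≫ (F.mapBinaryBicone (coneBicone f i)).inl +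
      (F.mapBinaryBicone (coneBicone f i)).snd ≫ (F.mapBinaryBicone (coneBicone f i)).inr =
      𝟙 (F.mapBinaryBicone (coneBicone f i)).pt := by
  have := congrArg F.map (coneBicone_total f i)
  rwa [F.map_add, F.map_comp, F.map_comp, F.map_id] at this

lemma map_qClass_cone {P Q : TwistedComplex J} (f : cocycles P Q) (i : ℤ) :
    F.map (qClass (cone f) i (i + 1) rfl) =
      (F.mapBinaryBicone (coneBicone f i)).fst ≫ F.map (qClass (shift 1 P) i (i + 1) rfl) ≫
        (F.mapBinaryBicone (coneBicone f (i + 1))).inl +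
      (F.mapBinaryBicone (coneBicone f i)).fst ≫ F.map (diagClass f (i + 1)) ≫
        (F.mapBinaryBicone (coneBicone f (i + 1))).inr +
      (F.mapBinaryBicone (coneBicone f i)).snd ≫ F.map (qClass Q i (i + 1) rfl) ≫
        (F.mapBinaryBicone (coneBicone f (i + 1))).inr :=
  (congrArg F.map (qClass_cone f i)).trans (map_sum_of_three F _ _ _ _ _ _ _ _ _)

/-- The map induced on the homology at `j` of `F(P^i) ⟶ F(P^j) ⟶ F(P^k)`. -/
abbrev homologyMapAt {P Q : TwistedComplex J} (f : cocycles P Q) (i j k : ℤ) (h : i + 1 = j)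
    (h' : j + 1 = k) :=
  ShortComplex.homologyMap (F.mapShortComplex.map (mapAt f i j k h h'))

/-- For a cone, the sequence of homology objects is exact at the target of the morphism. -/
lemma exactAt_homologyMapAt₂ {P Q : TwistedComplex J} (f : cocycles P Q) (i j k : ℤ)
    (h : i + 1 = j) (h' : j + 1 = k) :
    ExactAt (homologyMapAt F f i j k h h') (homologyMapAt F (coneInr f) i j k h h') := by
  subst h h'
  refine exactAt_homologyMap_inr (B₁ := F.mapBinaryBicone (coneBicone f i))
    (B₂ := F.mapBinaryBicone (coneBicone f (i + 1))) _ _ _ (map_qClass_cone F f i)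
    (F.mapShortComplex.map (mapAt f _ _ _ rfl rfl))
    (F.mapShortComplex.map (mapAt (coneInr f) _ _ _ rfl rfl)) ?_ rfl ?_
  · exact (congrArg F.map (qClass_shift_one P i (i + 1) rfl)).trans F.map_neg
  · exact congrArg F.map (diagClass_coneInr f (i + 1))

/-- For a cone, the sequence of homology objects is exact at the cone. -/
lemma exactAt_homologyMapAt₃ {P Q : TwistedComplex J} (f : cocycles P Q) (i j k : ℤ)
    (h : i + 1 = j) (h' : j + 1 = k) :
    ExactAt (homologyMapAt F (coneInr f) i j k h h') (homologyMapAt F (coneFst f) i j k h h') := by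
  subst h h'
  refine exactAt_homologyMap_inr_fst (B₁ := F.mapBinaryBicone (coneBicone f i))
    (B₂ := F.mapBinaryBicone (coneBicone f (i + 1)))
    (B₃ := F.mapBinaryBicone (coneBicone f (i + 1 + 1))) _ _ _ (map_coneBicone_total F f (i + 1))
    (map_qClass_cone F f i) (map_qClass_cone F f (i + 1))
    (F.mapShortComplex.map (mapAt (coneInr f) _ _ _ rfl rfl))
    (F.mapShortComplex.map (mapAt (coneFst f) _ _ _ rfl rfl)) ?_ ?_
  · exact congrArg F.map (diagClass_coneInr f (i + 1))
  · exact congrArg F.map (diagClass_coneFst f (i + 1))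

/-- For a cone, the sequence of homology objects is exact at the shift of the source. -/
lemma exactAt_homologyMapAt₁ {P Q : TwistedComplex J} (f : cocycles P Q) (i j k : ℤ)
    (h : i + 1 = j) (h' : j + 1 = k) :
    ExactAt (homologyMapAt F (coneFst f) i j k h h')
      (homologyMapAt F ((shiftDG 1).mapCocycles f) i j k h h') := by
  subst h h'
  refine exactAt_homologyMap_fst (B₁ := F.mapBinaryBicone (coneBicone f i))
    (B₂ := F.mapBinaryBicone (coneBicone f (i + 1)))
    (B₃ := F.mapBinaryBicone (coneBicone f (i + 1 + 1))) _ _ _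
    (map_qClass_cone F f (i + 1))
    (F.mapShortComplex.map (mapAt (coneFst f) _ _ _ rfl rfl))
    (F.mapShortComplex.map (mapAt ((shiftDG 1).mapCocycles f) _ _ _ rfl rfl)) ?_ ?_ ?_
  · exact (congrArg F.map (qClass_shift_one Q i (i + 1) rfl)).trans F.map_neg
  · exact congrArg F.map (diagClass_coneFst f (i + 1))
  · exact congrArg F.map (diagClass_shift 1 f (i + 1))

end HeartHomological

/-! ### Extension of additive functors on `H⁰(J)` -/

section ShiftedHeart

lemma map_comp_inv_of_comm {C D : Type*} [Category* C] [Category* D] (G : C ⥤ D) {X Y X' Y' : C}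
    {f : X ⟶ Y} {f' : X' ⟶ Y'} (x : X ≅ X') (y : Y ≅ Y') (h : f ≫ y.hom = x.hom ≫ f') :
    G.map f' ≫ (G.mapIso y.symm).hom = (G.mapIso x.symm).hom ≫ G.map f := by
  have e : f' ≫ y.inv = x.inv ≫ f := by
    rw [Iso.comp_inv_eq, Category.assoc, h, Iso.inv_hom_id_assoc]
  exact (G.map_comp _ _).symm.trans ((congrArg G.map e).trans (G.map_comp _ _))

variable {A : Type w₁} [Category.{w₂} A] [Abelian A]

/-- Changing the signs of both morphisms of a complex gives an isomorphic complex. -/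
def shortComplexUnitsSMulIso (ε : ℤˣ) {X Y Z : A} {f f' : X ⟶ Y} {g g' : Y ⟶ Z} (w : f ≫ g = 0)
    (w' : f' ≫ g' = 0) (hf : f' = ε • f) (hg : g' = ε • g) :
    ShortComplex.mk f' g' w' ≅ ShortComplex.mk f g w :=
  ShortComplex.isoMk
    (by
      refine ⟨ε • 𝟙 X, ε • 𝟙 X, ?_, ?_⟩ <;>
      obtain rfl | rfl := Int.units_eq_one_or ε <;> simp)
    (Iso.refl Y)
    (by
      refine ⟨ε • 𝟙 Z, ε • 𝟙 Z, ?_, ?_⟩ <;>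
      obtain rfl | rfl := Int.units_eq_one_or ε <;> simp)
    (by subst hf hg; obtain rfl | rfl := Int.units_eq_one_or ε <;> simp)
    (by subst hf hg; obtain rfl | rfl := Int.units_eq_one_or ε <;> simp)

lemma homologyMap_comp_inv_of_comm {S T S' T' : ShortComplex A} {φ' : S' ⟶ T'} {φ : S ⟶ T}
    (α : S' ≅ S) (β : T' ≅ T) (h : φ' ≫ β.hom = α.hom ≫ φ) :
    ShortComplex.homologyMap φ ≫ (ShortComplex.homologyMapIso β.symm).hom =
      (ShortComplex.homologyMapIso α.symm).hom ≫ ShortComplex.homologyMap φ' := by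
  have e : φ ≫ β.inv = α.inv ≫ φ' := by
    rw [Iso.comp_inv_eq, Category.assoc, h, Iso.inv_hom_id_assoc]
  change ShortComplex.homologyMap φ ≫ ShortComplex.homologyMap β.inv =
    ShortComplex.homologyMap α.inv ≫ ShortComplex.homologyMap φ'
  rw [← ShortComplex.homologyMap_comp, e, ShortComplex.homologyMap_comp]

lemma map_units_smul {C : Type*} [Category* C] [Preadditive C] (F : C ⥤ A) [F.Additive] (ε : ℤˣ)
    {X Y : C} (f : X ⟶ Y) : F.map (ε • f) = ε • F.map f := by
  obtain rfl | rfl := Int.units_eq_one_or ε <;> simp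

lemma units_smul_id_comm (ε : ℤˣ) {X Y : A} (f : X ⟶ Y) : f ≫ (ε • 𝟙 Y) = (ε • 𝟙 X) ≫ f := by
  obtain rfl | rfl := Int.units_eq_one_or ε <;> simp

variable {J : Type u} [DGCategory.{v} J] [IsNegative J] (F : HZero J ⥤ A) [F.Additive]

/-- The complexes attached to `P[s]` are, up to the sign `(-1) ^ s` of the morphisms, translates of
those attached to `P`. -/
def shiftComplexIso (s : ℤ) (P : TwistedComplex J) :
    (heartComplex (shift s P)).map F ≅
      (complexAt P (-1 + s) (0 + s) (1 + s) (by omega) (by omega)).map F :=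
  shortComplexUnitsSMulIso s.negOnePow _ _
    ((congrArg F.map (qClass_shift s P (-1) 0 (by omega))).trans (map_units_smul F _ _))
    ((congrArg F.map (qClass_shift s P 0 1 (by omega))).trans (map_units_smul F _ _))

lemma shiftComplexIso_hom_naturality (s : ℤ) {P Q : TwistedComplex J} (f : cocycles P Q) :
    mapHeartMap F ((shiftDG s).mapCocycles f) ≫ (shiftComplexIso F s Q).hom =
      (shiftComplexIso F s P).hom ≫
        F.mapShortComplex.map (mapAt f (-1 + s) (0 + s) (1 + s) (by omega) (by omega)) := by
  have e : ∀ i, F.map (diagClass ((shiftDG s).mapCocycles f) i) = F.map (diagClass f (i + s)) :=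
    fun i => congrArg F.map (diagClass_shift s f i)
  refine ShortComplex.hom_ext _ _ ?_ ?_ ?_
  · refine (congrArg (· ≫ (s.negOnePow • 𝟙 _)) (e (-1))).trans ?_
    exact units_smul_id_comm _ _
  · refine (congrArg (· ≫ 𝟙 _) (e 0)).trans ?_
    exact (Category.comp_id _).trans (Category.id_comp _).symm
  · refine (congrArg (· ≫ (s.negOnePow • 𝟙 _)) (e 1)).trans ?_
    exact units_smul_id_comm _ _

lemma exactAt_heartHomology_map_shift (s : ℤ) {P Q R : TwistedComplex J} (f : cocycles P Q)
    (g : cocycles Q R)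
    (h : ExactAt (homologyMapAt F f (-1 + s) (0 + s) (1 + s) (by omega) (by omega))
      (homologyMapAt F g (-1 + s) (0 + s) (1 + s) (by omega) (by omega))) :
    ExactAt ((heartHomology F).map ((shiftTr J s).map (HZero.mk f)))
      ((heartHomology F).map ((shiftTr J s).map (HZero.mk g))) := by
  have e : ∀ {P Q : TwistedComplex J} (f : cocycles P Q),
      homologyMapAt F f (-1 + s) (0 + s) (1 + s) (by omega) (by omega) ≫
        (ShortComplex.homologyMapIso (shiftComplexIso F s Q).symm).hom =
      (ShortComplex.homologyMapIso (shiftComplexIso F s P).symm).hom ≫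
        (heartHomology F).map ((shiftTr J s).map (HZero.mk f)) :=
    fun {P Q} f => homologyMap_comp_inv_of_comm _ _ (shiftComplexIso_hom_naturality F s f)
  exact h.of_iso _ _ _ (e f) (e g)

lemma isZero_map_of_id_eq_zero {X : J} (hX : id X = 0) : IsZero (F.obj (HZero.of X)) := by
  rw [IsZero.iff_id_eq_zero, ← F.map_id]
  have e : 𝟙 (HZero.of X) = 0 := (congrArg HZero.mk₀ hX).trans (map_zero _)
  rw [e, F.map_zero]

end ShiftedHeart

section HeartHomological

variable {A : Type w₁} [Category.{w₂} A] [Abelian A]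

variable {J : Type u} [DGCategory.{v} J] [HasFiniteSums J] [IsNegative J]
  (F : HZero J ⥤ A) [F.Additive]

lemma isHomological_heartHomology : IsHomological (heartHomology F) where
  additive :=
    { map_add := by
        intro P Q f g
        obtain ⟨f, rfl⟩ := HZero.mk_surjective f
        obtain ⟨g, rfl⟩ := HZero.mk_surjective g
        exact map_add (heartHomologyMap F P.obj Q.obj) f g }
  exact₂ := by
    rintro X Y Z a b c ⟨P, Q, f, x, y, z, ha, hb, hc⟩ s
    let G := shiftTr J s ⋙ heartHomology F
    exact (exactAt_heartHomology_map_shift F s f (coneInr f)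
      (exactAt_homologyMapAt₂ F f _ _ _ _ _)).of_iso (G.mapIso x.symm) (G.mapIso y.symm)
      (G.mapIso z.symm)
      (map_comp_inv_of_comm G x y ha) (map_comp_inv_of_comm G y z hb)
  exact₃ := by
    rintro X Y Z a b c ⟨P, Q, f, x, y, z, ha, hb, hc⟩ s
    let G := shiftTr J s ⋙ heartHomology F
    exact (exactAt_heartHomology_map_shift F s (coneInr f) (coneFst f)
      (exactAt_homologyMapAt₃ F f _ _ _ _ _)).of_iso (G.mapIso y.symm) (G.mapIso z.symm)
      (G.mapIso ((shiftTr J 1).mapIso x).symm)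
      (map_comp_inv_of_comm G y z hb) (map_comp_inv_of_comm G z ((shiftTr J 1).mapIso x) hc)
  exact₁ := by
    rintro X Y Z a b c ⟨P, Q, f, x, y, z, ha, hb, hc⟩ s
    let G := shiftTr J s ⋙ heartHomology F
    have ha' : (shiftTr J 1).map a ≫ ((shiftTr J 1).mapIso y).hom =
        ((shiftTr J 1).mapIso x).hom ≫ HZero.mk ((shiftDG 1).mapCocycles f) :=
      ((shiftTr J 1).map_comp _ _).symm.trans
        ((congrArg (shiftTr J 1).map ha).trans ((shiftTr J 1).map_comp _ _))
    exact (exactAt_heartHomology_map_shift F s (coneFst f) ((shiftDG 1).mapCocycles f)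
      (exactAt_homologyMapAt₁ F f _ _ _ _ _)).of_iso (G.mapIso z.symm)
      (G.mapIso ((shiftTr J 1).mapIso x).symm) (G.mapIso ((shiftTr J 1).mapIso y).symm)
      (map_comp_inv_of_comm G z ((shiftTr J 1).mapIso x) hc)
      (map_comp_inv_of_comm G ((shiftTr J 1).mapIso x) ((shiftTr J 1).mapIso y) ha')

/-- The object in degree zero of `X[n]` is zero for `n ≠ 0`. -/
lemma isAcyclic_heartHomology : IsAcyclic (heartHomology F) := by
  intro X n hn
  have h : IsZero ((heartComplex (shift n (single X))).map F).X₂ :=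
    isZero_map_of_id_eq_zero F (id_singleX_of_ne X (0 + n) (by omega))
  exact (ShortComplex.exact_iff_isZero_homology _).1 (ShortComplex.exact_of_isZero_X₂ _ h)

end HeartHomological

/-! ### The equivalence of categories -/

section Equivalence

variable {J : Type u} [DGCategory.{v} J] [HasFiniteSums J] [IsNegative J]
  {A : Type w₁} [Category.{w₂} A] [Abelian A]

lemma isIso_singleToOpcycles (F : HZero J ⥤ A) [F.Additive] (X : J) :
    IsIso (singleToOpcycles F X) :=
  ShortComplex.isIso_pOpcycles _
    ((isZero_map_of_id_eq_zero F (id_singleX_of_ne X (-1) (by omega))).eq_of_src _ _)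

lemma isIso_homologyι_single (F : HZero J ⥤ A) [F.Additive] (X : J) :
    IsIso ((heartComplex (single X)).map F).homologyι :=
  ShortComplex.isIso_homologyι _
    ((isZero_map_of_id_eq_zero F (id_singleX_of_ne X 1 (by omega))).eq_of_tgt _ _)

/-- For an object `X` of `J` concentrated in degree zero, the homology of
`F(P^{-1}) ⟶ F(P^0) ⟶ F(P^1)` is `F(X)`. -/
def heartHomologySingleIso (F : HZero J ⥤ A) [F.Additive] (X : J) :
    F.obj (HZero.of X) ≅ ((heartComplex (single X)).map F).homology :=
  have := isIso_singleToOpcycles F X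
  have := isIso_homologyι_single F X
  asIso (singleToOpcycles F X) ≪≫ (asIso ((heartComplex (single X)).map F).homologyι).symm

lemma heartHomologySingleIso_hom_comp_homologyι (F : HZero J ⥤ A) [F.Additive] (X : J) :
    (heartHomologySingleIso F X).hom ≫ ((heartComplex (single X)).map F).homologyι =
      singleToOpcycles F X := by
  have := isIso_homologyι_single F X
  simp [heartHomologySingleIso]

/-- Naturality of `heartHomologySingleIso` in both variables at once. -/
lemma heartHomologySingleIso_naturality {F G : HZero J ⥤ A} [F.Additive] [G.Additive] {X Y : J}
    (φ : (heartComplex (single X)).map F ⟶ (heartComplex (single Y)).map G) :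
    (show F.obj (HZero.of X) ⟶ G.obj (HZero.of Y) from φ.τ₂) ≫ (heartHomologySingleIso G Y).hom =
      (heartHomologySingleIso F X).hom ≫ ShortComplex.homologyMap φ := by
  have := isIso_homologyι_single G Y
  rw [← cancel_mono ((heartComplex (single Y)).map G).homologyι, Category.assoc, Category.assoc,
    heartHomologySingleIso_hom_comp_homologyι, ShortComplex.homologyι_naturality,
    ← Category.assoc, heartHomologySingleIso_hom_comp_homologyι]
  exact (ShortComplex.p_opcyclesMap φ).symm

variable (J A) in
/-- The functor `F ↦ (P ↦ ker(F(P^0) ⟶ F(P^1)) / im(F(P^{-1}) ⟶ F(P^0)))`, with values in the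
category of acyclic homological functors. -/
def extension : (HZero J ⥤+ A) ⥤ AcyclicHomologicalFunctor J A :=
  (acyclicHomological J A).lift (heartHomologyFunctor J A)
    (fun F => ⟨isHomological_heartHomology F.obj, isAcyclic_heartHomology F.obj⟩)

variable (J A) in
/-- An acyclic homological functor is recovered from its restriction to `H⁰(J)`. -/
def restrictionUnitIso : 𝟭 (AcyclicHomologicalFunctor J A) ≅ restriction J A ⋙ extension J A :=
  NatIso.ofComponents
    (fun H => (acyclicHomological J A).isoMk ((homologyNatIso J A).app H))
    (fun η => ObjectProperty.hom_ext _ ((homologyNatIso J A).hom.naturality η))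

/-- An additive functor on `H⁰(J)` is the restriction of its extension. -/
def extensionRestrictionIso (F : HZero J ⥤ A) [F.Additive] :
    F ≅ incl J ⋙ heartHomology F :=
  NatIso.ofComponents (fun X => heartHomologySingleIso F X.obj) (by
    intro X Y f
    obtain ⟨f, rfl⟩ := HZero.mk_surjective f
    exact heartHomologySingleIso_naturality (mapHeartMap F ((singleDG J).mapCocycles f)))

variable (J A) in
/-- The isomorphism `extensionRestrictionIso`, natural in the functor. -/
def restrictionCounitIso : extension J A ⋙ restriction J A ≅ 𝟭 (HZero J ⥤+ A) :=
  (NatIso.ofComponents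
    (fun F => (additiveFunctor (HZero J) A).isoMk (extensionRestrictionIso F.obj))
    (fun {F G} η => ObjectProperty.hom_ext _ (by
      ext X
      exact heartHomologySingleIso_naturality
        ((heartComplex (single X.obj)).mapNatTrans η.hom))) :
    𝟭 (HZero J ⥤+ A) ≅ extension J A ⋙ restriction J A).symm

end Equivalence

end TwistedComplex

end DGCategory

open DGCategory DGCategory.TwistedComplex in
/-- Let `J` be a negative dg-category with finite sums and `A` an abelian category. For every
`J`-acyclic homological functor `H : Tr(J) ⥤ A` and every twisted complex `P`, there is an
isomorphism `H(P) ≅ ker(H(P^0) ⟶ H(P^1)) / im(H(P^{-1}) ⟶ H(P^0))`, natural in `P ∈ Tr(J)` and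
in `H`, which is the obvious one if `P` is an object of `J` concentrated in degree `0`. Moreover,
the composition with `H⁰(J) ⥤ Tr(J)` is an equivalence from the category of `J`-acyclic
homological functors `Tr(J) ⥤ A` to the category of additive functors `H⁰(J) ⥤ A`. -/
theorem lemma2p4 {J : Type u} [DGCategory.{v} J] [HasFiniteSums J] [IsNegative J]
    {A : Type w₁} [Category.{w₂} A] [Abelian A] :
    (∃ e : (acyclicHomological J A).ι ≅ restriction J A ⋙ heartHomologyFunctor J A,
      ∀ (H : AcyclicHomologicalFunctor J A) (X : J),
        (e.hom.app H).app ((incl J).obj (HZero.of X)) ≫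
            ((heartComplex (single X)).map ((restriction J A).obj H).obj).homologyι =
          singleToOpcycles ((restriction J A).obj H).obj X) ∧
    (restriction J A).IsEquivalence :=
  ⟨⟨homologyNatIso J A, homologyNatIso_single⟩,
    (CategoryTheory.Equivalence.mk (restriction J A) (extension J A) (restrictionUnitIso J A)
      (restrictionCounitIso J A)).isEquivalence_functor⟩
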